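/- A \emph{combinatorial surface} with $N$ triangles is a closed oriented surface obtained from $N$ oriented triangles by gluing their $3N$ sides in pairs, reversing orientation (sides of the same triangle may be glued to each other, and edges may be loops). Let $\mathrm{Comb}_N\mathrm{Mod}$ be the set of these surfaces up to homeomorphisms that send edges to edges and faces to faces. A \emph{combinatorial pair of pants} $P$ is a finite complex made of vertices, edges and triangles, embedded in a three-holed sphere as a deformation retract, together with its three boundary curves, which are closed edge paths; edges that lie in no triangle (\emph{stranded} edges) are allowed. A \emph{combinatorial pants decomposition} of a combinatorial surface $\Sigma$ of genus $g\ge 2$ consists of $2g-2$ combinatorial pairs of pants, an orientation-compatible identification in pairs of their $6g-6$ boundary curves (of equal lengths, each curve being identified with a different one), and an isomorphism of the resulting complex with $\Sigma$. Its \emph{total length} is the sum of the numbers of edges of its $3g-3$ curves. It is \emph{minimal} if each of these curves, as a closed edge path in $\Sigma$, has the least number of edges among all closed edge paths in its free homotopy class. Form a graph from $P$ as follows: each vertex of $P$ whose link has $d$ components, more than one of which is an interval, is replaced by a star with $d$ edges; then paths of edges are shrunk to single edges, and maximal groups of triangles glued along edges are shrunk to single vertices. The vertices of this graph are called \emph{clusters},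 and the degree of a cluster is its degree in this graph. A cluster is \emph{disk-type} if it is a single point or its interior is an open disk. The pair of pants $P$ is \emph{tight} if no disk-type cluster has degree $2$, and a pants decomposition is \emph{tight} if it is minimal and all its pairs of pants are tight. \textbf{Theorem.} There is a constant $c>0$ such that for all integers $N\ge 0$ and $g\ge 2$ and all real $L$, the number of elements of $\mathrm{Comb}_N\mathrm{Mod}$ that are connected of genus $g$ and admit a tight combinatorial pants decomposition of total length at most $L$ is at most $$\exp(cN)\, g^g\, (L/g)^{6g}.$$ -/

import Mathlib

noncomputable section

/-! ## Combinatorial maps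

A finite cell complex on an oriented closed surface is encoded by its *darts* (oriented edges).
A dart `d` runs from its source to its target, and the face containing `d` lies on its left.
`edge d` is the same edge with the opposite orientation, and `face d` is the next dart along the
boundary of the face on the left of `d`. -/

/-- A combinatorial map with dart set `D`. -/
structure CombMap (D : Type) where
  edge : Equiv.Perm D
  face : Equiv.Perm D
  edge_edge : ∀ d, edge (edge d) = d
  edge_ne : ∀ d, edge d ≠ d

namespace CombMap

variable {D : Type} (M : CombMap D)

/-- `vert d = face (edge d)` is the next dart with the same source as `d`. -/
def vert : Equiv.Perm D := M.edge.trans M.face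

/-- The vertices, edges and faces are the cycles of the three permutations: the class of `d` is
its source, its underlying edge, and the face on its left. -/
abbrev Vertex : Type := Quotient (Equiv.Perm.SameCycle.setoid M.vert)
abbrev Edge : Type := Quotient (Equiv.Perm.SameCycle.setoid M.edge)
abbrev Face : Type := Quotient (Equiv.Perm.SameCycle.setoid M.face)

def vertexOf (d : D) : M.Vertex := Quotient.mk _ d
def edgeOf (d : D) : M.Edge := Quotient.mk _ d
def faceOf (d : D) : M.Face := Quotient.mk _ d

def eulerChar : ℤ := (Nat.card M.Vertex : ℤ) - Nat.card M.Edge + Nat.card M.Face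

/-- The underlying surface is nonempty and connected. -/
def Connected : Prop :=
  Nonempty D ∧ ∀ d d', Relation.EqvGen (fun a b => b = M.edge a ∨ b = M.face a) d d'

/-- The closed walk along the boundary of the face on the left of `d`, starting with `d`. -/
def faceWalk (d : D) : List D := List.iterate M.face d (Function.minimalPeriod M.face d)

end CombMap

/-! ## Combinatorial surfaces -/

/-- The sides of `N` oriented triangles; side `i` of a triangle runs from its corner `i` to its
corner `i + 1`. -/
abbrev Side (N : ℕ) : Type := Fin N × ZMod 3

/-- The next side of the same triangle. -/
def nextSide (N : ℕ) : Equiv.Perm (Side N) :=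
  Equiv.prodCongr (Equiv.refl _) (Equiv.addRight 1)

/-- A combinatorial surface made of `N` triangles: the sides of the triangles are glued in pairs
(orientation reversingly, so that the result is an oriented closed surface). Two sides of the same
triangle may be glued together, and edges may become loops. -/
@[ext] structure CombSurface (N : ℕ) where
  glue : Equiv.Perm (Side N)
  glue_glue : ∀ d, glue (glue d) = d
  glue_ne : ∀ d, glue d ≠ d

namespace CombSurface

variable {N : ℕ}

/-- The triangulation of the surface, as a combinatorial map. -/
def toMap (S : CombSurface N) : CombMap (Side N) where
  edge := S.glue
  face := nextSide N
  edge_edge := S.glue_glue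
  edge_ne := S.glue_ne

/-- The surface is connected and has genus `g`. -/
def HasGenus (S : CombSurface N) (g : ℕ) : Prop :=
  S.toMap.Connected ∧ S.toMap.eulerChar = 2 - 2 * (g : ℤ)

/-- There is a homeomorphism that sends edges to edges and faces to faces. It induces a bijection
`φ` of the sides; `flip d` tells whether it reverses the orientation of the triangle of `d`, which
is constant on each connected component. -/
def Equivalent (S S' : CombSurface N) : Prop :=
  ∃ (φ : Equiv.Perm (Side N)) (flip : Side N → Bool),
    (∀ d, flip (nextSide N d) = flip d) ∧
    (∀ d, flip (S.glue d) = flip d) ∧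
    (∀ d, φ (S.glue d) = S'.glue (φ d)) ∧
    (∀ d, φ (nextSide N d) =
      if flip d = true then (nextSide N).symm (φ d) else nextSide N (φ d))

theorem Equivalent.refl (S : CombSurface N) : Equivalent S S :=
  ⟨1, fun _ => false, by simp⟩

theorem Equivalent.symm {S S' : CombSurface N} (h : Equivalent S S') : Equivalent S' S := by
  obtain ⟨φ, flip, h1, h2, h3, h4⟩ := h
  have key : ∀ d, φ.symm (nextSide N d) =
      if flip (φ.symm d) = true then (nextSide N).symm (φ.symm d)
      else nextSide N (φ.symm d) := by
    intro d
    rw [Equiv.symm_apply_eq]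
    by_cases hf : flip (φ.symm d) = true
    · have h5 := h4 ((nextSide N).symm (φ.symm d))
      have h6 := h1 ((nextSide N).symm (φ.symm d))
      rw [Equiv.apply_symm_apply] at h5 h6
      rw [← h6, if_pos hf, Equiv.apply_symm_apply, Equiv.eq_symm_apply] at h5
      rw [if_pos hf, ← h5]
    · rw [if_neg hf, h4, if_neg hf, Equiv.apply_symm_apply]
  have keyg : ∀ d, φ.symm (S'.glue d) = S.glue (φ.symm d) := by
    intro d
    rw [Equiv.symm_apply_eq, h3, Equiv.apply_symm_apply]
  refine ⟨φ.symm, fun d => flip (φ.symm d), ?_, ?_, keyg, key⟩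
  · intro d
    simp only [key]
    split_ifs with hf
    · rw [← h1, Equiv.apply_symm_apply]
    · exact h1 _
  · intro d
    simp only [keyg, h2]

theorem Equivalent.trans {S S' S'' : CombSurface N} (h : Equivalent S S')
    (h' : Equivalent S' S'') : Equivalent S S'' := by
  obtain ⟨φ, flip, h1, h2, h3, h4⟩ := h
  obtain ⟨ψ, flop, k1, k2, k3, k4⟩ := h'
  have k1' : ∀ d, flop ((nextSide N).symm d) = flop d := fun d => by
    rw [← k1, Equiv.apply_symm_apply]
  have k4' : ∀ d, ψ ((nextSide N).symm d) =
      if flop d = true then nextSide N (ψ d) else (nextSide N).symm (ψ d) := by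
    intro d
    have h5 := k4 ((nextSide N).symm d)
    rw [Equiv.apply_symm_apply, k1'] at h5
    split_ifs at h5 ⊢
    · rw [h5, Equiv.apply_symm_apply]
    · rw [h5, Equiv.symm_apply_apply]
  refine ⟨φ.trans ψ, fun d => xor (flip d) (flop (φ d)), ?_, ?_, ?_, ?_⟩
  · intro d
    simp only [h1, h4]
    split_ifs <;> simp [k1, k1']
  · intro d
    simp only [h2, h3, k2]
  · intro d
    simp [h3, k3]
  · intro d
    simp only [Equiv.trans_apply, h4]
    by_cases hf : flip d = true <;> by_cases hg : flop (φ d) = true <;>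
      simp [k4, k4', hf, hg]

instance setoid (N : ℕ) : Setoid (CombSurface N) where
  r := Equivalent
  iseqv := ⟨Equivalent.refl, Equivalent.symm, Equivalent.trans⟩

instance : Finite (CombSurface N) :=
  Finite.of_injective CombSurface.glue fun _ _ h => CombSurface.ext h

/-! ### Simplicial closed curves and free homotopy -/

/-- A cyclic sequence of oriented edges is a closed curve: the target of each one is the source of
the next one. -/
def IsClosedCurve (S : CombSurface N) (w : Cycle (Side N)) : Prop :=
  w.Chain fun a b => S.toMap.vertexOf (S.glue a) = S.toMap.vertexOf b

/-- The elementary homotopies of simplicial closed curves: removing an edge followed by its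
inverse, and removing the boundary of a triangle. -/
inductive ElementaryHomotopy (S : CombSurface N) : Cycle (Side N) → Cycle (Side N) → Prop
  | backtrack (d : Side N) (w : List (Side N)) :
      S.IsClosedCurve ((d :: S.glue d :: w : List (Side N)) : Cycle (Side N)) →
      S.ElementaryHomotopy ((d :: S.glue d :: w : List (Side N)) : Cycle (Side N)) w
  | triangle (d : Side N) (w : List (Side N)) :
      S.IsClosedCurve
        ((d :: nextSide N d :: nextSide N (nextSide N d) :: w : List (Side N)) :
          Cycle (Side N)) →
      S.ElementaryHomotopy
        ((d :: nextSide N d :: nextSide N (nextSide N d) :: w : List (Side N)) :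
          Cycle (Side N)) w

/-- Free homotopy of simplicial closed curves on a connected surface (the empty cycle stands for
the constant curves). -/
def FreelyHomotopic (S : CombSurface N) (w w' : Cycle (Side N)) : Prop :=
  Relation.EqvGen S.ElementaryHomotopy w w'

/-- A simplicial closed curve of minimal length in its free homotopy class. -/
def IsMinimal (S : CombSurface N) (w : Cycle (Side N)) : Prop :=
  ∀ w', S.FreelyHomotopic w w' → w.length ≤ w'.length

end CombSurface

/-- The combinatorial moduli space: combinatorial surfaces made of `N` triangles, up to
homeomorphisms that send edges to edges and faces to faces. -/
abbrev CombMod (N : ℕ) : Type := Quotient (CombSurface.setoid N)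

/-! ## Combinatorial pairs of pants -/

/-- A combinatorial pair of pants: a complex `Δ`, made of edges and triangles, that is embedded in
a three-holed sphere as a deformation retract. Capping off the three holes by discs, this means
that the graph of the edges of `Δ` is a connected graph on the sphere, that three of its faces
(those of the darts `base k`) are the holes, and that all other faces are the triangles of `Δ`.
The boundary curves are the boundary walks of the three holes, `base k` being a base point of the
`k`-th curve. An edge of `Δ` need not belong to a triangle. -/
structure CombPants where
  Dart : Type
  finite : Finite Dart
  map : CombMap Dart
  connected : map.Connected
  spherical : map.eulerChar = 2
  base : Fin 3 → Dart
  base_injective : Function.Injective fun k => map.faceOf (base k)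
  triangle : ∀ d, (∀ k, map.faceOf d ≠ map.faceOf (base k)) →
    map.face d ≠ d ∧ map.face (map.face (map.face d)) = d

namespace CombPants

variable (P : CombPants)

/-- The dart `d` belongs to a boundary curve (there is a hole on its left). -/
def IsBdry (d : P.Dart) : Prop := ∃ k, P.map.faceOf d = P.map.faceOf (P.base k)

/-- The length of the `k`-th boundary curve. -/
def bdryLength (k : Fin 3) : ℕ := (P.map.faceWalk (P.base k)).length

/-- The triangle on the left of `d` and the triangle on the left of `d'` belong to the same group
of triangles that are glued along edges. -/
def SameCluster (d d' : P.Dart) : Prop :=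
  Relation.EqvGen
    (fun a b => ¬ P.IsBdry a ∧ ¬ P.IsBdry b ∧ (b = P.map.face a ∨ b = P.map.edge a)) d d'

/-- The cluster that contains the triangle on the left of `d` (where `d` is not in the boundary),
as the set of the sides of its triangles. -/
def cluster (d : P.Dart) : Set P.Dart := {d' | P.SameCluster d d'}

/-- The interior of the cluster `C`, which is a connected open surface of genus `0`, consists of
the triangles of `C` and of the edges and vertices all of whose adjacent faces are triangles
of `C`. It is homeomorphic to a disk if and only if its Euler characteristic is `1`. -/
def DiskType (C : Set P.Dart) : Prop :=
  ({v : P.map.Vertex | ∀ d, P.map.vertexOf d = v → d ∈ C}.ncard : ℤ)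
    - {e : P.map.Edge | ∀ d, P.map.edgeOf d = e → d ∈ C}.ncard
    + {f : P.map.Face | ∀ d, P.map.faceOf d = f → d ∈ C}.ncard = 1

/-- The link of a vertex `v` that is not interior has one connected component for each boundary
dart `d` with source `v`: in the cyclic order around `v`, the component that starts with `d`.
The component is a point if there is a hole on both sides of `d` (then `d` is a stranded edge);
otherwise it is an interval, and the triangles at `v` between whose edges it runs belong to the
cluster of `edge d`. -/
def IsPointComponent (d : P.Dart) : Prop := P.IsBdry d ∧ P.IsBdry (P.map.edge d)

def IsIntervalComponent (d : P.Dart) : Prop := P.IsBdry d ∧ ¬ P.IsBdry (P.map.edge d)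

open Classical in
/-- The number of ends of strands that are attached to a cluster at the interval component `d` of
the link of a boundary vertex `v`. If the link of `v` contains a further interval, `v` is replaced
by a star with one edge for each component of the link, so that there is one strand to the centre
of this star (of length zero, or part of a longer one if the star has just two edges). Otherwise
the strands attached there are those that start with a stranded edge at `v`. -/
def attachedEnds (d : P.Dart) : ℕ :=
  if ∃ d', d' ≠ d ∧ P.IsIntervalComponent d' ∧ P.map.vertexOf d' = P.map.vertexOf d then 1
  else {d' | P.IsPointComponent d' ∧ P.map.vertexOf d' = P.map.vertexOf d}.ncard

/-- The degree of the cluster `C` in the graph of clusters and strands. -/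
def clusterDegree (C : Set P.Dart) : ℕ :=
  ∑ᶠ d ∈ {d | P.IsIntervalComponent d ∧ P.map.edge d ∈ C}, P.attachedEnds d

/-- The pair of pants is tight: it has no loose disk, that is, no disk-type cluster of degree `2`.
(Clusters that are single points need not be considered: a point at which just two strands meet
is no cluster, as paths of edges are shrunk to single strands.) -/
def Tight : Prop :=
  ∀ d, ¬ P.IsBdry d → ¬ (P.DiskType (P.cluster d) ∧ P.clusterDegree (P.cluster d) = 2)

end CombPants

/-! ## Combinatorial pants decompositions -/

/-- The disjoint union of a family of pairs of pants. -/
def unionMap {n : ℕ} (P : Fin n → CombPants) : CombMap (Σ i, (P i).Dart) where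
  edge := Equiv.sigmaCongrRight fun i => (P i).map.edge
  face := Equiv.sigmaCongrRight fun i => (P i).map.face
  edge_edge := by
    rintro ⟨i, d⟩
    exact congrArg (Sigma.mk i) ((P i).map.edge_edge d)
  edge_ne := by
    rintro ⟨i, d⟩ h
    exact (P i).map.edge_ne d (by simpa using h)

/-- A combinatorial pants decomposition of `S` into `n` pairs of pants: a family of pairs of pants,
a gluing of their boundary curves in pairs, and an isomorphism between the resulting complex
and `S`. -/
structure PantsDecomposition {N : ℕ} (S : CombSurface N) (n : ℕ) where
  pants : Fin n → CombPants
  /-- The gluing: the boundary edge `x` is identified with the boundary edge `mate x`, with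
  opposite orientation (`mate` is irrelevant on darts that are not in the boundary). -/
  mate : (Σ i, (pants i).Dart) → (Σ i, (pants i).Dart)
  mate_bdry : ∀ x, (pants x.1).IsBdry x.2 → (pants (mate x).1).IsBdry (mate x).2
  mate_mate : ∀ x, (pants x.1).IsBdry x.2 → mate (mate x) = x
  /-- `mate` identifies whole boundary curves, reversing their directions. -/
  mate_face : ∀ x, (pants x.1).IsBdry x.2 →
    mate ((unionMap pants).face x) = (unionMap pants).face.symm (mate x)
  /-- Each boundary curve is glued to another one. -/
  mate_ne : ∀ x, (pants x.1).IsBdry x.2 →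
    (unionMap pants).faceOf (mate x) ≠ (unionMap pants).faceOf x
  /-- The projection of the oriented edges of the pairs of pants to those of `S`, that is, the
  quotient map followed by the isomorphism. -/
  proj : (Σ i, (pants i).Dart) → Side N
  proj_edge : ∀ x, proj ((unionMap pants).edge x) = S.glue (proj x)
  proj_mate : ∀ x, (pants x.1).IsBdry x.2 → proj (mate x) = S.glue (proj x)
  /-- The triangles of the pairs of pants correspond bijectively to those of `S`. -/
  proj_face : ∀ x, ¬ (pants x.1).IsBdry x.2 → proj ((unionMap pants).face x) = nextSide N (proj x)
  proj_bijOn : Set.BijOn proj {x | ¬ (pants x.1).IsBdry x.2} Set.univ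
  /-- The oriented edges of `S` are those of the pairs of pants, modulo the gluing. -/
  proj_eq_iff : ∀ x y, proj x = proj y ↔
    Relation.EqvGen
      (fun a b => (pants a.1).IsBdry a.2 ∧ b = (unionMap pants).edge (mate a)) x y
  /-- The vertices of `S` are those of the pairs of pants, modulo the gluing (the source of `a` is
  the target of `mate a`). -/
  proj_vertex_iff : ∀ x y, S.toMap.vertexOf (proj x) = S.toMap.vertexOf (proj y) ↔
    Relation.EqvGen
      (fun a b => (unionMap pants).vertexOf a = (unionMap pants).vertexOf b ∨
        ((pants a.1).IsBdry a.2 ∧ b = (unionMap pants).face (mate a))) x y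

namespace PantsDecomposition

variable {N : ℕ} {S : CombSurface N} {n : ℕ} (Q : PantsDecomposition S n)

/-- The boundary curve `k` of the `i`-th pair of pants, as a simplicial closed curve on `S`. -/
def bdryCurve (i : Fin n) (k : Fin 3) : Cycle (Side N) :=
  (((Q.pants i).map.faceWalk ((Q.pants i).base k)).map fun d => Q.proj ⟨i, d⟩ : List (Side N))

/-- All boundary curves have minimal length in their free homotopy classes. -/
def Minimal : Prop := ∀ i k, S.IsMinimal (Q.bdryCurve i k)

/-- The decomposition is minimal, and all its pairs of pants are tight. -/
def Tight : Prop := Q.Minimal ∧ ∀ i, (Q.pants i).Tight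

/-- The sum of the lengths of the curves of the pants decomposition, each of which is a boundary
curve on two sides. -/
def totalLength : ℝ := (∑ i, ∑ k, ((Q.pants i).bdryLength k : ℝ)) / 2

end PantsDecomposition

/-- The classes of combinatorial surfaces of genus `g` made of `N` triangles that admit a tight
pants decomposition (into `2g - 2` pairs of pants) of total length at most `L`. -/
def tightlyDecomposable (N g : ℕ) (L : ℝ) : Set (CombMod N) :=
  {x | ∃ S : CombSurface N, Quotient.mk _ S = x ∧ S.HasGenus g ∧
    ∃ Q : PantsDecomposition S (2 * g - 2), Q.Tight ∧ Q.totalLength ≤ L}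

end

/-! The surfaces are counted through codes. A tight pants decomposition is recovered, up to
isomorphism, from a code of each of its `n = 2g - 2` pairs of pants, the matching of the `3n`
boundary curves, and the lengths and twists of the `3g - 3` glued curves
(`DecompCode.Describes.equivalent`). The matchings contribute about `g ^ (3g)` and the lengths and
twists about `(L / g) ^ (6g)`. The labels of the pairs of pants are arbitrary and a connected code
has at most `n` symmetries, so one divides by `n! / n`, about `g ^ (2g)`; this leaves `g ^ g`.
Factors exponential in `g` go into `exp (cN)` because `g ≤ N`.

What has to be shown is that the codes of the pairs of pants are exponential in the number of
triangles, although strands of stranded edges may be long. After the interior vertices of strands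
are forgotten, two facts suffice.

There are few strands: besides the edges of triangles only 18 darts remain. Two strands between the
same two holes, or two bridges that separate the same holes, bound a part of the complex without a
hole. This bigon is simply connected, and minimality makes its two sides geodesics, so they have
equal length and meet only at equal distance from the ends (`CombPants.Geodesic.exists_bigon`). A
cluster inside it fills the region between two consecutive common vertices; it is a disk with
exactly two strand ends, which tightness forbids. Hence the sides coincide
(`CombPants.Bigon.edge_eq`) and the two strands are parts of a single one.

The lengths of the strands need not be recorded: they solve a linear system given by the three
boundary lengths, which has at most one solution since a bridge inside one hole forces every strand
to touch that hole (`CombPants.Geodesic.chainLength_eq`).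

The topology is expressed by permutations. The genus of a pair of permutations is not negative
(`defect_nonneg`); deleting an edge multiplies by a transposition, and in genus zero this yields the
Jordan curve theorem (`CombMap.Spherical.jordan`). Simple connectedness means that an edge function
whose product around all faces but one is trivial has a potential
(`CombMap.Spherical.exists_potential`); it is applied to an edge function with values in the
fundamental group (`CombMap.exists_detecting`). Finally a planar map is coded by the walk around a
spanning tree: the tree edges and the other edges are two matchings without crossings, which are
determined by one word (`CombMap.exists_contour`, `CombMap.IsContour.unique`). -/

open Equiv

/-! ### Cycles of permutations and transpositions -/

section Cycles

variable {D : Type}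

/-- The partition of `D` into the cycles of `π`. -/
def cyc (π : Perm D) : Setoid D := Perm.SameCycle.setoid π

/-- The smallest equivalence relation that relates `x` and `y`. -/
def pairRel (x y : D) : Setoid D := Relation.EqvGen.setoid fun a b => a = x ∧ b = y

theorem pairRel_le {x y : D} {s : Setoid D} : pairRel x y ≤ s ↔ s x y := by
  constructor
  · intro h
    exact h (Relation.EqvGen.rel _ _ ⟨rfl, rfl⟩)
  · intro h
    refine Setoid.eqvGen_le ?_
    rintro a b ⟨rfl, rfl⟩
    exact h

theorem cyc_le {π : Perm D} {s : Setoid D} : cyc π ≤ s ↔ ∀ x, s x (π x) := by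
  constructor
  · intro h x
    exact h ⟨1, by simp⟩
  · rintro h x y ⟨i, rfl⟩
    revert x
    induction i using Int.induction_on with
    | zero => exact fun x => s.refl x
    | succ i ih =>
      intro x
      have h2 : (π ^ ((i : ℤ) + 1)) x = (π ^ (i : ℤ)) (π x) := by
        rw [zpow_add_one]; rfl
      rw [h2]; exact s.trans (h x) (@ih _)
    | pred i ih =>
      intro x
      have h2 : (π ^ (-(i : ℤ) - 1)) x = (π ^ (-(i : ℤ))) (π⁻¹ x) := by
        rw [zpow_sub_one]; rfl
      rw [h2]
      refine s.trans ?_ (@ih _)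
      have := h (π⁻¹ x)
      rw [show π (π⁻¹ x) = x from π.apply_symm_apply x] at this
      exact s.symm this

theorem cyc_apply (π : Perm D) (x : D) : cyc π x (π x) := cyc_le.1 le_rfl x

/-- The number of cycles, fixed points included. -/
noncomputable def numCycles (π : Perm D) : ℕ := Nat.card (Quotient (cyc π))

theorem cyc_inv (π : Perm D) : cyc π⁻¹ = cyc π := by
  ext x y
  exact Perm.sameCycle_inv

theorem numCycles_inv (π : Perm D) : numCycles π⁻¹ = numCycles π := by
  rw [numCycles, cyc_inv, numCycles]

/-- The right-hand side is itself an equivalence relation that contains `s` and the new pair, so it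
contains their join. -/
theorem of_sup_pairRel {s : Setoid D} {x y a b : D} (h : (s ⊔ pairRel x y) a b) :
    s a b ∨ ((s a x ∨ s a y) ∧ (s b x ∨ s b y)) := by
  let t : Setoid D :=
    { r := fun a b => s a b ∨ ((s a x ∨ s a y) ∧ (s b x ∨ s b y))
      iseqv := by
        refine ⟨fun a => Or.inl (s.refl a), ?_, ?_⟩
        · rintro a b (h | h)
          · exact Or.inl (s.symm h)
          · exact Or.inr ⟨h.2, h.1⟩
        · rintro a b c (h1 | h1) (h2 | h2)
          · exact Or.inl (s.trans h1 h2)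
          · exact Or.inr ⟨h2.1.imp (s.trans h1) (s.trans h1), h2.2⟩
          · exact Or.inr ⟨h1.1, h1.2.imp (s.trans (s.symm h2)) (s.trans (s.symm h2))⟩
          · exact Or.inr ⟨h1.1, h2.2⟩ }
  have h1 : s ⊔ pairRel x y ≤ t := by
    refine sup_le (fun a b h => Or.inl h) (pairRel_le.2 ?_)
    exact Or.inr ⟨Or.inl (s.refl _), Or.inr (s.refl _)⟩
  exact h1 h

open Classical in
theorem card_quotient_sup_pairRel [Finite D] (s : Setoid D) {x y : D} (h : ¬ s x y) :
    Nat.card (Quotient (s ⊔ pairRel x y)) + 1 = Nat.card (Quotient s) := by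
  have key : ∀ a b, (s ⊔ pairRel x y) a b ↔
      (s a b ∨ (s a x ∧ s b y) ∨ (s a y ∧ s b x)) := by
    intro a b
    let t : Setoid D :=
      { r := fun a b => s a b ∨ (s a x ∧ s b y) ∨ (s a y ∧ s b x)
        iseqv := by
          refine ⟨fun a => Or.inl (s.refl a), ?_, ?_⟩
          · rintro a b (h | h | h)
            · exact Or.inl (s.symm h)
            · exact Or.inr (Or.inr ⟨h.2, h.1⟩)
            · exact Or.inr (Or.inl ⟨h.2, h.1⟩)
          · rintro a b c (h1 | h1 | h1) (h2 | h2 | h2)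
            · exact Or.inl (s.trans h1 h2)
            · exact Or.inr (Or.inl ⟨s.trans h1 h2.1, h2.2⟩)
            · exact Or.inr (Or.inr ⟨s.trans h1 h2.1, h2.2⟩)
            · exact Or.inr (Or.inl ⟨h1.1, s.trans (s.symm h2) h1.2⟩)
            · exact absurd (s.trans (s.symm h2.1) h1.2) h
            · exact Or.inl (s.trans h1.1 (s.symm h2.2))
            · exact Or.inr (Or.inr ⟨h1.1, s.trans (s.symm h2) h1.2⟩)
            · exact Or.inl (s.trans h1.1 (s.symm h2.2))
            · exact absurd (s.trans (s.symm h1.2) h2.1) h }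
    constructor
    · intro h1
      have : s ⊔ pairRel x y ≤ t := by
        refine sup_le (fun a b h => Or.inl h) (pairRel_le.2 ?_)
        exact Or.inr (Or.inl ⟨s.refl _, s.refl _⟩)
      exact this h1
    · have h1 : s ≤ s ⊔ pairRel x y := le_sup_left
      have h2 : (s ⊔ pairRel x y) x y := pairRel_le.1 le_sup_right
      rintro (h | h | h)
      · exact h1 h
      · exact Setoid.trans' _ (h1 h.1) (Setoid.trans' _ h2 (Setoid.symm' _ (h1 h.2)))
      · exact Setoid.trans' _ (h1 h.1) (Setoid.trans' _ (Setoid.symm' _ h2)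
          (Setoid.symm' _ (h1 h.2)))
  -- The class of `y` goes to `none`, all others to their images; the merged class is then
  -- represented by `x` alone, and `f` is a bijection.
  let f : Quotient s → Option (Quotient (s ⊔ pairRel x y)) := fun q =>
    if q = Quotient.mk s y then none
    else some (Quotient.map' (s₁ := s) (s₂ := s ⊔ pairRel x y) id
      (fun a b h => (key _ _).2 (Or.inl h)) q)
  have hf : Function.Bijective f := by
    constructor
    · intro q q'
      induction q using Quotient.inductionOn with | _ a
      induction q' using Quotient.inductionOn with | _ b
      intro hab
      simp only [f] at hab
      split_ifs at hab with h1 h2 h2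
      · rw [h1, h2]
      · have h3 := Quotient.exact (Option.some.inj hab)
        have h1' : ¬ s a y := fun h => h1 (Quotient.sound h)
        have h2' : ¬ s b y := fun h => h2 (Quotient.sound h)
        rcases (key a b).1 h3 with h | h | h
        · exact Quotient.sound h
        · exact absurd h.2 h2'
        · exact absurd h.1 h1'
    · rintro (_ | q)
      · exact ⟨Quotient.mk s y, by simp [f]⟩
      · induction q using Quotient.inductionOn with | _ a
        by_cases h1 : s a y
        · refine ⟨Quotient.mk s x, ?_⟩
          have : ¬ Quotient.mk s x = Quotient.mk s y := fun h2 => h (Quotient.exact h2)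
          simp only [f, if_neg this]
          congr 1
          refine Quotient.sound ((key x a).2 (Or.inr (Or.inl ⟨s.refl _, h1⟩)))
        · refine ⟨Quotient.mk s a, ?_⟩
          have : ¬ Quotient.mk s a = Quotient.mk s y := fun h2 => h1 (Quotient.exact h2)
          simp only [f, if_neg this]
          rfl
  rw [Nat.card_congr (Equiv.ofBijective f hf), Finite.card_option]

/-- The relation of lying in the same orbit of the group generated by `σ` and `α`. -/
def conn (σ α : Perm D) : Setoid D := cyc σ ⊔ cyc α

theorem conn_left (σ α : Perm D) (x : D) : conn σ α x (σ x) :=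
  (le_sup_left : cyc σ ≤ conn σ α) (cyc_apply _ _)

theorem conn_right (σ α : Perm D) (x : D) : conn σ α x (α x) :=
  (le_sup_right : cyc α ≤ conn σ α) (cyc_apply _ _)

theorem conn_le {σ α : Perm D} {s : Setoid D} :
    conn σ α ≤ s ↔ (∀ x, s x (σ x)) ∧ ∀ x, s x (α x) := by
  rw [conn, sup_le_iff, cyc_le, cyc_le]

theorem cyc_mul_le_conn (σ α : Perm D) : cyc (σ * α) ≤ conn σ α := by
  rw [cyc_le]
  intro x
  exact Setoid.trans' _ (conn_right σ α x) (conn_left σ α (α x))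

theorem cyc_left_le_conn (σ α : Perm D) : cyc σ ≤ conn σ α := le_sup_left

theorem cyc_one : cyc (1 : Perm D) = ⊥ := by
  rw [eq_bot_iff, cyc_le]
  intro x; rfl

theorem numCycles_one : numCycles (1 : Perm D) = Nat.card D := by
  rw [numCycles, cyc_one]
  exact (Nat.card_congr (Equiv.ofBijective (Quotient.mk (⊥ : Setoid D))
    ⟨fun a b h => Quotient.exact h, Quotient.mk_surjective⟩)).symm

theorem numCycles_le [Finite D] (π : Perm D) : numCycles π ≤ Nat.card D :=
  Nat.card_le_card_of_surjective _ (Quotient.mk_surjective (s := cyc π))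

variable [DecidableEq D]

/-- Both permutations agree up to an exchange of `x` and `y`, so their cycles become the same once
these are identified. Numbers of cycles are compared through this common quotient. -/
theorem cyc_mul_swap_sup (π : Perm D) (x y : D) :
    cyc (π * swap x y) ⊔ pairRel x y = cyc π ⊔ pairRel x y := by
  have main : ∀ π : Perm D, cyc (π * swap x y) ≤ cyc π ⊔ pairRel x y := by
    intro π
    rw [cyc_le]
    intro a
    have h1 : cyc π ≤ cyc π ⊔ pairRel x y := le_sup_left
    have h2 : (cyc π ⊔ pairRel x y) x y := pairRel_le.1 le_sup_right
    rw [Perm.mul_apply]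
    refine Setoid.trans' _ (y := swap x y a) ?_ (h1 (cyc_apply _ _))
    by_cases hx : a = x
    · rw [hx, swap_apply_left]; exact h2
    · by_cases hy : a = y
      · rw [hy, swap_apply_right]; exact Setoid.symm' _ h2
      · rw [swap_apply_of_ne_of_ne hx hy]
  refine le_antisymm (sup_le (main π) le_sup_right) (sup_le ?_ le_sup_right)
  have := main (π * swap x y)
  rwa [mul_assoc, swap_mul_self, mul_one] at this

/-- The transposition cuts the cycle in two: from `y` the product jumps to `π x`, follows `π` until
`y` is reached again, and so never meets `x`. -/
theorem not_sameCycle_mul_swap [Finite D] {π : Perm D} {x y : D} (hxy : x ≠ y)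
    (h : π.SameCycle x y) : ¬ (π * swap x y).SameCycle x y := by
  obtain ⟨n, hn⟩ := h.exists_nat_pow_eq
  have hex : ∃ n, (π ^ n) x = y := ⟨n, hn⟩
  set k := Nat.find hex with hk
  have hky : (π ^ k) x = y := Nat.find_spec hex
  have hmin : ∀ i < k, (π ^ i) x ≠ y := fun i hi => Nat.find_min hex hi
  have hk0 : 0 < k := by
    rcases Nat.eq_zero_or_pos k with h0 | h0
    · rw [h0] at hky; exact absurd hky hxy
    · exact h0
  have hx : ∀ i, 0 < i → i ≤ k → (π ^ i) x ≠ x := by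
    intro i hi hik he
    have h1 : (π ^ (k - i)) x = y := by
      have : (π ^ (k - i)) ((π ^ i) x) = y := by
        rw [← Perm.mul_apply, ← pow_add, Nat.sub_add_cancel hik, hky]
      rwa [he] at this
    exact hmin _ (by omega) h1
  have inv : ∀ m, ∃ i, 0 < i ∧ i ≤ k ∧ ((π * swap x y) ^ m) y = (π ^ i) x := by
    intro m
    induction m with
    | zero => exact ⟨k, hk0, le_rfl, by simp [hky]⟩
    | succ m ih =>
      obtain ⟨i, hi, hik, he⟩ := ih
      rw [pow_succ', Perm.mul_apply, he, Perm.mul_apply]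
      rcases eq_or_lt_of_le hik with rfl | hlt
      · rw [hky, swap_apply_right]
        exact ⟨1, one_pos, hk0, by simp⟩
      · rw [swap_apply_of_ne_of_ne (hx i hi hik) (hmin i hlt)]
        exact ⟨i + 1, by omega, hlt, by rw [pow_succ']; rfl⟩
  intro hc
  obtain ⟨m, hm⟩ := hc.symm.exists_nat_pow_eq
  obtain ⟨i, hi, hik, he⟩ := inv m
  exact hx i hi hik (he.symm.trans hm)

/-- The transposition joins the two cycles: from `y` the product enters the cycle of `x` at `π x`
and follows it all the way to `x`. -/
theorem sameCycle_mul_swap [Finite D] {π : Perm D} {x y : D}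
    (h : ¬ π.SameCycle x y) : (π * swap x y).SameCycle x y := by
  have hex : ∃ n, 0 < n ∧ (π ^ n) x = x := ⟨orderOf π, orderOf_pos π, by simp [pow_orderOf_eq_one]⟩
  obtain ⟨hk0, hkx⟩ := Nat.find_spec hex
  have hmin : ∀ i < Nat.find hex, 0 < i → (π ^ i) x ≠ x :=
    fun i hi hi0 he => Nat.find_min hex hi ⟨hi0, he⟩
  generalize Nat.find hex = k at *
  have hy : ∀ i : ℕ, (π ^ i) x ≠ y := fun i he => h ⟨i, by simpa using he⟩
  have inv : ∀ i, 0 < i → i ≤ k → ((π * swap x y) ^ i) y = (π ^ i) x := by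
    intro i hi hik
    induction i with
    | zero => omega
    | succ i ih =>
      rw [pow_succ', Perm.mul_apply, pow_succ', Perm.mul_apply]
      rcases Nat.eq_zero_or_pos i with rfl | hi0
      · simp
      · rw [ih hi0 (by omega), Perm.mul_apply,
          swap_apply_of_ne_of_ne (hmin i (by omega) hi0) (hy i)]
  exact Perm.SameCycle.symm ⟨k, by simpa [hkx] using inv k hk0 le_rfl⟩

theorem numCycles_mul_swap_of_sameCycle [Finite D] {π : Perm D} {x y : D} (hxy : x ≠ y)
    (h : π.SameCycle x y) : numCycles (π * swap x y) = numCycles π + 1 := by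
  have h1 := card_quotient_sup_pairRel (cyc (π * swap x y))
    (not_sameCycle_mul_swap hxy h)
  rw [cyc_mul_swap_sup, sup_eq_left.2 (pairRel_le.2 h)] at h1
  exact h1.symm

theorem numCycles_mul_swap_of_not_sameCycle [Finite D] {π : Perm D} {x y : D}
    (h : ¬ π.SameCycle x y) : numCycles (π * swap x y) + 1 = numCycles π := by
  have h1 := card_quotient_sup_pairRel (cyc π) h
  rw [← cyc_mul_swap_sup, sup_eq_left.2 (pairRel_le.2 (sameCycle_mul_swap h))] at h1
  exact h1

theorem swap_mul_eq_inv (π : Perm D) (x y : D) : swap x y * π = (π⁻¹ * swap x y)⁻¹ := by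
  rw [mul_inv_rev, inv_inv, swap_inv]

theorem numCycles_swap_mul_of_sameCycle [Finite D] {π : Perm D} {x y : D} (hxy : x ≠ y)
    (h : π.SameCycle x y) : numCycles (swap x y * π) = numCycles π + 1 := by
  rw [swap_mul_eq_inv, numCycles_inv, numCycles_mul_swap_of_sameCycle hxy
    (Perm.sameCycle_inv.2 h), numCycles_inv]

/-! ### The Euler characteristic of a pair of permutations -/

theorem conn_sup_pairRel (σ α : Perm D) (x y : D) :
    conn σ (α * swap x y) ⊔ pairRel x y = conn σ α ⊔ pairRel x y := by
  rw [conn, conn, sup_assoc, cyc_mul_swap_sup, sup_assoc]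

theorem conn_eq_of_sameCycle {σ α : Perm D} {x y : D} (h : α.SameCycle x y) :
    conn σ α = conn σ (α * swap x y) ⊔ pairRel x y := by
  rw [conn_sup_pairRel, eq_comm, sup_eq_left, pairRel_le]
  exact (le_sup_right : cyc α ≤ conn σ α) h

/-- Twice the genus of the surface given by the pair `(σ, α)`. -/
noncomputable def defect (σ α : Perm D) : ℤ :=
  Nat.card D + 2 * Nat.card (Quotient (conn σ α)) - numCycles σ - numCycles α - numCycles (σ * α)

/-- Here `σ` rotates around the vertices, `α` reverses edges (a fixed point stands for a deleted
edge), and `σ * α` walks around the faces; `Nat.card D - numCycles α` is the number of edges.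
Multiplying `α` by the transposition deletes an edge, and the cases record whether this disconnects
the graph and whether it splits or merges faces. -/
theorem defect_mul_swap [Finite D] {σ α : Perm D} {x y : D} (hxy : x ≠ y)
    (h : α.SameCycle x y) :
    (conn σ (α * swap x y) x y ∧ (σ * α).SameCycle x y ∧
      defect σ α = defect σ (α * swap x y) + 2) ∨
    ((conn σ (α * swap x y) x y ↔ ¬ (σ * α).SameCycle x y) ∧
      defect σ α = defect σ (α * swap x y)) := by
  have h1 := numCycles_mul_swap_of_sameCycle hxy h
  have h2 : σ * (α * swap x y) = σ * α * swap x y := (mul_assoc _ _ _).symm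
  have h3 := conn_eq_of_sameCycle (σ := σ) h
  by_cases hc : conn σ (α * swap x y) x y
  · rw [sup_eq_left.2 (pairRel_le.2 hc)] at h3
    by_cases hs : (σ * α).SameCycle x y
    · left
      refine ⟨hc, hs, ?_⟩
      have h4 := numCycles_mul_swap_of_sameCycle hxy hs
      rw [defect, defect, h2, h1, h4, ← h3]; push_cast; ring
    · right
      refine ⟨by simp [hc, hs], ?_⟩
      have h4 := numCycles_mul_swap_of_not_sameCycle hs
      rw [defect, defect, h2, h1, ← h4, ← h3]; push_cast; ring
  · have h5 := card_quotient_sup_pairRel _ hc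
    rw [← h3] at h5
    -- A separating edge has one face on both sides: two different faces would merge after the
    -- deletion, yet a face lies in one component.
    have hs : (σ * α).SameCycle x y := by
      by_contra hs
      have h6 := sameCycle_mul_swap hs
      rw [← h2] at h6
      exact hc (cyc_mul_le_conn _ _ h6)
    right
    refine ⟨by simp [hc, hs], ?_⟩
    have h4 := numCycles_mul_swap_of_sameCycle hxy hs
    rw [defect, defect, h2, h1, h4, ← h5]; push_cast; ring

/-- The genus is not negative. -/
theorem defect_nonneg [Finite D] (σ α : Perm D) : 0 ≤ defect σ α := by
  induction hm : Nat.card D - numCycles α using Nat.strong_induction_on generalizing α with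
  | _ m ih =>
    -- Without edges every component is a single vertex with one face and the defect is zero;
    -- deleting an edge never increases the defect.
    by_cases h1 : α = 1
    · subst h1
      rw [defect, mul_one, numCycles_one, conn, cyc_one, sup_bot_eq]
      have : Nat.card (Quotient (cyc σ)) = numCycles σ := rfl
      rw [this]; linarith
    · obtain ⟨x, hx⟩ : ∃ x, α x ≠ x := by
        by_contra! h
        exact h1 (Equiv.ext h)
      have h : α.SameCycle x (α x) := cyc_apply α x
      have h2 := numCycles_mul_swap_of_sameCycle (Ne.symm hx) h
      have h3 := numCycles_le (α * swap x (α x))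
      have h4 := ih (Nat.card D - numCycles (α * swap x (α x))) (by omega) _ rfl
      rcases defect_mul_swap (σ := σ) (Ne.symm hx) h with ⟨-, -, h5⟩ | ⟨-, h5⟩ <;> omega

/-- The smaller surface has no negative genus, so the drop by two cannot occur. Planarity is
inherited, and the remaining alternative is the Jordan curve theorem. -/
theorem defect_mul_swap_eq_zero [Finite D] {σ α : Perm D} (h0 : defect σ α = 0) {x y : D}
    (hxy : x ≠ y) (h : α.SameCycle x y) :
    defect σ (α * swap x y) = 0 ∧ (conn σ (α * swap x y) x y ↔ ¬ (σ * α).SameCycle x y) := by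
  have h4 := defect_nonneg σ (α * swap x y)
  rcases defect_mul_swap (σ := σ) hxy h with ⟨-, -, h5⟩ | ⟨h6, h5⟩
  · omega
  · exact ⟨by omega, h6⟩

/-- Splitting a vertex of a sphere at two corners that lie in the same face separates them. -/
theorem not_conn_swap_mul [Finite D] {σ α : Perm D} (h0 : defect σ α = 0) {x y : D}
    (hxy : x ≠ y) (h : σ.SameCycle x y) (h' : (σ * α).SameCycle x y) :
    ¬ conn (swap x y * σ) α x y := by
  intro hc
  -- If the corners remained connected, the split would add one vertex and one face and change
  -- nothing else, so the defect would become `-2`.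
  have h1 := numCycles_swap_mul_of_sameCycle hxy h
  have h2 := numCycles_swap_mul_of_sameCycle hxy h'
  have h3 := defect_nonneg (swap x y * σ) α
  have h4 : cyc (swap x y * σ) ⊔ pairRel x y = cyc σ ⊔ pairRel x y := by
    have := cyc_mul_swap_sup σ⁻¹ x y
    rwa [← cyc_inv (σ⁻¹ * swap x y), ← swap_mul_eq_inv, cyc_inv] at this
  have h5 : conn (swap x y * σ) α = conn σ α := by
    have h6 : conn (swap x y * σ) α ⊔ pairRel x y = conn σ α ⊔ pairRel x y := by
      rw [conn, conn, sup_right_comm, h4, sup_right_comm]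
    rwa [sup_eq_left.2 (pairRel_le.2 hc), sup_eq_left (a := conn σ α).2 (pairRel_le.2
      ((le_sup_left : cyc σ ≤ conn σ α) h))] at h6
  rw [defect, mul_assoc, h1, h2, h5] at h3
  rw [defect] at h0
  push_cast at h3
  linarith

/-- After multiplication by a transposition, the points of a cycle are either still in the same
cycle, or each of them is in the cycle of one of the two transposed points. -/
theorem SameCycle.mul_swap {π : Perm D} {x y a b : D} (h : π.SameCycle a b) :
    (π * swap x y).SameCycle a b ∨
      (((π * swap x y).SameCycle a x ∨ (π * swap x y).SameCycle a y) ∧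
        ((π * swap x y).SameCycle b x ∨ (π * swap x y).SameCycle b y)) := by
  have h1 : (cyc (π * swap x y) ⊔ pairRel x y) a b := by
    rw [cyc_mul_swap_sup]
    exact (le_sup_left : cyc π ≤ _) h
  exact of_sup_pairRel h1

end Cycles

/-! ### Planar maps, deletion of edges, and the Jordan curve theorem -/

section Planar

open scoped Classical

namespace CombMap

variable {D : Type} (M : CombMap D)

theorem vert_apply (d : D) : M.vert d = M.face (M.edge d) := rfl

theorem vert_edge (d : D) : M.vert (M.edge d) = M.face d := by
  rw [vert_apply, M.edge_edge]

theorem vert_mul_edge : M.vert * M.edge = M.face := Equiv.ext M.vert_edge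

/-- The darts of the edges that are contained in `A`. -/
def Active (A : Set D) (d : D) : Prop := d ∈ A ∧ M.edge d ∈ A

variable {M} in
theorem Active.edge {A : Set D} {d : D} (h : M.Active A d) : M.Active A (M.edge d) :=
  ⟨h.2, by rw [M.edge_edge]; exact h.1⟩

theorem active_edge_iff {A : Set D} {d : D} : M.Active A (M.edge d) ↔ M.Active A d :=
  ⟨fun h => by simpa [M.edge_edge] using h.edge, fun h => h.edge⟩

/-- The permutation `edge`, with the edges outside `A` deleted. -/
noncomputable def edgeOn (A : Set D) : Perm D where
  toFun d := if M.Active A d then M.edge d else d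
  invFun d := if M.Active A d then M.edge d else d
  left_inv d := by
    by_cases h : M.Active A d
    · simp [h, h.edge, M.edge_edge]
    · simp [h]
  right_inv d := by
    by_cases h : M.Active A d
    · simp [h, h.edge, M.edge_edge]
    · simp [h]

variable {M} in
theorem edgeOn_of_active {A : Set D} {d : D} (h : M.Active A d) : M.edgeOn A d = M.edge d :=
  if_pos h

variable {M} in
theorem edgeOn_of_not_active {A : Set D} {d : D} (h : ¬ M.Active A d) : M.edgeOn A d = d :=
  if_neg h

theorem edgeOn_univ : M.edgeOn Set.univ = M.edge :=
  Equiv.ext fun _ => edgeOn_of_active ⟨trivial, trivial⟩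

theorem not_active_diff {A : Set D} {d x : D} (h : x = d ∨ x = M.edge d) :
    ¬ M.Active (A \ {d}) x := by
  rintro ⟨h1, h2⟩
  rcases h with rfl | rfl
  · exact h1.2 rfl
  · exact h2.2 (M.edge_edge d)

theorem active_diff_iff {A : Set D} {d x : D} :
    M.Active (A \ {d}) x ↔ M.Active A x ∧ x ≠ d ∧ x ≠ M.edge d := by
  constructor
  · intro h
    refine ⟨⟨h.1.1, h.2.1⟩, ?_, ?_⟩ <;> rintro rfl
    · exact M.not_active_diff (Or.inl rfl) h
    · exact M.not_active_diff (Or.inr rfl) h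
  · rintro ⟨h, h1, h2⟩
    refine ⟨⟨h.1, h1⟩, h.2, ?_⟩
    rintro rfl
    exact h2 (M.edge_edge x).symm

/-- A dart is active only together with its reverse, so dropping `d` from `A` deletes the whole
edge. This translates deletion into multiplication by a transposition. -/
theorem edgeOn_diff {A : Set D} {d : D} (h : M.Active A d) :
    M.edgeOn (A \ {d}) = M.edgeOn A * swap d (M.edge d) := by
  ext x
  rw [Perm.mul_apply]
  by_cases h1 : x = d
  · rw [edgeOn_of_not_active (M.not_active_diff (Or.inl h1)), h1, swap_apply_left,
      edgeOn_of_active h.edge, M.edge_edge]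
  by_cases h2 : x = M.edge d
  · rw [edgeOn_of_not_active (M.not_active_diff (Or.inr h2)), h2, swap_apply_right,
      edgeOn_of_active h]
  rw [swap_apply_of_ne_of_ne h1 h2]
  by_cases h3 : M.Active A x
  · rw [edgeOn_of_active h3, edgeOn_of_active (M.active_diff_iff.2 ⟨h3, h1, h2⟩)]
  · rw [edgeOn_of_not_active h3, edgeOn_of_not_active (fun h4 => h3 (M.active_diff_iff.1 h4).1)]

theorem edgeOn_diff_of_not_active {A : Set D} {d : D} (h : ¬ M.Active A d) :
    M.edgeOn (A \ {d}) = M.edgeOn A := by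
  ext x
  by_cases h3 : M.Active A x
  · rw [edgeOn_of_active h3, edgeOn_of_active (M.active_diff_iff.2 ⟨h3, ?_, ?_⟩)]
    · rintro rfl; exact h h3
    · rintro rfl; exact h (M.active_edge_iff.1 h3)
  · rw [edgeOn_of_not_active h3, edgeOn_of_not_active (fun h4 => h3 (M.active_diff_iff.1 h4).1)]

/-- The boundary walks of the faces of the graph with the edges in `A`. -/
noncomputable def faceOn (A : Set D) : Perm D := M.vert * M.edgeOn A

/-- Connectedness in the graph with the edges in `A`; a dart stands for its source. -/
noncomputable def connOn (A : Set D) : Setoid D := conn M.vert (M.edgeOn A)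

variable {M}

theorem faceOn_of_active {A : Set D} {d : D} (h : M.Active A d) : M.faceOn A d = M.face d := by
  rw [faceOn, Perm.mul_apply, edgeOn_of_active h, vert_edge]

theorem faceOn_of_not_active {A : Set D} {d : D} (h : ¬ M.Active A d) :
    M.faceOn A d = M.vert d := by
  rw [faceOn, Perm.mul_apply, edgeOn_of_not_active h]

theorem faceOn_univ : M.faceOn Set.univ = M.face := by
  rw [faceOn, edgeOn_univ, vert_mul_edge]

theorem connOn_vert {A : Set D} (d : D) : M.connOn A d (M.vert d) := conn_left _ _ _

theorem connOn_edge {A : Set D} {d : D} (h : M.Active A d) : M.connOn A d (M.edge d) := by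
  have := conn_right M.vert (M.edgeOn A) d
  rwa [edgeOn_of_active h] at this

theorem connOn_faceOn {A : Set D} (d : D) : M.connOn A d (M.faceOn A d) :=
  cyc_mul_le_conn _ _ (cyc_apply _ _)

theorem connOn_of_sameCycle {A : Set D} {d d' : D} (h : (M.faceOn A).SameCycle d d') :
    M.connOn A d d' := cyc_mul_le_conn _ _ h

theorem connOn_of_vert {A : Set D} {d d' : D} (h : M.vert.SameCycle d d') :
    M.connOn A d d' := cyc_left_le_conn _ _ h

theorem connOn_le {A : Set D} {s : Setoid D} (h1 : ∀ x, s x (M.vert x))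
    (h2 : ∀ x, M.Active A x → s x (M.edge x)) : M.connOn A ≤ s := by
  refine conn_le.2 ⟨h1, fun x => ?_⟩
  by_cases h : M.Active A x
  · rw [edgeOn_of_active h]; exact h2 x h
  · rw [edgeOn_of_not_active h]

theorem connOn_mono {A B : Set D} (h : A ⊆ B) : M.connOn A ≤ M.connOn B :=
  connOn_le connOn_vert fun _ hx => connOn_edge ⟨h hx.1, h hx.2⟩

theorem connOn_diff {A : Set D} {d x y : D} (h : M.connOn A x y) :
    M.connOn (A \ {d}) x y ∨
      ((M.connOn (A \ {d}) x d ∨ M.connOn (A \ {d}) x (M.edge d)) ∧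
        (M.connOn (A \ {d}) y d ∨ M.connOn (A \ {d}) y (M.edge d))) := by
  by_cases hd : M.Active A d
  · refine of_sup_pairRel ?_
    rw [connOn, edgeOn_diff _ hd, conn_sup_pairRel]
    exact (le_sup_left : conn M.vert (M.edgeOn A) ≤ _) h
  · left
    rwa [connOn, edgeOn_diff_of_not_active _ hd]

theorem sameCycle_faceOn_diff {A : Set D} {d x y : D} (h : (M.faceOn A).SameCycle x y) :
    (M.faceOn (A \ {d})).SameCycle x y ∨
      (((M.faceOn (A \ {d})).SameCycle x d ∨ (M.faceOn (A \ {d})).SameCycle x (M.edge d)) ∧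
        ((M.faceOn (A \ {d})).SameCycle y d ∨
          (M.faceOn (A \ {d})).SameCycle y (M.edge d))) := by
  by_cases hd : M.Active A d
  · rw [faceOn, edgeOn_diff _ hd, ← mul_assoc]
    exact SameCycle.mul_swap h
  · left
    rwa [faceOn, edgeOn_diff_of_not_active _ hd]

theorem sameCycle_faceOn_of_diff {A : Set D} {d x y : D} (hd : M.Active A d)
    (h : (M.faceOn (A \ {d})).SameCycle x y) :
    (M.faceOn A).SameCycle x y ∨
      (((M.faceOn A).SameCycle x d ∨ (M.faceOn A).SameCycle x (M.edge d)) ∧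
        ((M.faceOn A).SameCycle y d ∨ (M.faceOn A).SameCycle y (M.edge d))) := by
  have h1 := SameCycle.mul_swap (x := d) (y := M.edge d) h
  have h2 : M.faceOn (A \ {d}) * swap d (M.edge d) = M.faceOn A := by
    rw [faceOn, edgeOn_diff _ hd, mul_assoc, mul_assoc, swap_mul_self, mul_one, faceOn]
  rwa [h2] at h1

variable (M) in
/-- All components of the surface are spheres. -/
def Spherical : Prop := defect M.vert M.edge = 0

variable [Finite D]

/-- The edges outside `A` are deleted one at a time, and each deletion preserves genus zero. -/
theorem Spherical.defect_edgeOn (h : M.Spherical) (A : Set D) :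
    defect M.vert (M.edgeOn A) = 0 := by
  have key : ∀ s : Set D, s.Finite → defect M.vert (M.edgeOn sᶜ) = 0 := by
    intro s hs
    induction s, hs using Set.Finite.induction_on with
    | empty => rw [Set.compl_empty, edgeOn_univ]; exact h
    | @insert a s _ _ ih =>
      have h1 : (insert a s)ᶜ = sᶜ \ {a} := by
        ext x; simp [not_or, and_comm]
      rw [h1]
      by_cases ha : M.Active sᶜ a
      · rw [edgeOn_diff _ ha]
        refine (defect_mul_swap_eq_zero ih (M.edge_ne a).symm ?_).1
        have := cyc_apply (M.edgeOn sᶜ) a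
        rwa [edgeOn_of_active ha] at this
      · rwa [edgeOn_diff_of_not_active _ ha]
  simpa using key Aᶜ (Set.toFinite _)

/-- The Jordan curve theorem: an edge of a planar graph separates if and only if it has the same
face on both sides. -/
theorem Spherical.jordan (h : M.Spherical) {A : Set D} {d : D} (hd : M.Active A d) :
    M.connOn (A \ {d}) d (M.edge d) ↔ ¬ (M.faceOn A).SameCycle d (M.edge d) := by
  have h1 := defect_mul_swap_eq_zero (h.defect_edgeOn A) (M.edge_ne d).symm
    (by have := cyc_apply (M.edgeOn A) d
        rwa [edgeOn_of_active hd] at this)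
  rw [connOn, edgeOn_diff _ hd]
  exact h1.2

end CombMap

end Planar

/-! ### Potentials of group-valued edge functions on planar graphs -/

section Potential

open scoped Classical

/-- A function that is constant along a cycle, with at most one exception, is constant. -/
theorem eq_apply_of_eq_apply_of_ne {D X : Type} [Finite D] {π : Perm D} {k : D → X} {z : D}
    (h : ∀ y, π.SameCycle z y → y ≠ z → k (π y) = k y) : k (π z) = k z := by
  have hex : ∃ n, 0 < n ∧ (π ^ n) z = z := ⟨orderOf π, orderOf_pos π, by simp [pow_orderOf_eq_one]⟩
  obtain ⟨hk0, hkx⟩ := Nat.find_spec hex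
  have hmin : ∀ i < Nat.find hex, 0 < i → (π ^ i) z ≠ z :=
    fun i hi hi0 he => Nat.find_min hex hi ⟨hi0, he⟩
  generalize Nat.find hex = n at *
  have key : ∀ i, 0 < i → i ≤ n → k ((π ^ i) z) = k (π z) := by
    intro i hi hin
    induction i with
    | zero => omega
    | succ i ih =>
      rcases Nat.eq_zero_or_pos i with rfl | hi0
      · simp
      · rw [pow_succ', Perm.mul_apply, h _ ⟨i, by simp⟩ (hmin i (by omega) hi0)]
        exact ih hi0 (by omega)
  rw [← key n hk0 le_rfl, hkx]

namespace CombMap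

variable {D : Type} {M : CombMap D} {G : Type} [Group G]

variable (M) in
/-- The weight of a dart along the boundary walks of the graph with edges in `A`. -/
noncomputable def wt (h : D → G) (A : Set D) (y : D) : G := if M.Active A y then h y else 1

variable (M) in
/-- The product of `h` around the face of `x` of the graph with edges in `A` is trivial. -/
def TrivOn (h : D → G) (A : Set D) (x : D) : Prop :=
  ∃ g : D → G, ∀ y, (M.faceOn A).SameCycle x y → M.wt h A y * g (M.faceOn A y) = g y

variable {h : D → G} {A : Set D}

theorem TrivOn.of_sameCycle {x y : D} (hx : M.TrivOn h A x) (hxy : (M.faceOn A).SameCycle x y) :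
    M.TrivOn h A y := by
  obtain ⟨g, hg⟩ := hx
  exact ⟨g, fun z hz => hg z (hxy.trans hz)⟩

theorem wt_diff_of_ne {d y : D} (h1 : y ≠ d) (h2 : y ≠ M.edge d) :
    M.wt h (A \ {d}) y = M.wt h A y := by
  simp only [wt, M.active_diff_iff, h1, h2, ne_eq, not_false_eq_true, and_true]

theorem wt_diff {d y : D} (hy : y = d ∨ y = M.edge d) : M.wt h (A \ {d}) y = 1 :=
  if_neg (M.not_active_diff hy)

theorem faceOn_diff_of_ne {d y : D} (h1 : y ≠ d) (h2 : y ≠ M.edge d) :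
    M.faceOn (A \ {d}) y = M.faceOn A y := by
  by_cases h3 : M.Active A y
  · rw [faceOn_of_active h3, faceOn_of_active (M.active_diff_iff.2 ⟨h3, h1, h2⟩)]
  · rw [faceOn_of_not_active h3,
      faceOn_of_not_active (fun h4 => h3 (M.active_diff_iff.1 h4).1)]

theorem faceOn_diff_left {d : D} (hd : M.Active A d) :
    M.faceOn (A \ {d}) d = M.faceOn A (M.edge d) := by
  rw [faceOn_of_not_active (M.not_active_diff (Or.inl rfl)), faceOn_of_active hd.edge,
    vert_apply]

theorem faceOn_diff_right {d : D} (hd : M.Active A d) :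
    M.faceOn (A \ {d}) (M.edge d) = M.faceOn A d := by
  rw [faceOn_of_not_active (M.not_active_diff (Or.inr rfl)), faceOn_of_active hd, vert_edge]

/-- Far from `d` and `edge d` the faces do not change when this edge is deleted. -/
theorem sameCycle_diff_iff {d x y : D} (hd : M.Active A d)
    (h1 : ¬ (M.faceOn A).SameCycle d x) (h2 : ¬ (M.faceOn A).SameCycle (M.edge d) x) :
    (M.faceOn (A \ {d})).SameCycle x y ↔ (M.faceOn A).SameCycle x y := by
  constructor
  · intro h3
    rcases sameCycle_faceOn_of_diff hd h3 with h4 | ⟨h4 | h4, -⟩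
    · exact h4
    · exact absurd h4.symm h1
    · exact absurd h4.symm h2
  · intro h3
    have far : ∀ z, z = d ∨ z = M.edge d → ¬ (M.faceOn (A \ {d})).SameCycle x z := by
      rintro z hz h4
      rcases sameCycle_faceOn_of_diff hd h4 with h5 | ⟨h5 | h5, -⟩
      · rcases hz with rfl | rfl
        · exact h1 h5.symm
        · exact h2 h5.symm
      · exact h1 h5.symm
      · exact h2 h5.symm
    rcases sameCycle_faceOn_diff (d := d) h3 with h4 | ⟨h4 | h4, -⟩
    · exact h4
    · exact absurd h4 (far _ (Or.inl rfl))
    · exact absurd h4 (far _ (Or.inr rfl))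

theorem TrivOn.diff {d x : D} (hd : M.Active A d) (hx : M.TrivOn h A x)
    (h1 : ¬ (M.faceOn A).SameCycle d x) (h2 : ¬ (M.faceOn A).SameCycle (M.edge d) x) :
    M.TrivOn h (A \ {d}) x := by
  obtain ⟨g, hg⟩ := hx
  refine ⟨g, fun y hy => ?_⟩
  rw [sameCycle_diff_iff hd h1 h2] at hy
  have h3 : y ≠ d := by rintro rfl; exact h1 hy.symm
  have h4 : y ≠ M.edge d := by rintro rfl; exact h2 hy.symm
  rw [wt_diff_of_ne h3 h4, faceOn_diff_of_ne h3 h4]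
  exact hg y hy

/-- When two faces with trivial product are merged, the product around the new face is trivial. -/
theorem TrivOn.merge (hh : ∀ d, h (M.edge d) = (h d)⁻¹) {d : D} (hd : M.Active A d)
    (h0 : ¬ (M.faceOn A).SameCycle d (M.edge d)) (h1 : M.TrivOn h A d)
    (h2 : M.TrivOn h A (M.edge d)) : M.TrivOn h (A \ {d}) d := by
  obtain ⟨g1, hg1⟩ := h1
  obtain ⟨g2, hg2⟩ := h2
  have e1 := hg1 d (Perm.SameCycle.refl _ _)
  have e2 := hg2 (M.edge d) (Perm.SameCycle.refl _ _)
  rw [wt, if_pos hd] at e1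
  rw [wt, if_pos hd.edge, hh] at e2
  -- On its own face each trivialisation is free up to right multiplication by a constant; `k` makes
  -- `g2` fit `g1` at the junction after `d`.
  set k := (g2 (M.faceOn A (M.edge d)))⁻¹ * g1 d with hk
  have hne := M.edge_ne d
  refine ⟨fun y => if (M.faceOn A).SameCycle d y then g1 y else g2 y * k, fun y hy => ?_⟩
  have hstep : ∀ y, (M.faceOn A).SameCycle d (M.faceOn A y) ↔ (M.faceOn A).SameCycle d y :=
    fun y => Perm.sameCycle_apply_right
  beta_reduce
  by_cases hyd : y = d
  · subst hyd
    rw [wt_diff (Or.inl rfl), faceOn_diff_left hd, if_neg (by rwa [hstep]), if_pos (Perm.SameCycle.refl _ _),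
      hk, one_mul, mul_inv_cancel_left]
  by_cases hye : y = M.edge d
  · subst hye
    rw [wt_diff (Or.inr rfl), faceOn_diff_right hd, if_pos ((hstep _).2 (Perm.SameCycle.refl _ _)), if_neg h0,
      ← e2, hk, ← e1]
    group
  rw [wt_diff_of_ne hyd hye, faceOn_diff_of_ne hyd hye]
  by_cases hc : (M.faceOn A).SameCycle d y
  · rw [if_pos hc, if_pos ((hstep _).2 hc), hg1 y hc]
  · rw [if_neg hc, if_neg (fun h3 => hc ((hstep _).1 h3)), ← mul_assoc, hg2]
    rcases sameCycle_faceOn_of_diff hd hy with h4 | ⟨-, h4 | h4⟩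
    · exact absurd h4 hc
    · exact absurd h4.symm hc
    · exact h4.symm

variable [Finite D]

/-- On a forest every edge function is the coboundary of a vertex function. -/
theorem Spherical.exists_potential_forest (hM : M.Spherical)
    (hh : ∀ d, h (M.edge d) = (h d)⁻¹) (A : Set D)
    (hA : ∀ d, M.Active A d → (M.faceOn A).SameCycle d (M.edge d)) :
    ∃ f : D → G, (∀ x, f (M.vert x) = f x) ∧ ∀ x, M.Active A x → h x * f (M.edge x) = f x := by
  induction hn : A.ncard using Nat.strong_induction_on generalizing A with
  | _ n ih =>
    by_cases hex : ∃ d, M.Active A d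
    · obtain ⟨d, hd⟩ := hex
      have hlt : (A \ {d}).ncard < n := by
        rw [← hn]; exact Set.ncard_sdiff_singleton_lt_of_mem hd.1 (Set.toFinite _)
      obtain ⟨f, hf1, hf2⟩ := ih _ hlt (A \ {d}) (by
        intro d' hd'
        have hd'' := (M.active_diff_iff.1 hd').1
        by_contra hc
        have h1 := (hM.jordan hd').2 hc
        refine (hM.jordan hd'').1 (connOn_mono (fun x hx => ?_) h1) (hA d' hd'')
        exact ⟨hx.1.1, hx.2⟩) rfl
      have hnc : ¬ M.connOn (A \ {d}) d (M.edge d) := by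
        rw [hM.jordan hd, not_not]; exact hA d hd
      -- Once the bridge is deleted, the potential may be multiplied by a constant on the component
      -- of `d` alone; `k` makes the equation hold across the bridge as well.
      set k := (f d)⁻¹ * h d * f (M.edge d) with hk
      refine ⟨fun x => if M.connOn (A \ {d}) d x then f x * k else f x, ?_, ?_⟩
      · intro x
        have : M.connOn (A \ {d}) d (M.vert x) ↔ M.connOn (A \ {d}) d x :=
          ⟨fun h => Setoid.trans' _ h (Setoid.symm' _ (connOn_vert x)),
            fun h => Setoid.trans' _ h (connOn_vert x)⟩
        simp only [this, hf1]
      · intro x hx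
        beta_reduce
        by_cases hxd : x = d
        · subst hxd
          rw [if_neg hnc, if_pos (Setoid.refl' _ _), hk]
          group
        by_cases hxe : x = M.edge d
        · subst hxe
          rw [M.edge_edge, if_neg hnc, if_pos (Setoid.refl' _ _), hk, hh]
          group
        have hx' : M.Active (A \ {d}) x := M.active_diff_iff.2 ⟨hx, hxd, hxe⟩
        have : M.connOn (A \ {d}) d (M.edge x) ↔ M.connOn (A \ {d}) d x :=
          ⟨fun h => Setoid.trans' _ h (Setoid.symm' _ (connOn_edge hx')),
            fun h => Setoid.trans' _ h (connOn_edge hx')⟩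
        simp only [this]
        split_ifs
        · rw [← mul_assoc, hf2 x hx']
        · exact hf2 x hx'
    · exact ⟨fun _ => 1, fun _ => rfl, fun x hx => absurd ⟨x, hx⟩ hex⟩

/-- A planar graph is simply connected once all faces but one of each component are filled. -/
theorem Spherical.exists_potential (hM : M.Spherical)
    (hh : ∀ d, h (M.edge d) = (h d)⁻¹) (A : Set D)
    (hA : ∀ x y, M.connOn A x y →
      (M.faceOn A).SameCycle x y ∨ M.TrivOn h A x ∨ M.TrivOn h A y) :
    ∃ f : D → G, (∀ x, f (M.vert x) = f x) ∧ ∀ x, M.Active A x → h x * f (M.edge x) = f x := by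
  induction hn : A.ncard using Nat.strong_induction_on generalizing A with
  | _ n ih =>
    by_cases hex : ∀ d, M.Active A d → (M.faceOn A).SameCycle d (M.edge d)
    · exact hM.exists_potential_forest hh A hex
    push Not at hex
    -- An edge between two different faces: by hypothesis one of the two is trivial, and up to
    -- reversal it is the face of `edge d`. Deleting the edge merges this face into the other one,
    -- which preserves the hypothesis.
    obtain ⟨d, hd, hs, ht⟩ : ∃ d, M.Active A d ∧ ¬ (M.faceOn A).SameCycle d (M.edge d) ∧
        M.TrivOn h A (M.edge d) := by
      obtain ⟨d, hd, hs⟩ := hex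
      rcases hA d (M.edge d) (connOn_edge hd) with h1 | h1 | h1
      · exact absurd h1 hs
      · exact ⟨M.edge d, hd.edge, by rw [M.edge_edge]; exact fun h2 => hs h2.symm,
          by rwa [M.edge_edge]⟩
      · exact ⟨d, hd, hs, h1⟩
    have hlt : (A \ {d}).ncard < n := by
      rw [← hn]; exact Set.ncard_sdiff_singleton_lt_of_mem hd.1 (Set.toFinite _)
    have hmono : ∀ {x y}, M.connOn (A \ {d}) x y → M.connOn A x y :=
      fun h => connOn_mono Set.sdiff_subset h
    have hde : (M.faceOn (A \ {d})).SameCycle d (M.edge d) := by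
      rw [faceOn, edgeOn_diff _ hd, ← mul_assoc]
      exact sameCycle_mul_swap hs
    have far : ∀ y, ¬ (M.faceOn (A \ {d})).SameCycle d y →
        ¬ (M.faceOn A).SameCycle d y ∧ ¬ (M.faceOn A).SameCycle (M.edge d) y := by
      intro y hy
      constructor <;> intro h1 <;> rcases sameCycle_faceOn_diff (d := d) h1 with h2 | ⟨-, h2 | h2⟩
      · exact hy h2
      · exact hy h2.symm
      · exact hy (hde.trans h2.symm)
      · exact hy (hde.trans h2)
      · exact hy h2.symm
      · exact hy (hde.trans h2.symm)
    -- a merged face with another face of the same component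
    have aux : ∀ y, M.connOn (A \ {d}) d y → ¬ (M.faceOn (A \ {d})).SameCycle d y →
        M.TrivOn h (A \ {d}) d ∨ M.TrivOn h (A \ {d}) y := by
      intro y hy hdy
      obtain ⟨f1, f2⟩ := far y hdy
      by_cases hty : M.TrivOn h A y
      · exact Or.inr (hty.diff hd f1 f2)
      · rcases hA d y (hmono hy) with h1 | h1 | h1
        · exact absurd h1 f1
        · exact Or.inl (TrivOn.merge hh hd hs h1 ht)
        · exact absurd h1 hty
    obtain ⟨f, hf1, hf2⟩ := ih _ hlt (A \ {d}) (by
      intro x y hxy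
      by_cases hsx : (M.faceOn (A \ {d})).SameCycle d x
      · by_cases hsy : (M.faceOn (A \ {d})).SameCycle d y
        · exact Or.inl (hsx.symm.trans hsy)
        · rcases aux y (Setoid.trans' _ (connOn_of_sameCycle hsx) hxy) hsy with h1 | h1
          · exact Or.inr (Or.inl (h1.of_sameCycle hsx))
          · exact Or.inr (Or.inr h1)
      · by_cases hsy : (M.faceOn (A \ {d})).SameCycle d y
        · rcases aux x (Setoid.trans' _ (connOn_of_sameCycle hsy) (Setoid.symm' _ hxy)) hsx
            with h1 | h1
          · exact Or.inr (Or.inr (h1.of_sameCycle hsy))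
          · exact Or.inr (Or.inl h1)
        · obtain ⟨x1, x2⟩ := far x hsx
          obtain ⟨y1, y2⟩ := far y hsy
          rcases hA x y (hmono hxy) with h1 | h1 | h1
          · exact Or.inl ((sameCycle_diff_iff hd x1 x2).2 h1)
          · exact Or.inr (Or.inl (h1.diff hd x1 x2))
          · exact Or.inr (Or.inr (h1.diff hd y1 y2))) rfl
    refine ⟨f, hf1, ?_⟩
    -- The deleted edge satisfies the equation too: the product around the trivial face of `edge d`
    -- is one, and all other edges of that face already satisfy it.
    have hed : h (M.edge d) * f d = f (M.edge d) := by
      obtain ⟨g, hg⟩ := ht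
      have key := eq_apply_of_eq_apply_of_ne (π := M.faceOn A) (k := fun y => (g y)⁻¹ * f y)
        (z := M.edge d) (by
          intro y hy hye
          have hyd : y ≠ d := by rintro rfl; exact hs hy.symm
          have hgy := hg y hy
          by_cases hya : M.Active A y
          · have h3 := hf2 y (M.active_diff_iff.2 ⟨hya, hyd, hye⟩)
            rw [wt, if_pos hya] at hgy
            rw [← h3, ← hgy, faceOn_of_active hya, ← vert_edge, hf1]
            group
          · rw [wt, if_neg hya] at hgy
            rw [← hgy, faceOn_of_not_active hya, hf1, one_mul])
      have hge := hg _ (Perm.SameCycle.refl _ _)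
      rw [wt, if_pos hd.edge] at hge
      have h4 : f (M.faceOn A (M.edge d)) = f d := by
        rw [faceOn_of_active hd.edge, ← vert_apply, hf1]
      rw [h4, ← hge] at key
      have h5 : f d = g (M.faceOn A (M.edge d)) * ((g (M.faceOn A (M.edge d)))⁻¹ * f d) := by
        group
      rw [h5, key]
      group
    intro x hx
    by_cases hxd : x = d
    · subst hxd
      rw [← hed, hh]; group
    by_cases hxe : x = M.edge d
    · subst hxe
      rw [M.edge_edge]; exact hed
    exact hf2 x (M.active_diff_iff.2 ⟨hx, hxd, hxe⟩)

end CombMap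

end Potential

/-! ### Coding planar maps by the contour of a spanning tree -/

section Contour

open scoped Classical

/-- Matchings without crossings (between pairs of the same type) are determined by the set of the
left ends. -/
theorem matching_unique {k : ℕ} {E E' : Fin k → Fin k} {τ : Fin k → Prop}
    (hE : ∀ i, E (E i) = i) (hE' : ∀ i, E' (E' i) = i) (hne : ∀ i, E i ≠ i)
    (hne' : ∀ i, E' i ≠ i)
    (hτ : ∀ i, τ (E i) ↔ τ i) (hτ' : ∀ i, τ (E' i) ↔ τ i)
    (ho : ∀ i, i < E i ↔ i < E' i)
    (hc : ∀ i j, (τ i ↔ τ j) → i < j → j < E i → i < E j ∧ E j < E i)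
    (hc' : ∀ i j, (τ i ↔ τ j) → i < j → j < E' i → i < E' j ∧ E' j < E' i) : E = E' := by
  -- Induction on the length of an arc of `E`. If `E'` joined the right end of the arc to another
  -- point, the absence of crossings would produce a strictly shorter arc of `E` inside it on which
  -- the two matchings also differ.
  have key : ∀ n : ℕ, ∀ i, i < E i → (E i : ℕ) - i = n → E' i = E i := by
    intro n
    induction n using Nat.strong_induction_on with
    | _ n ih =>
      intro i hi hn
      have hj : ¬ E i < E' (E i) := by
        rw [← ho, hE]; exact not_lt.2 hi.le
      have hi' : E' (E i) < E i := lt_of_le_of_ne (not_lt.1 hj) (hne' _)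
      have ht : τ i ↔ τ (E' (E i)) := by rw [hτ', hτ]
      rcases lt_trichotomy i (E' (E i)) with h | h | h
      · exfalso
        have h1 := hc i _ ht h hi'
        have h2 : E' (E i) < E (E' (E i)) := by rw [ho, hE']; exact hi'
        have h3 := ih _ (by
          have := Fin.lt_def.1 h; have := Fin.lt_def.1 hi'; have := Fin.lt_def.1 h1.2
          omega) _ h2 rfl
        rw [hE'] at h3
        have h4 := congrArg E h3
        rw [hE, hE] at h4
        exact h.ne h4
      · rw [h, hE', ← h]
      · exfalso
        have h0 : i < E' i := (ho i).1 hi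
        have h1 := hc' _ i ht.symm h (by rw [hE']; exact hi)
        rw [hE'] at h1
        have h2 := hc i (E' i) (by rw [hτ']) h0 h1.2
        have h3 : E (E' i) < E (E (E' i)) := by
          rw [hE]
          have h4 : ¬ E' i < E (E' i) := by rw [ho, hE']; exact not_lt.2 h0.le
          exact lt_of_le_of_ne (not_lt.1 h4) (hne _)
        have h4 := ih _ (by
          rw [hE]
          have := Fin.lt_def.1 h1.2; have := Fin.lt_def.1 h2.1; rw [hE] at h3
          have := Fin.lt_def.1 h3
          omega) _ h3 rfl
        rw [hE] at h4
        have h5 := congrArg E' h4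
        rw [hE', hE'] at h5
        exact h2.1.ne' h5
  funext i
  by_cases hi : i < E i
  · exact (key _ i hi rfl).symm
  · have h2 : E i < E (E i) := by rw [hE]; exact lt_of_le_of_ne (not_lt.1 hi) (hne i)
    have h3 := key _ _ h2 rfl
    rw [hE] at h3
    have h4 := congrArg E' h3
    rwa [hE'] at h4

/-- The cyclic successor. -/
def finSucc {k : ℕ} (i : Fin k) : Fin k := ⟨(i + 1) % k, Nat.mod_lt _ (i.pos)⟩

/-- The transposition short-circuits the cyclic walk: `d` is now followed by the successor of `e`,
and `e` by the successor of `d`. So the points after `d` up to and including `e` form an invariant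
arc. -/
theorem arc_invariant {D : Type} {π : Perm D} {k : ℕ} {ε : D ≃ Fin k}
    (hπ : ∀ x, ε (π x) = finSucc (ε x)) {d e : D} (hde : ε d < ε e) {x y : D}
    (h : (π * swap d e).SameCycle x y) :
    (ε d < ε x ∧ ε x ≤ ε e) ↔ (ε d < ε y ∧ ε y ≤ ε e) := by
  let t : Setoid D :=
    { r := fun a b => (ε d < ε a ∧ ε a ≤ ε e) ↔ (ε d < ε b ∧ ε b ≤ ε e)
      iseqv := ⟨fun _ => Iff.rfl, Iff.symm, Iff.trans⟩ }
  have h1 : cyc (π * swap d e) ≤ t := by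
    rw [cyc_le]
    intro a
    change (ε d < ε a ∧ ε a ≤ ε e) ↔
      (ε d < ε ((π * swap d e) a) ∧ ε ((π * swap d e) a) ≤ ε e)
    rw [Perm.mul_apply, hπ]
    have he := (ε e).isLt
    have ha := (ε a).isLt
    simp only [Fin.lt_def, Fin.le_def, finSucc] at *
    by_cases h2 : a = d
    · subst h2
      rw [swap_apply_left]
      rcases Nat.lt_or_ge ((ε e : ℕ) + 1) k with h3 | h3
      · rw [Nat.mod_eq_of_lt h3]; omega
      · rw [show (ε e : ℕ) + 1 = k by omega, Nat.mod_self]; omega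
    by_cases h3 : a = e
    · subst h3
      rw [swap_apply_right, Nat.mod_eq_of_lt (by omega)]; omega
    rw [swap_apply_of_ne_of_ne h2 h3]
    have h4 : (ε a : ℕ) ≠ ε d := fun h5 => h2 (ε.injective (Fin.ext h5))
    have h5 : (ε a : ℕ) ≠ ε e := fun h5 => h3 (ε.injective (Fin.ext h5))
    rcases Nat.lt_or_ge ((ε a : ℕ) + 1) k with h6 | h6
    · rw [Nat.mod_eq_of_lt h6]; omega
    · rw [show (ε a : ℕ) + 1 = k by omega, Nat.mod_self]; omega
  exact h1 h

theorem exists_enumeration {D : Type} [Finite D] {π : Perm D} (r : D)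
    (h : ∀ x, π.SameCycle r x) :
    ∃ ε : D ≃ Fin (Nat.card D), ∀ x, ε (π x) = finSucc (ε x) := by
  set p := Function.minimalPeriod π r with hp
  have hp0 : 0 < p := Function.minimalPeriod_pos_of_mem_periodicPts
    (by
      refine ⟨orderOf π, orderOf_pos π, ?_⟩
      rw [Function.IsPeriodicPt, Function.IsFixedPt, Perm.iterate_eq_pow, pow_orderOf_eq_one]
      rfl)
  have hmod : ∀ n : ℕ, (π ^ (n % p)) r = (π ^ n) r := by
    intro n
    rw [← Perm.iterate_eq_pow, ← Perm.iterate_eq_pow]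
    exact Function.iterate_mod_minimalPeriod_eq
  let f : Fin p → D := fun i => (π ^ (i : ℕ)) r
  have hf : Function.Bijective f := by
    constructor
    · intro i j hij
      have h1 : (π^[(i : ℕ)]) r = (π^[(j : ℕ)]) r := by
        rw [Perm.iterate_eq_pow, Perm.iterate_eq_pow]; exact hij
      exact Fin.ext ((Function.iterate_injOn_Iio_minimalPeriod (f := π) (x := r)) i.2 j.2 h1)
    · intro x
      obtain ⟨n, hn⟩ := (h x).exists_nat_pow_eq
      exact ⟨⟨n % p, Nat.mod_lt _ hp0⟩, by simp only [f]; rw [hmod, hn]⟩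
  have hcard : p = Nat.card D := by
    rw [← Nat.card_congr (Equiv.ofBijective f hf), Nat.card_eq_fintype_card, Fintype.card_fin]
  refine ⟨(Equiv.ofBijective f hf).symm.trans (finCongr hcard), fun x => ?_⟩
  obtain ⟨i, rfl⟩ := hf.2 x
  have h1 : π (f i) = f (finSucc i) := by
    simp only [f, finSucc]
    rw [hmod, pow_succ', Perm.mul_apply]
  rw [h1]
  have h2 : ∀ i, (Equiv.ofBijective f hf).symm (f i) = i := fun i =>
    (Equiv.ofBijective f hf).symm_apply_apply i
  rw [Equiv.trans_apply, Equiv.trans_apply, h2, h2]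
  ext
  simp [finSucc, hcard]

namespace CombMap

variable {D : Type} {M : CombMap D}

variable (M) in
/-- The numbering `ε` of the darts follows the contour of the spanning tree `T`. Its edges and the
other edges are matchings without crossings. The word `w` tells which darts are in the tree, and
which ones come before their inverses. -/
structure IsContour {k : ℕ} (ε : D ≃ Fin k) (T : Set D) (w : Fin k → Bool × Bool) : Prop where
  succ : ∀ d, ε (M.faceOn T d) = finSucc (ε d)
  tree : ∀ d, (w (ε d)).1 = true ↔ M.Active T d
  opening : ∀ d, (w (ε d)).2 = true ↔ ε d < ε (M.edge d)
  noncrossing : ∀ d d', (M.Active T d ↔ M.Active T d') → ε d < ε d' → ε d' < ε (M.edge d) →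
    ε d < ε (M.edge d') ∧ ε (M.edge d') < ε (M.edge d)

/-- A map on the sphere is determined by the word of its contour. -/
theorem IsContour.unique {D' : Type} {M' : CombMap D'} {k : ℕ} {ε : D ≃ Fin k} {ε' : D' ≃ Fin k}
    {T : Set D} {T' : Set D'} {w : Fin k → Bool × Bool} (h : M.IsContour ε T w)
    (h' : M'.IsContour ε' T' w) :
    (∀ d, ε'.symm (ε (M.edge d)) = M'.edge (ε'.symm (ε d))) ∧
      ∀ d, ε'.symm (ε (M.face d)) = M'.face (ε'.symm (ε d)) := by
  -- Read on the positions of the walk, `edge` is a matching in which arcs of the same type (tree or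
  -- not) do not cross, and the word lists types and left ends.
  have hE : (fun i => ε (M.edge (ε.symm i))) = fun i => ε' (M'.edge (ε'.symm i)) := by
    refine matching_unique (τ := fun i => (w i).1 = true) ?_ ?_ ?_ ?_ ?_ ?_ ?_ ?_ ?_
    · intro i; simp [M.edge_edge]
    · intro i; simp [M'.edge_edge]
    · intro i hi
      refine M.edge_ne (ε.symm i) (ε.injective ?_)
      rw [hi, Equiv.apply_symm_apply]
    · intro i hi
      refine M'.edge_ne (ε'.symm i) (ε'.injective ?_)
      rw [hi, Equiv.apply_symm_apply]
    · intro i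
      have h1 := h.tree (ε.symm i)
      rw [Equiv.apply_symm_apply] at h1
      rw [h.tree, active_edge_iff, h1]
    · intro i
      have h1 := h'.tree (ε'.symm i)
      rw [Equiv.apply_symm_apply] at h1
      rw [h'.tree, active_edge_iff, h1]
    · intro i
      have h1 := h.opening (ε.symm i)
      have h2 := h'.opening (ε'.symm i)
      rw [Equiv.apply_symm_apply] at h1 h2
      rw [← h1, ← h2]
    · intro i j hij h1 h2
      have := h.noncrossing (ε.symm i) (ε.symm j) (by
        rw [← h.tree, ← h.tree]; simpa using hij)
      simp only [Equiv.apply_symm_apply] at this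
      exact this h1 h2
    · intro i j hij h1 h2
      have := h'.noncrossing (ε'.symm i) (ε'.symm j) (by
        rw [← h'.tree, ← h'.tree]; simpa using hij)
      simp only [Equiv.apply_symm_apply] at this
      exact this h1 h2
  have hedge : ∀ d, ε'.symm (ε (M.edge d)) = M'.edge (ε'.symm (ε d)) := by
    intro d
    have := congrFun hE (ε d)
    simp only [Equiv.symm_apply_apply] at this
    rw [this, Equiv.symm_apply_apply]
  refine ⟨hedge, fun d => ?_⟩
  have hact : ∀ d, M.Active T d ↔ M'.Active T' (ε'.symm (ε d)) := by
    intro d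
    rw [← h.tree, ← h'.tree, Equiv.apply_symm_apply]
  -- The walk moves by `face` at tree darts and by `vert` elsewhere; together with `edge` this
  -- determines `face` everywhere.
  have hfaceOn : ∀ d, ε'.symm (ε (M.faceOn T d)) = M'.faceOn T' (ε'.symm (ε d)) := by
    intro d
    rw [h.succ, Equiv.symm_apply_eq, h'.succ, Equiv.apply_symm_apply]
  by_cases hd : M.Active T d
  · have h1 := hfaceOn d
    rwa [faceOn_of_active hd, faceOn_of_active ((hact d).1 hd)] at h1
  · have hd' : ¬ M.Active T (M.edge d) := fun h1 => hd (M.active_edge_iff.1 h1)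
    have h1 := hfaceOn (M.edge d)
    have hd2 := fun h1 => hd' ((hact _).2 h1)
    rw [faceOn_of_not_active hd', faceOn_of_not_active hd2, vert_edge, hedge, vert_edge] at h1
    exact h1

theorem active_union_iff {T : Set D} {d x : D} :
    M.Active (T ∪ {d, M.edge d}) x ↔ M.Active T x ∨ x = d ∨ x = M.edge d := by
  have h1 : M.edge x = d ↔ x = M.edge d :=
    ⟨fun h => by rw [← h, M.edge_edge], fun h => by rw [h, M.edge_edge]⟩
  have h2 : M.edge x = M.edge d ↔ x = d := M.edge.injective.eq_iff
  simp only [Active, Set.mem_union, Set.mem_insert_iff, Set.mem_singleton_iff, h1, h2]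
  tauto

theorem edgeOn_congr {A B : Set D} (h : ∀ x, M.Active A x ↔ M.Active B x) :
    M.edgeOn A = M.edgeOn B := by
  ext x
  by_cases hx : M.Active A x
  · rw [edgeOn_of_active hx, edgeOn_of_active ((h x).1 hx)]
  · rw [edgeOn_of_not_active hx, edgeOn_of_not_active (fun h1 => hx ((h x).2 h1))]

theorem edgeOn_union_diff {T : Set D} {d : D} (hd : ¬ M.Active T d) :
    M.edgeOn ((T ∪ {d, M.edge d}) \ {d}) = M.edgeOn T := by
  refine edgeOn_congr fun x => ?_
  rw [active_diff_iff, active_union_iff]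
  constructor
  · tauto
  · intro hx
    refine ⟨Or.inl hx, ?_, ?_⟩
    · rintro rfl; exact hd hx
    · rintro rfl; exact hd (M.active_edge_iff.1 hx)

theorem faceOn_union {T : Set D} {d : D} (hd : ¬ M.Active T d) :
    M.faceOn (T ∪ {d, M.edge d}) = M.faceOn T * swap d (M.edge d) := by
  have h1 : M.Active (T ∪ {d, M.edge d}) d := M.active_union_iff.2 (Or.inr (Or.inl rfl))
  have h2 := M.edgeOn_diff h1
  rw [edgeOn_union_diff hd] at h2
  rw [faceOn, faceOn, h2, mul_assoc, mul_assoc, swap_mul_self, mul_one]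

variable [Finite D]

/-- For a minimal connected set of edges every edge separates, so by the Jordan curve theorem it has
one face on both sides. Then faces never change along the connected graph: there is only one. -/
theorem exists_spanning_tree (hM : M.Spherical) (hc : ∀ x y, M.connOn Set.univ x y) :
    ∃ T : Set D, (∀ x y, M.connOn T x y) ∧ ∀ x y, (M.faceOn T).SameCycle x y := by
  obtain ⟨T, hT, hmin⟩ : ∃ T : Set D, (∀ x y, M.connOn T x y) ∧
      ∀ T' ⊂ T, ¬ ∀ x y, M.connOn T' x y := by
    obtain ⟨T, hT1, hT2⟩ := (Set.toFinite {T : Set D | ∀ x y, M.connOn T x y}).exists_minimal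
      ⟨Set.univ, hc⟩
    exact ⟨T, hT1, fun T' h1 h2 => h1.2 (hT2 h2 h1.1)⟩
  refine ⟨T, hT, ?_⟩
  have h1 : ∀ d, M.Active T d → (M.faceOn T).SameCycle d (M.edge d) := by
    intro d hd
    by_contra hs
    have h2 := (hM.jordan hd).2 hs
    refine hmin (T \ {d}) ⟨Set.sdiff_subset, fun h3 => (h3 hd.1).2 rfl⟩ fun x y => ?_
    rcases connOn_diff (d := d) (hT x y) with h3 | ⟨h3 | h3, h4 | h4⟩
    · exact h3
    · exact Setoid.trans' _ h3 (Setoid.symm' _ h4)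
    · exact Setoid.trans' _ h3 (Setoid.trans' _ h2 (Setoid.symm' _ h4))
    · exact Setoid.trans' _ h3 (Setoid.trans' _ (Setoid.symm' _ h2) (Setoid.symm' _ h4))
    · exact Setoid.trans' _ h3 (Setoid.symm' _ h4)
  have h2 : M.connOn T ≤ cyc (M.faceOn T) := by
    refine connOn_le (fun x => ?_) fun x hx => h1 x hx
    by_cases hx : M.Active T x
    · have h3 := cyc_apply (M.faceOn T) (M.edge x)
      rw [faceOn_of_active hx.edge, ← vert_apply] at h3
      exact (h1 x hx).trans h3
    · have h3 := cyc_apply (M.faceOn T) x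
      rwa [faceOn_of_not_active hx] at h3
  exact fun x y => h2 (hT x y)

/-- If two tree edges crossed, the second would reconnect the two parts left by deleting the first.
If two other edges crossed, adding the first would put the ends of the second into different faces;
adding the second would merge these faces, giving a non-separating edge with the same face on both
sides. Both contradict the Jordan curve theorem. -/
theorem exists_contour (hM : M.Spherical) (hc : ∀ x y, M.connOn Set.univ x y) (r : D) :
    ∃ (ε : D ≃ Fin (Nat.card D)) (T : Set D) (w : Fin (Nat.card D) → Bool × Bool),
      M.IsContour ε T w := by
  obtain ⟨T, hT, hs⟩ := exists_spanning_tree hM hc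
  obtain ⟨ε, hε⟩ := exists_enumeration r (hs r)
  refine ⟨ε, T, fun i => (decide (M.Active T (ε.symm i)),
    decide (ε (ε.symm i) < ε (M.edge (ε.symm i)))), hε, by simp, by simp, ?_⟩
  intro d d' hact h1 h2
  by_contra hcon
  have hin : ε d < ε d' ∧ ε d' ≤ ε (M.edge d) := ⟨h1, h2.le⟩
  have hout : ¬ (ε d < ε (M.edge d') ∧ ε (M.edge d') ≤ ε (M.edge d)) := by
    rintro ⟨h3, h4⟩
    refine hcon ⟨h3, h4.lt_of_ne fun h5 => ?_⟩
    rw [M.edge.injective (ε.injective h5)] at h1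
    exact lt_irrefl _ h1
  have hde : ε d < ε (M.edge d) := h1.trans h2
  have hdd' : d' ≠ d := by rintro rfl; exact lt_irrefl _ h1
  have hdd'' : d' ≠ M.edge d := by rintro rfl; exact lt_irrefl _ h2
  by_cases hd : M.Active T d
  · have hd' := hact.1 hd
    have harc : ∀ {x y}, (M.faceOn (T \ {d})).SameCycle x y →
        ((ε d < ε x ∧ ε x ≤ ε (M.edge d)) ↔ (ε d < ε y ∧ ε y ≤ ε (M.edge d))) := by
      intro x y hxy
      rw [faceOn, edgeOn_diff _ hd, ← mul_assoc] at hxy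
      exact arc_invariant hε hde hxy
    have hor : ∀ x, (M.faceOn (T \ {d})).SameCycle x d ∨
        (M.faceOn (T \ {d})).SameCycle x (M.edge d) := by
      intro x
      rcases sameCycle_faceOn_diff (d := d) (hs x d) with h3 | ⟨h3, -⟩
      · exact Or.inl h3
      · exact h3
    have e1 : (M.faceOn (T \ {d})).SameCycle d' (M.edge d) := by
      rcases hor d' with h3 | h3
      · exact absurd ((harc h3).1 hin).1 (lt_irrefl _)
      · exact h3
    have e2 : (M.faceOn (T \ {d})).SameCycle (M.edge d') d := by
      rcases hor (M.edge d') with h3 | h3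
      · exact h3
      · exact absurd ((harc h3).2 ⟨hde, le_rfl⟩) hout
    have h3 : M.Active (T \ {d}) d' := M.active_diff_iff.2 ⟨hd', hdd', hdd''⟩
    have h4 : M.connOn (T \ {d}) d (M.edge d) :=
      Setoid.trans' _ (Setoid.symm' _ (connOn_of_sameCycle e2))
        (Setoid.trans' _ (Setoid.symm' _ (connOn_edge h3)) (connOn_of_sameCycle e1))
    exact (hM.jordan hd).1 h4 (hs _ _)
  · have hd' : ¬ M.Active T d' := fun h => hd (hact.2 h)
    set B := T ∪ {d, M.edge d} with hB
    have hBd : ¬ M.Active B d' := by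
      rw [hB, active_union_iff]; tauto
    have h3 : ¬ (M.faceOn B).SameCycle d' (M.edge d') := by
      intro h3
      rw [hB, faceOn_union hd] at h3
      exact hout ((arc_invariant hε hde h3).1 hin)
    have h4 : M.Active (B ∪ {d', M.edge d'}) d' := M.active_union_iff.2 (Or.inr (Or.inl rfl))
    refine (hM.jordan h4).1 ?_ ?_
    · rw [connOn, edgeOn_union_diff hBd]
      exact connOn_mono Set.subset_union_left (hT _ _)
    · rw [faceOn_union hBd]
      exact sameCycle_mul_swap h3

end CombMap

end Contour

/-! ### Homotopy of edge paths and the fundamental group -/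

section Homotopy

namespace CombMap

variable {D : Type} (M : CombMap D)

/-- The list of darts `l` is a path from the vertex `x` to the vertex `y`. -/
def IsPath : M.Vertex → List D → M.Vertex → Prop
  | x, [], y => x = y
  | x, d :: l, y => M.vertexOf d = x ∧ IsPath (M.vertexOf (M.edge d)) l y

/-- Elementary homotopies of paths: removing an edge followed by its inverse, and removing the
boundary of a face in the set `F`. -/
inductive PathStep (F : D → Prop) : List D → List D → Prop
  | backtrack (a b : List D) (d : D) : PathStep F (a ++ d :: M.edge d :: b) (a ++ b)
  | triangle (a b : List D) (d : D) (hd : F d) :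
      PathStep F (a ++ d :: M.face d :: M.face (M.face d) :: b) (a ++ b)

/-- Homotopy of paths from `x` to `y` relative to the end points. -/
def Homotopic (F : D → Prop) (x y : M.Vertex) : List D → List D → Prop :=
  Relation.EqvGen fun l l' => M.IsPath x l y ∧ M.IsPath x l' y ∧ M.PathStep F l l'

/-- The reversed path. -/
def reversePath (l : List D) : List D := (l.map M.edge).reverse

variable {M} {F : D → Prop}

theorem isPath_nil (x : M.Vertex) : M.IsPath x [] x := rfl

theorem isPath_singleton (d : D) : M.IsPath (M.vertexOf d) [d] (M.vertexOf (M.edge d)) :=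
  ⟨rfl, rfl⟩

theorem IsPath.append {x y z : M.Vertex} {l l' : List D} (h : M.IsPath x l y)
    (h' : M.IsPath y l' z) : M.IsPath x (l ++ l') z := by
  induction l generalizing x with
  | nil => cases h; exact h'
  | cons d l ih => exact ⟨h.1, ih h.2⟩

theorem IsPath.reverse {x y : M.Vertex} {l : List D} (h : M.IsPath x l y) :
    M.IsPath y (M.reversePath l) x := by
  induction l generalizing x with
  | nil => exact h.symm
  | cons d l ih =>
    rw [reversePath, List.map_cons, List.reverse_cons]
    exact (ih h.2).append ⟨rfl, by rw [M.edge_edge]; exact h.1⟩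

theorem length_reversePath (l : List D) : (M.reversePath l).length = l.length := by
  simp [reversePath]

theorem PathStep.append {l l' : List D} (h : M.PathStep F l l') (a b : List D) :
    M.PathStep F (a ++ l ++ b) (a ++ l' ++ b) := by
  cases h with
  | backtrack p q d =>
    have := PathStep.backtrack (M := M) (F := F) (a ++ p) (q ++ b) d
    simpa using this
  | triangle p q d hd =>
    have := PathStep.triangle (M := M) (F := F) (a ++ p) (q ++ b) d hd
    simpa using this

theorem Homotopic.refl {x y : M.Vertex} (l : List D) : M.Homotopic F x y l l :=
  Relation.EqvGen.refl l

theorem Homotopic.symm {x y : M.Vertex} {l l' : List D} (h : M.Homotopic F x y l l') :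
    M.Homotopic F x y l' l := Relation.EqvGen.symm _ _ h

theorem Homotopic.trans {x y : M.Vertex} {l l' l'' : List D} (h : M.Homotopic F x y l l')
    (h' : M.Homotopic F x y l' l'') : M.Homotopic F x y l l'' := Relation.EqvGen.trans _ _ _ h h'

theorem Homotopic.append {x y x' y' : M.Vertex} {l l' a b : List D}
    (h : M.Homotopic F x y l l') (ha : M.IsPath x' a x) (hb : M.IsPath y b y') :
    M.Homotopic F x' y' (a ++ l ++ b) (a ++ l' ++ b) := by
  induction h with
  | rel l l' h =>
    exact Relation.EqvGen.rel _ _ ⟨(ha.append h.1).append hb, (ha.append h.2.1).append hb,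
      h.2.2.append a b⟩
  | refl l => exact .refl _
  | symm l l' _ ih => exact ih.symm
  | trans l l' l'' _ _ ih ih' => exact ih.trans ih'

theorem homotopic_reverse {x y : M.Vertex} {l : List D} (h : M.IsPath x l y) :
    M.Homotopic F x x (l ++ M.reversePath l) [] := by
  induction l generalizing x with
  | nil => exact .refl _
  | cons d l ih =>
    have h1 : M.IsPath (M.vertexOf (M.edge d)) [M.edge d] x :=
      ⟨rfl, by rw [M.edge_edge]; exact h.1⟩
    have h2 : M.IsPath x [d] (M.vertexOf (M.edge d)) := ⟨h.1, rfl⟩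
    have h3 := (ih h.2).append h2 h1
    have h4 : M.Homotopic F x x [d, M.edge d] [] :=
      Relation.EqvGen.rel _ _ ⟨h2.append h1, rfl, PathStep.backtrack [] [] d⟩
    refine Homotopic.trans ?_ (Homotopic.trans h3 h4)
    simp only [reversePath, List.map_cons, List.reverse_cons, List.append_assoc,
      List.cons_append, List.nil_append]
    exact .refl _

theorem reversePath_reversePath (l : List D) : M.reversePath (M.reversePath l) = l := by
  simp only [reversePath, List.map_reverse, List.reverse_reverse, List.map_map]
  exact (List.map_congr_left fun d _ => M.edge_edge d).trans (List.map_id l)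

theorem homotopic_reverse' {x y : M.Vertex} {l : List D} (h : M.IsPath x l y) :
    M.Homotopic F y y (M.reversePath l ++ l) [] := by
  have := homotopic_reverse (F := F) h.reverse
  rwa [reversePath_reversePath] at this

/-! ### The fundamental group -/

variable (M F) in
/-- Loops at `x` up to homotopy. -/
def loopSetoid (x : M.Vertex) : Setoid {l : List D // M.IsPath x l x} where
  r l l' := M.Homotopic F x x l l'
  iseqv := ⟨fun _ => .refl _, .symm, .trans⟩

variable (M F) in
def LoopGroup (x : M.Vertex) : Type := Quotient (M.loopSetoid F x)

variable (F) in
def loopClass {x : M.Vertex} (l : List D) (h : M.IsPath x l x) : M.LoopGroup F x :=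
  Quotient.mk (M.loopSetoid F x) ⟨l, h⟩

theorem loopClass_eq {x : M.Vertex} {l l' : List D} {h : M.IsPath x l x} {h' : M.IsPath x l' x} :
    loopClass F l h = loopClass F l' h' ↔ M.Homotopic F x x l l' :=
  ⟨fun h => Quotient.exact h, fun h => Quotient.sound h⟩

theorem Homotopic.reverse {x y : M.Vertex} {l l' : List D} (hl : M.IsPath x l y)
    (hl' : M.IsPath x l' y) (h : M.Homotopic F x y l l') :
    M.Homotopic F y x (M.reversePath l) (M.reversePath l') := by
  have h1 := (homotopic_reverse (F := F) hl').append hl.reverse (b := []) rfl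
  have h2 := h.append hl.reverse hl'.reverse
  have h3 := (homotopic_reverse' (F := F) hl).append (a := []) rfl hl'.reverse
  simp only [List.append_nil, List.nil_append, List.append_assoc] at h1 h2 h3
  exact (h1.symm.trans h2.symm).trans h3

instance (x : M.Vertex) : Group (M.LoopGroup F x) where
  mul := Quotient.map₂ (fun l l' => ⟨l.1 ++ l'.1, l.2.append l'.2⟩) (by
    intro a a' ha b b' hb
    have h1 := Homotopic.append ha (a := []) rfl b.2
    have h2 := Homotopic.append hb a'.2 (b := []) rfl
    simp only [List.append_nil, List.nil_append] at h1 h2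
    exact h1.trans h2)
  one := loopClass F [] rfl
  inv := Quotient.map (fun l => ⟨M.reversePath l.1, l.2.reverse⟩) (by
    intro a b h
    exact Homotopic.reverse a.2 b.2 h)
  mul_assoc := by
    rintro ⟨a⟩ ⟨b⟩ ⟨c⟩
    exact loopClass_eq.2 (by rw [List.append_assoc]; exact .refl _)
  one_mul := by
    rintro ⟨a⟩
    exact loopClass_eq.2 (.refl _)
  mul_one := by
    rintro ⟨a⟩
    exact loopClass_eq.2 (by rw [List.append_nil]; exact .refl _)
  inv_mul_cancel := by
    rintro ⟨a⟩
    exact loopClass_eq.2 (homotopic_reverse' a.2)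

theorem loopClass_mul {x : M.Vertex} {l l' : List D} (h : M.IsPath x l x) (h' : M.IsPath x l' x) :
    loopClass F l h * loopClass F l' h' = loopClass F (l ++ l') (h.append h') := rfl

/-- There is an edge function with values in the fundamental group that detects homotopies. -/
theorem exists_detecting (x₀ : M.Vertex) (hc : ∀ y, ∃ l, M.IsPath x₀ l y)
    (hF : ∀ d, F d → M.face (M.face (M.face d)) = d) :
    ∃ (G : Type) (_ : Group G) (h : D → G), (∀ d, h (M.edge d) = (h d)⁻¹) ∧
      (∀ d, F d → h d * (h (M.face d) * h (M.face (M.face d))) = 1) ∧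
      ∀ x y l l', M.IsPath x l y → M.IsPath x l' y → (l.map h).prod = (l'.map h).prod →
        M.Homotopic F x y l l' := by
  choose τ hτ using hc
  have hd : ∀ d, M.IsPath x₀ (τ (M.vertexOf d) ++ [d] ++
      M.reversePath (τ (M.vertexOf (M.edge d)))) x₀ := fun d =>
    ((hτ _).append (isPath_singleton d)).append (hτ _).reverse
  have hl : ∀ {x y l}, M.IsPath x l y → M.IsPath x₀ (τ x ++ l ++ M.reversePath (τ y)) x₀ :=
    fun h => ((hτ _).append h).append (hτ _).reverse
  let h : D → M.LoopGroup F x₀ := fun d => loopClass F _ (hd d)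
  -- `h d` is the class of the loop that runs out along `τ`, across `d` and back. Along a path these
  -- loops telescope to the path closed up by `τ`, so the product remembers its homotopy class.
  have key : ∀ {x y l} (hxy : M.IsPath x l y), (l.map h).prod = loopClass F _ (hl hxy) := by
    intro x y l hxy
    induction l generalizing x with
    | nil =>
      cases hxy
      rw [List.map_nil, List.prod_nil]
      refine (loopClass_eq (h := isPath_nil _)).2 ?_
      have := homotopic_reverse (F := F) (hτ y)
      simpa using this.symm
    | cons d l ih =>
      obtain ⟨rfl, h2⟩ := hxy
      rw [List.map_cons, List.prod_cons, ih h2]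
      simp only [h]
      rw [loopClass_mul, loopClass_eq]
      have h3 := (homotopic_reverse' (F := F) (hτ (M.vertexOf (M.edge d)))).append
        ((hτ (M.vertexOf d)).append (isPath_singleton d)) (h2.append (hτ y).reverse)
      simpa using h3
  have hclosed : ∀ {x l}, M.IsPath x l x → M.Homotopic F x x l [] → (l.map h).prod = 1 := by
    intro x l hxl h1
    have h2 := key (isPath_nil x)
    rw [List.map_nil, List.prod_nil] at h2
    rw [key hxl, h2, loopClass_eq]
    exact h1.append (hτ x) (hτ x).reverse
  refine ⟨M.LoopGroup F x₀, inferInstance, h, ?_, ?_, ?_⟩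
  · intro d
    have h1 : M.IsPath (M.vertexOf d) [d, M.edge d] (M.vertexOf d) :=
      ⟨rfl, rfl, by rw [M.edge_edge]; rfl⟩
    have h2 := hclosed h1 (homotopic_reverse (isPath_singleton d))
    simp only [List.map_cons, List.map_nil, List.prod_cons, List.prod_nil, mul_one] at h2
    exact (inv_eq_of_mul_eq_one_right h2).symm
  · intro d hFd
    have hv : ∀ d, M.vertexOf (M.edge d) = M.vertexOf (M.face d) := fun d =>
      Quotient.sound (by
        have := cyc_apply M.vert (M.edge d)
        rwa [vert_edge] at this)
    have h1 : M.IsPath (M.vertexOf d) [d, M.face d, M.face (M.face d)] (M.vertexOf d) :=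
      ⟨rfl, (hv d).symm, (hv _).symm, by rw [hv, hF d hFd]; rfl⟩
    have h2 := hclosed h1 (Relation.EqvGen.rel _ _ ⟨h1, rfl, PathStep.triangle [] [] d hFd⟩)
    simpa only [List.map_cons, List.map_nil, List.prod_cons, List.prod_nil, mul_one] using h2
  · intro x y l l' hxl hxl' hp
    rw [key hxl, key hxl', loopClass_eq] at hp
    have h1 := hp.append (hτ x).reverse (hτ y)
    have aux : ∀ {l}, M.IsPath x l y → M.Homotopic F x y
        (M.reversePath (τ x) ++ (τ x ++ l ++ M.reversePath (τ y)) ++ τ y) l := by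
      intro l hl
      have e1 := (homotopic_reverse' (F := F) (hτ x)).append (a := []) rfl
        ((hl.append (hτ y).reverse).append (hτ y))
      have e2 := (homotopic_reverse' (F := F) (hτ y)).append hl (b := []) rfl
      simp only [List.append_nil, List.nil_append, List.append_assoc] at e1 e2 ⊢
      exact e1.trans e2
    exact ((aux hxl).symm.trans h1).trans (aux hxl')

end CombMap

end Homotopy

/-! ### Minimal curves are geodesics inside the pairs of pants -/

section Geodesic

namespace CombMap

variable {D : Type} {M : CombMap D}

theorem vertexOf_eq_iff {d d' : D} : M.vertexOf d = M.vertexOf d' ↔ M.vert.SameCycle d d' :=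
  ⟨fun h => Quotient.exact h, fun h => Quotient.sound h⟩

theorem faceOf_eq_iff {d d' : D} : M.faceOf d = M.faceOf d' ↔ M.face.SameCycle d d' :=
  ⟨fun h => Quotient.exact h, fun h => Quotient.sound h⟩

theorem vertexOf_edge (d : D) : M.vertexOf (M.edge d) = M.vertexOf (M.face d) := by
  have := cyc_apply M.vert (M.edge d)
  rw [vert_edge] at this
  exact vertexOf_eq_iff.2 this

theorem faceOf_face (d : D) : M.faceOf (M.face d) = M.faceOf d :=
  faceOf_eq_iff.2 (Perm.sameCycle_apply_left.2 (Perm.SameCycle.refl _ _))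

theorem isPath_iterate (x : D) (n : ℕ) :
    M.IsPath (M.vertexOf x) (List.iterate M.face x n) (M.vertexOf (M.face^[n] x)) := by
  induction n generalizing x with
  | zero => rfl
  | succ n ih => exact ⟨rfl, by rw [vertexOf_edge]; exact ih _⟩

end CombMap

theorem isRotated_iterate {X : Type} {f : X → X} {x : X} {n : ℕ} (h : f^[n] x = x) :
    ((List.iterate f (f x) n : List X) : Cycle X) = (List.iterate f x n : List X) := by
  cases n with
  | zero => rfl
  | succ n =>
    have h1 : List.iterate f (f x) (n + 1) = List.iterate f (f x) n ++ [x] := by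
      rw [List.iterate_add]
      congr 1
      simpa [List.iterate] using h
    rw [h1]
    exact (Cycle.coe_cons_eq_coe_append _ x).symm

namespace CombPants

variable (P : CombPants)

/-- Homotopy in the complex `Δ`. -/
abbrev Homotopic (x y : P.map.Vertex) (l l' : List P.Dart) : Prop :=
  P.map.Homotopic (fun d => ¬ P.IsBdry d) x y l l'

/-- The boundary curves cannot be shortened by a homotopy in `Δ`. -/
def Geodesic : Prop :=
  ∀ (x : P.Dart) (n : ℕ) (l : List P.Dart), P.IsBdry x →
    n ≤ Function.minimalPeriod P.map.face x →
    P.Homotopic (P.map.vertexOf x) (P.map.vertexOf (P.map.face^[n] x))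
      (List.iterate P.map.face x n) l → n ≤ l.length

end CombPants

namespace PantsDecomposition

variable {N : ℕ} {S : CombSurface N} {n : ℕ} (Q : PantsDecomposition S n)

theorem isClosedCurve_proj {i : Fin n} {x : (Q.pants i).map.Vertex} {l : List (Q.pants i).Dart}
    (h : (Q.pants i).map.IsPath x l x) :
    S.IsClosedCurve ((l.map fun d => Q.proj ⟨i, d⟩ : List (Side N)) : Cycle (Side N)) := by
  have hv : ∀ a b : (Q.pants i).Dart,
      (Q.pants i).map.vertexOf (Q.pants i |>.map.edge a) = (Q.pants i).map.vertexOf b →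
      S.toMap.vertexOf (S.glue (Q.proj ⟨i, a⟩)) = S.toMap.vertexOf (Q.proj ⟨i, b⟩) := by
    intro a b hab
    have h1 : S.glue (Q.proj ⟨i, a⟩) = Q.proj ⟨i, (Q.pants i).map.edge a⟩ :=
      (Q.proj_edge ⟨i, a⟩).symm
    rw [h1, Q.proj_vertex_iff]
    refine Relation.EqvGen.rel _ _ (Or.inl ?_)
    rw [CombMap.vertexOf_eq_iff] at hab ⊢
    have h2 : cyc (Q.pants i).map.vert ≤ Setoid.comap (fun d => (⟨i, d⟩ : Σ i, (Q.pants i).Dart))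
        (cyc (unionMap Q.pants).vert) := by
      rw [cyc_le]
      intro d
      exact cyc_apply (unionMap Q.pants).vert ⟨i, d⟩
    exact h2 hab
  have key : ∀ (l : List (Q.pants i).Dart) (x y) (z : (Q.pants i).Dart),
      (Q.pants i).map.IsPath x l y → (Q.pants i).map.vertexOf z = y →
      List.IsChain (fun a b => S.toMap.vertexOf (S.glue a) = S.toMap.vertexOf b)
        ((l.map fun d => Q.proj ⟨i, d⟩) ++ [Q.proj ⟨i, z⟩]) := by
    intro l
    induction l with
    | nil => intro x y z _ _; exact List.isChain_singleton _
    | cons d l ih =>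
      intro x y z h1 h2
      have h3 := ih _ _ z h1.2 h2
      cases l with
      | nil =>
        refine List.isChain_cons_cons.2 ⟨hv _ _ ?_, h3⟩
        rw [h2]; exact h1.2
      | cons d' l =>
        exact List.isChain_cons_cons.2 ⟨hv _ _ h1.2.1.symm, h3⟩
  cases l with
  | nil => exact Cycle.Chain.nil _
  | cons d l =>
    have := key (d :: l) x x d h h.1
    exact this

/-- Triangles of the complex are triangles of the surface, so each elementary homotopy projects to
one, after the cyclic word has been rotated to put the removed piece in front. The return path `w`
closes the paths up. -/
theorem freelyHomotopic_proj {i : Fin n} {x y : (Q.pants i).map.Vertex}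
    {l l' w : List (Q.pants i).Dart} (h : (Q.pants i).Homotopic x y l l')
    (hw : (Q.pants i).map.IsPath y w x) :
    S.FreelyHomotopic (((l ++ w).map fun d => Q.proj ⟨i, d⟩ : List (Side N)) : Cycle (Side N))
      (((l' ++ w).map fun d => Q.proj ⟨i, d⟩ : List (Side N)) : Cycle (Side N)) := by
  induction h with
  | refl l => exact Relation.EqvGen.refl _
  | symm l l' _ ih => exact ih.symm
  | trans l l' l'' _ _ ih ih' => exact ih.trans _ _ _ ih'
  | rel l l' h =>
    obtain ⟨h1, h2, h3⟩ := h
    have h4 := Q.isClosedCurve_proj (h1.append hw)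
    refine Relation.EqvGen.rel _ _ ?_
    have rot : ∀ a b : List (Side N), ((a ++ b : List (Side N)) : Cycle (Side N)) =
        (b ++ a : List (Side N)) := fun a b => Cycle.coe_eq_coe.2 List.isRotated_append
    cases h3 with
    | backtrack a b d =>
      have e : Q.proj ⟨i, (Q.pants i).map.edge d⟩ = S.glue (Q.proj ⟨i, d⟩) := Q.proj_edge ⟨i, d⟩
      simp only [List.append_assoc, List.map_append, List.map_cons, List.cons_append, e] at h4 ⊢
      rw [rot] at h4
      rw [rot, rot (a.map _)]
      exact CombSurface.ElementaryHomotopy.backtrack _ _ h4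
    | triangle a b d hd =>
      have e : ∀ d, ¬ (Q.pants i).IsBdry d →
          Q.proj ⟨i, (Q.pants i).map.face d⟩ = nextSide N (Q.proj ⟨i, d⟩) :=
        fun d hd => Q.proj_face ⟨i, d⟩ hd
      have hd' : ¬ (Q.pants i).IsBdry ((Q.pants i).map.face d) := by
        rintro ⟨k, hk⟩
        exact hd ⟨k, by rwa [CombMap.faceOf_face] at hk⟩
      simp only [List.append_assoc, List.map_append, List.map_cons, List.cons_append, e d hd,
        e _ hd'] at h4 ⊢
      rw [rot] at h4
      rw [rot, rot (a.map _)]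
      exact CombSurface.ElementaryHomotopy.triangle _ _ h4

/-- Replacing a piece of a boundary curve by a shorter homotopic path, and keeping the rest, would
shorten the curve in its free homotopy class. -/
theorem Minimal.geodesic {Q : PantsDecomposition S n} (hQ : Q.Minimal) (i : Fin n) :
    (Q.pants i).Geodesic := by
  intro x m l hx hm hl
  have := (Q.pants i).finite
  set f := (Q.pants i).map.face with hf
  obtain ⟨k, hk⟩ := hx
  obtain ⟨j, hj⟩ := (CombMap.faceOf_eq_iff.1 hk.symm).exists_nat_pow_eq
  have hper : ∀ z, f^[Function.minimalPeriod f z] z = z :=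
    fun z => Function.iterate_minimalPeriod
  -- The piece may start anywhere on the curve; moving the starting point only rotates the cyclic
  -- word.
  have hrot : ∀ j : ℕ, Function.minimalPeriod f ((f ^ j) ((Q.pants i).base k)) =
      Function.minimalPeriod f ((Q.pants i).base k) ∧
      ((List.iterate f ((f ^ j) ((Q.pants i).base k)) (Function.minimalPeriod f
        ((Q.pants i).base k)) : List _) : Cycle (Q.pants i).Dart) =
      (List.iterate f ((Q.pants i).base k) (Function.minimalPeriod f
        ((Q.pants i).base k)) : List _) := by
    intro j
    induction j with
    | zero => exact ⟨rfl, rfl⟩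
    | succ j ih =>
      have h1 : (f ^ (j + 1)) ((Q.pants i).base k) = f ((f ^ j) ((Q.pants i).base k)) := by
        rw [pow_succ']; rfl
      rw [h1]
      refine ⟨?_, ?_⟩
      · rw [← ih.1]
        exact Function.minimalPeriod_apply (Function.mem_periodicPts.2
          ⟨orderOf f, orderOf_pos f, by
            rw [Function.IsPeriodicPt, Function.IsFixedPt, Perm.iterate_eq_pow,
              pow_orderOf_eq_one]; rfl⟩)
      · refine (isRotated_iterate ?_).trans ih.2
        have := hper ((f ^ j) ((Q.pants i).base k))
        rwa [ih.1] at this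
  obtain ⟨h1, h2⟩ := hrot j
  rw [hj] at h1 h2
  rw [h1] at hm
  set p := Function.minimalPeriod f ((Q.pants i).base k) with hp
  obtain ⟨r, hr⟩ := Nat.exists_eq_add_of_le hm
  have h3 : List.iterate f x p = List.iterate f x m ++ List.iterate f (f^[m] x) r := by
    rw [hr, List.iterate_add]
  have h4 : (Q.pants i).map.IsPath ((Q.pants i).map.vertexOf (f^[m] x))
      (List.iterate f (f^[m] x) r) ((Q.pants i).map.vertexOf x) := by
    have := CombMap.isPath_iterate (M := (Q.pants i).map) (f^[m] x) r
    rw [← hf, ← Function.iterate_add_apply, Nat.add_comm r m, ← hr] at this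
    rwa [show f^[p] x = x by rw [← h1]; exact hper x] at this
  have h5 := hQ i k _ (by
    have := Q.freelyHomotopic_proj hl h4
    rw [← h3] at this
    have h6 : Q.bdryCurve i k = (((List.iterate f x p).map fun d => Q.proj ⟨i, d⟩ :
        List (Side N)) : Cycle (Side N)) := by
      have := congrArg (Cycle.map fun d => Q.proj ⟨i, d⟩) h2
      simp only [Cycle.map_coe] at this
      exact this.symm
    rw [h6]
    exact this)
  have h7 : (Q.bdryCurve i k).length = p := by
    simp [PantsDecomposition.bdryCurve, CombMap.faceWalk, hp, hf]
  rw [h7] at h5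
  simp only [Cycle.length_coe, List.length_map, List.length_append, List.length_iterate] at h5
  omega

end PantsDecomposition

end Geodesic

/-! ### Boundary curves in simply connected parts of a pair of pants -/

section PantsBasics

open scoped Classical

theorem SameCycle.induction {D : Type} [Finite D] {π : Perm D} {p : D → Prop}
    (h : ∀ z, p z → p (π z)) {x y : D} (hx : p x) (hxy : π.SameCycle x y) : p y := by
  obtain ⟨n, rfl⟩ := hxy.exists_nat_pow_eq
  clear hxy
  induction n with
  | zero => exact hx
  | succ n ih => rw [pow_succ']; exact h _ ih

/-- The way along a cycle from `x` to another point `y`. -/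
theorem exists_first_visit {D : Type} [Finite D] {π : Perm D} {x y : D} (hxy : x ≠ y)
    (h : π.SameCycle x y) :
    ∃ a : ℕ, π^[a + 1] x = y ∧ ∀ i < a, π^[i + 1] x ≠ y ∧ π^[i + 1] x ≠ x := by
  have hex : ∃ n : ℕ, π^[n] x = y := by
    obtain ⟨n, hn⟩ := h.exists_nat_pow_eq
    exact ⟨n, by rw [Perm.iterate_eq_pow, hn]⟩
  have hspec := Nat.find_spec hex
  have hmin : ∀ i < Nat.find hex, π^[i] x ≠ y := fun i hi => Nat.find_min hex hi
  generalize Nat.find hex = n at *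
  cases n with
  | zero => exact absurd hspec hxy
  | succ a =>
    refine ⟨a, hspec, fun i hi => ⟨hmin _ (by omega), fun h1 => ?_⟩⟩
    refine hmin (a + 1 - (i + 1)) (by omega) ?_
    rw [← hspec]
    conv_rhs => rw [show a + 1 = (a + 1 - (i + 1)) + (i + 1) by omega, Function.iterate_add_apply,
      h1]

namespace CombMap

variable {D : Type} {M : CombMap D}

theorem two_mul_numCycles_edge [Finite D] (M : CombMap D) :
    2 * numCycles M.edge = Nat.card D := by
  have : Fintype D := Fintype.ofFinite D
  have : Fintype (Quotient (cyc M.edge)) := Fintype.ofFinite _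
  rw [numCycles, Nat.card_eq_fintype_card, Nat.card_eq_fintype_card, ← Finset.card_univ (α := D),
    Finset.card_eq_sum_card_fiberwise (f := Quotient.mk (cyc M.edge)) (t := Finset.univ)
      (fun _ _ => Finset.mem_univ _),
    Finset.sum_congr rfl (g := fun _ => 2), Finset.sum_const, Finset.card_univ, smul_eq_mul,
    mul_comm]
  intro q _
  induction q using Quotient.inductionOn with | _ d
  rw [Finset.card_eq_two]
  refine ⟨d, M.edge d, (M.edge_ne d).symm, ?_⟩
  ext x
  simp only [Finset.mem_filter, Finset.mem_univ, true_and, Finset.mem_insert, Finset.mem_singleton]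
  constructor
  · intro h
    have h1 : M.edge.SameCycle d x := (Quotient.exact h : M.edge.SameCycle x d).symm
    refine SameCycle.induction (p := fun x => x = d ∨ x = M.edge d) ?_ (Or.inl rfl) h1
    rintro z (rfl | rfl)
    · exact Or.inr rfl
    · exact Or.inl (M.edge_edge d)
  · rintro (rfl | rfl)
    · rfl
    · exact Quotient.sound (Perm.sameCycle_apply_left.2 (Perm.SameCycle.refl _ _))

theorem Connected.connOn_univ (h : M.Connected) (x y : D) : M.connOn Set.univ x y := by
  have h1 := h.2 x y
  have hA : ∀ d, M.Active Set.univ d := fun _ => ⟨trivial, trivial⟩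
  induction h1 with
  | refl x => exact Setoid.refl' _ _
  | symm x y _ ih => exact Setoid.symm' _ ih
  | trans x y z _ _ ih ih' => exact Setoid.trans' _ ih ih'
  | rel x y h =>
    rcases h with rfl | rfl
    · exact connOn_edge (hA x)
    · rw [← vert_edge]
      exact Setoid.trans' _ (connOn_edge (hA x)) (connOn_vert _)

theorem Connected.spherical [Finite D] (h : M.Connected) (h2 : M.eulerChar = 2) :
    M.Spherical := by
  have h3 : Nat.card (Quotient (conn M.vert M.edge)) = 1 := by
    rw [Nat.card_eq_one_iff_unique]
    refine ⟨⟨fun a b => ?_⟩, ⟨Quotient.mk _ h.1.some⟩⟩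
    induction a, b using Quotient.inductionOn₂ with | _ a b
    refine Quotient.sound ?_
    have := h.connOn_univ a b
    rwa [connOn, edgeOn_univ] at this
  have h4 := M.two_mul_numCycles_edge
  have h5 : M.eulerChar = (numCycles M.vert : ℤ) - numCycles M.edge + numCycles M.face := rfl
  rw [Spherical, defect, h3, vert_mul_edge]
  omega

/-- Any vertex can be reached from any other one. -/
theorem exists_isPath (h : ∀ x y, M.connOn Set.univ x y) (x y : M.Vertex) :
    ∃ l, M.IsPath x l y := by
  let s : Setoid D :=
    { r := fun a b => ∃ l, M.IsPath (M.vertexOf a) l (M.vertexOf b)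
      iseqv := ⟨fun a => ⟨[], rfl⟩, fun ⟨l, hl⟩ => ⟨_, hl.reverse⟩,
        fun ⟨l, hl⟩ ⟨l', hl'⟩ => ⟨_, hl.append hl'⟩⟩ }
  have h1 : M.connOn Set.univ ≤ s := by
    refine connOn_le (fun x => ⟨[], ?_⟩) fun x _ => ⟨[x], isPath_singleton x⟩
    exact vertexOf_eq_iff.2 (cyc_apply _ _)
  induction x, y using Quotient.inductionOn₂ with | _ a b
  exact h1 (h a b)

/-- The product of an exact edge function along the boundary of a face. -/
theorem prod_iterate {G : Type} [Group G] {h f : D → G} (hf : ∀ x, f (M.vert x) = f x) (n : ℕ)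
    (x : D) (hx : ∀ i < n, h (M.face^[i] x) * f (M.edge (M.face^[i] x)) = f (M.face^[i] x)) :
    ((List.iterate M.face x n).map h).prod = f x * (f (M.face^[n] x))⁻¹ := by
  induction n generalizing x with
  | zero => simp
  | succ n ih =>
    have h0 := hx 0 (Nat.succ_pos n)
    rw [Function.iterate_zero, id] at h0
    rw [List.iterate, List.map_cons, List.prod_cons, ih (M.face x) (fun i hi => hx (i + 1) (by omega)),
      Function.iterate_succ_apply, ← h0, ← hf (M.edge x), vert_edge]
    group

end CombMap

namespace CombPants

variable (P : CombPants)

instance : Finite P.Dart := P.finite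

theorem isSpherical : P.map.Spherical := P.connected.spherical P.spherical

variable {P}

theorem isBdry_of_sameCycle {x y : P.Dart} (h : P.map.face.SameCycle x y) (hx : P.IsBdry x) :
    P.IsBdry y := by
  obtain ⟨k, hk⟩ := hx
  exact ⟨k, by rw [← hk]; exact (CombMap.faceOf_eq_iff.2 h).symm⟩

theorem isBdry_face {x : P.Dart} : P.IsBdry (P.map.face x) ↔ P.IsBdry x :=
  ⟨isBdry_of_sameCycle (Perm.sameCycle_apply_left.2 (Perm.SameCycle.refl _ _)),
    isBdry_of_sameCycle (cyc_apply _ _)⟩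

theorem isBdry_vert {x : P.Dart} : P.IsBdry (P.map.vert x) ↔ P.IsBdry (P.map.edge x) := by
  rw [CombMap.vert_apply, isBdry_face]

theorem isBdry_iterate {x : P.Dart} (n : ℕ) : P.IsBdry (P.map.face^[n] x) ↔ P.IsBdry x := by
  induction n with
  | zero => rfl
  | succ n ih => rw [Function.iterate_succ_apply', isBdry_face, ih]

theorem face_face_face {x : P.Dart} (h : ¬ P.IsBdry x) :
    P.map.face x ≠ x ∧ P.map.face (P.map.face (P.map.face x)) = x :=
  P.triangle x fun k hk => h ⟨k, hk⟩

/-- The component of `x₀` in the graph of the edges in `A` contains just one face that is not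
a triangle, so that it is simply connected. -/
def Filled (A : Set P.Dart) (x₀ : P.Dart) : Prop :=
  (∀ x, ¬ P.IsBdry x → P.map.Active A x) ∧
    ∀ x, P.IsBdry x → P.map.connOn A x₀ x → (P.map.faceOn A).SameCycle x₀ x

/-- The edge function is set to one outside the component of `x₀`. Then every face there is trivial,
and inside the component the triangles are; at most one face remains, as the potential theorem
requires. -/
theorem Filled.exists_potential {A : Set P.Dart} {x₀ : P.Dart} (hA : Filled A x₀) {G : Type}
    [Group G] {h : P.Dart → G} (h1 : ∀ d, h (P.map.edge d) = (h d)⁻¹)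
    (h2 : ∀ d, ¬ P.IsBdry d → h d * (h (P.map.face d) * h (P.map.face (P.map.face d))) = 1) :
    ∃ f : P.Dart → G, (∀ x, f (P.map.vert x) = f x) ∧
      ∀ x, P.map.Active A x → P.map.connOn A x₀ x → h x * f (P.map.edge x) = f x := by
  let h' : P.Dart → G := fun x => if P.map.Active A x ∧ P.map.connOn A x₀ x then h x else 1
  have hh' : ∀ d, h' (P.map.edge d) = (h' d)⁻¹ := by
    intro d
    by_cases hd : P.map.Active A d ∧ P.map.connOn A x₀ d
    · have hd' : P.map.Active A (P.map.edge d) ∧ P.map.connOn A x₀ (P.map.edge d) :=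
        ⟨hd.1.edge, Setoid.trans' _ hd.2 (CombMap.connOn_edge hd.1)⟩
      simp only [h', if_pos hd, if_pos hd', h1]
    · have hd' : ¬ (P.map.Active A (P.map.edge d) ∧ P.map.connOn A x₀ (P.map.edge d)) := by
        rintro ⟨h3, h4⟩
        have h5 := P.map.active_edge_iff.1 h3
        exact hd ⟨h5, Setoid.trans' _ h4 (Setoid.symm' _ (CombMap.connOn_edge h5))⟩
      simp only [h', if_neg hd, if_neg hd', inv_one]
  have htriv : ∀ x, ¬ P.IsBdry x → P.map.TrivOn h' A x := by
    intro x hx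
    by_cases hc : P.map.connOn A x₀ x
    · have hb1 : ¬ P.IsBdry (P.map.face x) := fun h => hx (isBdry_face.1 h)
      have hb2 : ¬ P.IsBdry (P.map.face (P.map.face x)) := fun h => hb1 (isBdry_face.1 h)
      have ha := hA.1 x hx
      have ha1 := hA.1 _ hb1
      have ha2 := hA.1 _ hb2
      have e0 := CombMap.faceOn_of_active ha
      have e1 := CombMap.faceOn_of_active ha1
      have e2 := CombMap.faceOn_of_active ha2
      obtain ⟨n1, n3⟩ := face_face_face hx
      rw [n3] at e2
      have n2 : P.map.face (P.map.face x) ≠ x := by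
        intro h; rw [h] at n3; exact n1 n3
      have n2' : P.map.face (P.map.face x) ≠ P.map.face x := fun h => n1 (P.map.face.injective h)
      have hc1 : P.map.connOn A x₀ (P.map.face x) := by
        rw [← e0]; exact Setoid.trans' _ hc (CombMap.connOn_faceOn x)
      have hc2 : P.map.connOn A x₀ (P.map.face (P.map.face x)) := by
        rw [← e1]; exact Setoid.trans' _ hc1 (CombMap.connOn_faceOn _)
      refine ⟨fun z => if z = x then 1 else if z = P.map.face x then (h x)⁻¹ else
        h (P.map.face (P.map.face x)), ?_⟩
      have hmem : ∀ y, (P.map.faceOn A).SameCycle x y →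
          y = x ∨ y = P.map.face x ∨ y = P.map.face (P.map.face x) := by
        intro y hy
        refine SameCycle.induction (p := fun y => y = x ∨ y = P.map.face x ∨
          y = P.map.face (P.map.face x)) ?_ (Or.inl rfl) hy
        rintro z (rfl | rfl | rfl)
        · exact Or.inr (Or.inl e0)
        · exact Or.inr (Or.inr e1)
        · exact Or.inl e2
      intro y hy
      have h2x := h2 x hx
      rcases hmem y hy with rfl | rfl | rfl
      · simp only [CombMap.wt, if_pos ha, h', if_pos (And.intro ha hc), e0, if_neg n1, if_true]
        simp
      · simp only [CombMap.wt, if_pos ha1, h', if_pos (And.intro ha1 hc1), e1, if_neg n1, if_neg n2,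
          if_neg n2', if_true]
        exact (inv_eq_of_mul_eq_one_right h2x).symm
      · simp only [CombMap.wt, if_pos ha2, h', if_pos (And.intro ha2 hc2), e2, if_neg n2,
          if_neg n2', if_true]
        simp
    · refine ⟨fun _ => 1, fun y hy => ?_⟩
      have hcy : ¬ P.map.connOn A x₀ y := fun h3 =>
        hc (Setoid.trans' _ h3 (Setoid.symm' _ (CombMap.connOn_of_sameCycle hy)))
      simp [CombMap.wt, h', hcy]
  obtain ⟨f, hf1, hf2⟩ := P.isSpherical.exists_potential hh' A (by
    intro x y hxy
    by_cases hx : P.IsBdry x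
    · by_cases hy : P.IsBdry y
      · by_cases hc : P.map.connOn A x₀ x
        · exact Or.inl ((hA.2 x hx hc).symm.trans (hA.2 y hy (Setoid.trans' _ hc hxy)))
        · refine Or.inr (Or.inl ⟨fun _ => 1, fun y hy => ?_⟩)
          have hcy : ¬ P.map.connOn A x₀ y := fun h3 =>
            hc (Setoid.trans' _ h3 (Setoid.symm' _ (CombMap.connOn_of_sameCycle hy)))
          simp [CombMap.wt, h', hcy]
      · exact Or.inr (Or.inr (htriv y hy))
    · exact Or.inr (Or.inl (htriv x hx)))
  refine ⟨f, hf1, fun x hx hc => ?_⟩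
  have := hf2 x hx
  simpa only [h', if_pos (And.intro hx hc)] using this

/-- In a simply connected part of the complex, boundary curves are geodesics: every closed piece
is trivial, and two pieces with the same end points have the same length. -/
theorem Geodesic.of_filled (hP : P.Geodesic) {A : Set P.Dart} {x₀ : P.Dart} (hA : Filled A x₀) :
    (∀ (x : P.Dart) (n : ℕ), P.IsBdry x → n ≤ Function.minimalPeriod P.map.face x →
      (∀ i < n, P.map.Active A (P.map.face^[i] x) ∧ P.map.connOn A x₀ (P.map.face^[i] x)) →
      P.map.vertexOf x = P.map.vertexOf (P.map.face^[n] x) → n = 0) ∧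
    ∀ (x y : P.Dart) (n m : ℕ), P.IsBdry x → n ≤ Function.minimalPeriod P.map.face x →
      (∀ i < n, P.map.Active A (P.map.face^[i] x) ∧ P.map.connOn A x₀ (P.map.face^[i] x)) →
      (∀ i < m, P.map.Active A (P.map.face^[i] y) ∧ P.map.connOn A x₀ (P.map.face^[i] y)) →
      P.map.vertexOf x = P.map.vertexOf (P.map.face^[m] y) →
      P.map.vertexOf y = P.map.vertexOf (P.map.face^[n] x) → n ≤ m := by
  obtain ⟨G, _, h, h1, h2, h3⟩ := CombMap.exists_detecting (F := fun d => ¬ P.IsBdry d)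
    (P.map.vertexOf x₀) (CombMap.exists_isPath P.connected.connOn_univ _)
    (fun d hd => (face_face_face hd).2)
  obtain ⟨f, hf1, hf2⟩ := hA.exists_potential h1 h2
  have hfv : ∀ {x y}, P.map.vertexOf x = P.map.vertexOf y → f x = f y := by
    intro x y hxy
    exact SameCycle.induction (p := fun z => f x = f z) (fun z hz => by rw [hf1, hz]) rfl
      (CombMap.vertexOf_eq_iff.1 hxy)
  -- By the potential, the product of `h` along a piece depends only on its end vertices. Since `h`
  -- detects homotopy, pieces with the same ends are homotopic and can be compared in length.
  have hprod : ∀ (x : P.Dart) (n : ℕ),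
      (∀ i < n, P.map.Active A (P.map.face^[i] x) ∧ P.map.connOn A x₀ (P.map.face^[i] x)) →
      ((List.iterate P.map.face x n).map h).prod = f x * (f (P.map.face^[n] x))⁻¹ :=
    fun x n hx => CombMap.prod_iterate hf1 n x fun i hi => hf2 _ (hx i hi).1 (hx i hi).2
  constructor
  · intro x n hx hn hi hv
    have h4 := h3 _ _ (List.iterate P.map.face x n) [] (CombMap.isPath_iterate x n) hv (by
      rw [hprod x n hi, hfv hv]; simp)
    have := hP x n [] hx hn h4
    simpa using this
  · intro x y n m hx hn hi hj hv hv'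
    have hp := (CombMap.isPath_iterate (M := P.map) y m).reverse
    rw [← hv, hv'] at hp
    have hrev : ∀ l : List P.Dart, ((P.map.reversePath l).map h).prod = ((l.map h).prod)⁻¹ := by
      intro l
      induction l with
      | nil => simp [CombMap.reversePath]
      | cons d l ih =>
        rw [CombMap.reversePath] at ih ⊢
        simp only [List.map_cons, List.reverse_cons, List.map_append, List.prod_append, ih,
          List.map_nil, List.prod_cons, List.prod_nil, h1, mul_one, mul_inv_rev]
    have h4 := h3 _ _ (List.iterate P.map.face x n) _ (CombMap.isPath_iterate x n) hp (by
      rw [hrev, hprod x n hi, hprod y m hj, hfv hv, hfv hv']; group)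
    have := hP x n _ hx hn h4
    rwa [CombMap.length_reversePath, List.length_iterate] at this

end CombPants

end PantsBasics

/-! ### Bigons between parallel strands -/

section Bigons

open scoped Classical

namespace CombPants

variable {P : CombPants}

/-- A bigon: a simply connected part of the complex between two strands (which start at `d₁` and
end at `d₂`), with sides `p` and `q` of length `m`, which lie in the boundary curves. Vertices that
belong to both sides have the same distance from the ends. -/
structure Bigon (P : CombPants) (A : Set P.Dart) (m : ℕ) (p q : ℕ → P.Dart) : Prop where
  filled : Filled A (q 0)
  face_p : ∀ i < m, P.map.face (p i) = p (i + 1)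
  face_q : ∀ i < m, P.map.face (q (i + 1)) = q i
  active_p : ∀ i < m, P.map.Active A (p i)
  active_q : ∀ i < m, P.map.Active A (q (i + 1))
  vert_p : P.map.vert (q 0) = p 0
  vert_q : P.map.vert (p m) = q m
  bdry_p : ∀ i ≤ m, P.IsBdry (p i)
  bdry_q : ∀ i ≤ m, P.IsBdry (q i)
  conn_p : ∀ i ≤ m, P.map.connOn A (q 0) (p i)
  conn_q : ∀ i ≤ m, P.map.connOn A (q 0) (q i)
  ne : ∀ i ≤ m, ∀ j ≤ m, p i ≠ q j
  level_p : ∀ i ≤ m, ∀ j ≤ m, P.map.vertexOf (p i) = P.map.vertexOf (p j) → i = j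
  level_q : ∀ i ≤ m, ∀ j ≤ m, P.map.vertexOf (q i) = P.map.vertexOf (q j) → i = j
  level : ∀ i ≤ m, ∀ j ≤ m, P.map.vertexOf (p i) = P.map.vertexOf (q j) → i = j
  mem : ∀ x, P.IsBdry x → P.map.connOn A (q 0) x → ∃ i ≤ m, x = p i ∨ x = q i
  point_p : P.IsPointComponent (p m)
  point_q : P.IsPointComponent (q 0)
  inactive_p : ¬ P.map.Active A (p m)

/-- When the edges of `d₁` and `d₂` are cut, the part between them has a single boundary walk: it
follows a boundary curve from `edge d₁` to `d₂` and another piece back. The part is simply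
connected, so these pieces are geodesics with common ends. The second side `q` is numbered
backwards, so that both sides run in the same direction. -/
theorem Geodesic.exists_bigon (hP : P.Geodesic) {d₁ d₂ : P.Dart}
    (s₁ : P.IsPointComponent d₁) (s₂ : P.IsPointComponent d₂) (hne : d₂ ≠ P.map.edge d₁)
    (hconn : P.map.connOn {d₁, d₂}ᶜ (P.map.edge d₁) d₂)
    (hb : ∀ x, P.IsBdry x → P.map.connOn {d₁, d₂}ᶜ (P.map.edge d₁) x →
      (P.map.faceOn {d₁, d₂}ᶜ).SameCycle (P.map.edge d₁) x)
    (h1 : ¬ P.map.connOn {d₁, d₂}ᶜ (P.map.edge d₁) d₁)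
    (h2 : ¬ P.map.connOn {d₁, d₂}ᶜ (P.map.edge d₁) (P.map.edge d₂)) :
    ∃ m, Bigon P {d₁, d₂}ᶜ m (fun i => P.map.face^[i] (P.map.face d₁))
      (fun i => P.map.face^[m - i] (P.map.face (P.map.edge d₂))) ∧
      P.map.face^[m] (P.map.face d₁) = d₂ ∧
      P.map.face^[m] (P.map.face (P.map.edge d₂)) = P.map.edge d₁ := by
  set A : Set P.Dart := {d₁, d₂}ᶜ with hA
  set π := P.map.faceOn A with hπ
  set e := P.map.edge with he
  have hact : ∀ x, P.map.Active A x ↔ x ≠ d₁ ∧ x ≠ d₂ ∧ x ≠ e d₁ ∧ x ≠ e d₂ := by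
    intro x
    have e1 : ∀ y, e x = y ↔ x = e y := fun y =>
      ⟨fun h => by rw [← h, he, P.map.edge_edge], fun h => by rw [h, he, P.map.edge_edge]⟩
    simp only [CombMap.Active, hA, Set.mem_compl_iff, Set.mem_insert_iff, Set.mem_singleton_iff,
      ← he, e1]
    tauto
  have hfill : Filled A (e d₁) := by
    refine ⟨fun x hx => (hact x).2 ⟨?_, ?_, ?_, ?_⟩, hb⟩ <;> rintro rfl
    · exact hx s₁.1
    · exact hx s₂.1
    · exact hx s₁.2
    · exact hx s₂.2
  have hconnπ : ∀ x, P.map.connOn A x (π x) := fun x => CombMap.connOn_faceOn x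
  have hin : ∀ n : ℕ, P.map.connOn A (e d₁) (π^[n] (e d₁)) := by
    intro n
    induction n with
    | zero => exact Setoid.refl' _ _
    | succ n ih =>
      rw [Function.iterate_succ_apply']; exact Setoid.trans' _ ih (hconnπ _)
  have hin' : ∀ n : ℕ, P.map.connOn A (e d₁) (π^[n] d₂) := by
    intro n
    induction n with
    | zero => exact hconn
    | succ n ih =>
      rw [Function.iterate_succ_apply']; exact Setoid.trans' _ ih (hconnπ _)
  have hn1 : ∀ x, P.map.connOn A (e d₁) x → x ≠ d₁ ∧ x ≠ e d₂ := by
    intro x hx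
    constructor <;> rintro rfl
    · exact h1 hx
    · exact h2 hx
  have hs : π.SameCycle (e d₁) d₂ := hb d₂ s₂.1 hconn
  -- At the cut edge the walk turns from `edge d₁` to `face d₁`; this first step is not part of the
  -- side, whence `m₁ + 1` steps in all.
  obtain ⟨m₁, ha, ha'⟩ := exists_first_visit (Ne.symm hne) hs
  obtain ⟨m₂, hq, hq'⟩ := exists_first_visit hne hs.symm
  have hne1 : ¬ P.map.Active A (e d₁) := fun h => ((hact _).1 h).2.2.1 rfl
  have hne2 : ¬ P.map.Active A d₂ := fun h => ((hact _).1 h).2.1 rfl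
  have π1 : π (e d₁) = P.map.face d₁ := by
    rw [hπ, CombMap.faceOn_of_not_active hne1, he, CombMap.vert_edge]
  have π2 : π d₂ = P.map.face (e d₂) := by
    rw [hπ, CombMap.faceOn_of_not_active hne2, CombMap.vert_apply]
  have actP : ∀ i < m₁, P.map.Active A (π^[i + 1] (e d₁)) := fun i hi =>
    (hact _).2 ⟨(hn1 _ (hin _)).1, (ha' i hi).1, (ha' i hi).2, (hn1 _ (hin _)).2⟩
  have actQ : ∀ i < m₂, P.map.Active A (π^[i + 1] d₂) := fun i hi =>
    (hact _).2 ⟨(hn1 _ (hin' _)).1, (hq' i hi).2, (hq' i hi).1, (hn1 _ (hin' _)).2⟩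
  have eP : ∀ i ≤ m₁, π^[i + 1] (e d₁) = P.map.face^[i] (P.map.face d₁) := by
    intro i hi
    induction i with
    | zero => exact π1
    | succ i ih =>
      rw [Function.iterate_succ_apply', Function.iterate_succ_apply' P.map.face, ← ih (by omega), hπ,
        CombMap.faceOn_of_active (actP i hi)]
  have eQ : ∀ i ≤ m₂, π^[i + 1] d₂ = P.map.face^[i] (P.map.face (e d₂)) := by
    intro i hi
    induction i with
    | zero => exact π2
    | succ i ih =>
      rw [Function.iterate_succ_apply', Function.iterate_succ_apply' P.map.face, ← ih (by omega), hπ,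
        CombMap.faceOn_of_active (actQ i hi)]
  set p : ℕ → P.Dart := fun i => P.map.face^[i] (P.map.face d₁) with hp
  set r : ℕ → P.Dart := fun i => P.map.face^[i] (P.map.face (e d₂)) with hr
  have pm : p m₁ = d₂ := by rw [← ha, eP m₁ le_rfl]
  have rm : r m₂ = e d₁ := by rw [← hq, eQ m₂ le_rfl]
  have actp : ∀ i < m₁, P.map.Active A (p i) := fun i hi => by
    have := actP i hi
    rwa [eP i hi.le] at this
  have actr : ∀ i < m₂, P.map.Active A (r i) := fun i hi => by
    have := actQ i hi
    rwa [eQ i hi.le] at this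
  have cp : ∀ i ≤ m₁, P.map.connOn A (e d₁) (p i) := fun i hi => by
    have := hin (i + 1)
    rwa [eP i hi] at this
  have cr : ∀ i ≤ m₂, P.map.connOn A (e d₁) (r i) := fun i hi => by
    have := hin' (i + 1)
    rwa [eQ i hi] at this
  have bp : ∀ i, P.IsBdry (p i) := fun i => (isBdry_iterate i).2 (isBdry_face.2 s₁.1)
  have br : ∀ i, P.IsBdry (r i) := fun i => (isBdry_iterate i).2 (isBdry_face.2 s₂.2)
  have padd : ∀ i j, P.map.face^[j] (p i) = p (i + j) := fun i j => by
    simp only [hp]; rw [Nat.add_comm, Function.iterate_add_apply]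
  have radd : ∀ i j, P.map.face^[j] (r i) = r (i + j) := fun i j => by
    simp only [hr]; rw [Nat.add_comm, Function.iterate_add_apply]
  -- A side that ran around its whole boundary curve would meet `d₂` before step `m₁`, but up to
  -- there all darts are active.
  have perp : ∀ i, m₁ < Function.minimalPeriod P.map.face (p i) := by
    have h0 : ∀ i, Function.minimalPeriod P.map.face (p i) =
        Function.minimalPeriod P.map.face (p 0) := by
      intro i
      rw [show p i = P.map.face^[i] (p 0) by rw [padd, Nat.zero_add]]
      refine Function.minimalPeriod_apply_iterate ?_ i
      exact ⟨orderOf P.map.face, orderOf_pos _, by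
        rw [Function.IsPeriodicPt, Function.IsFixedPt, Perm.iterate_eq_pow, pow_orderOf_eq_one]
        rfl⟩
    intro i
    rw [h0]
    by_contra hcon
    have hpos : 0 < Function.minimalPeriod P.map.face (p 0) :=
      Function.minimalPeriod_pos_of_mem_periodicPts ⟨orderOf P.map.face, orderOf_pos _, by
        rw [Function.IsPeriodicPt, Function.IsFixedPt, Perm.iterate_eq_pow, pow_orderOf_eq_one]
        rfl⟩
    have h4 : p (m₁ - Function.minimalPeriod P.map.face (p 0)) = d₂ := by
      rw [← pm, show p m₁ = P.map.face^[m₁ - Function.minimalPeriod P.map.face (p 0)]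
        (P.map.face^[Function.minimalPeriod P.map.face (p 0)] (p 0)) by
          rw [← Function.iterate_add_apply, padd]; congr 1; omega,
        Function.iterate_minimalPeriod, padd, Nat.zero_add]
    exact hne2 (h4 ▸ actp _ (by omega))
  have perr : ∀ i, m₂ < Function.minimalPeriod P.map.face (r i) := by
    have h0 : ∀ i, Function.minimalPeriod P.map.face (r i) =
        Function.minimalPeriod P.map.face (r 0) := by
      intro i
      rw [show r i = P.map.face^[i] (r 0) by rw [radd, Nat.zero_add]]
      refine Function.minimalPeriod_apply_iterate ?_ i
      exact ⟨orderOf P.map.face, orderOf_pos _, by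
        rw [Function.IsPeriodicPt, Function.IsFixedPt, Perm.iterate_eq_pow, pow_orderOf_eq_one]
        rfl⟩
    intro i
    rw [h0]
    by_contra hcon
    have hpos : 0 < Function.minimalPeriod P.map.face (r 0) :=
      Function.minimalPeriod_pos_of_mem_periodicPts ⟨orderOf P.map.face, orderOf_pos _, by
        rw [Function.IsPeriodicPt, Function.IsFixedPt, Perm.iterate_eq_pow, pow_orderOf_eq_one]
        rfl⟩
    have h4 : r (m₂ - Function.minimalPeriod P.map.face (r 0)) = e d₁ := by
      rw [← rm, show r m₂ = P.map.face^[m₂ - Function.minimalPeriod P.map.face (r 0)]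
        (P.map.face^[Function.minimalPeriod P.map.face (r 0)] (r 0)) by
          rw [← Function.iterate_add_apply, radd]; congr 1; omega,
        Function.iterate_minimalPeriod, radd, Nat.zero_add]
    exact hne1 (h4 ▸ actr _ (by omega))
  obtain ⟨g1, g2⟩ := hP.of_filled hfill
  have v0 : P.map.vertexOf (e d₁) = P.map.vertexOf (p 0) := CombMap.vertexOf_edge d₁
  have vm : P.map.vertexOf d₂ = P.map.vertexOf (r 0) := by
    have := CombMap.vertexOf_edge (M := P.map) (e d₂)
    rwa [he, P.map.edge_edge] at this
  have lp' : ∀ i j, i ≤ j → j ≤ m₁ → P.map.vertexOf (p i) = P.map.vertexOf (p j) → i = j := by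
    intro i j hij hj hv
    have := g1 (p i) (j - i) (bp i) (by have := perp i; omega)
      (fun k hk => by rw [padd]; exact ⟨actp _ (by omega), cp _ (by omega)⟩)
      (by rw [padd, Nat.add_sub_cancel' hij]; exact hv)
    omega
  have lr' : ∀ i j, i ≤ j → j ≤ m₂ → P.map.vertexOf (r i) = P.map.vertexOf (r j) → i = j := by
    intro i j hij hj hv
    have := g1 (r i) (j - i) (br i) (by have := perr i; omega)
      (fun k hk => by rw [radd]; exact ⟨actr _ (by omega), cr _ (by omega)⟩)
      (by rw [radd, Nat.add_sub_cancel' hij]; exact hv)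
    omega
  -- A common vertex and the vertex of `edge d₁` bound a piece of either side. Both pieces are
  -- geodesic with the same ends, so `i = m₂ - j`. At the vertex of `d₂` this gives `m₁ = m₂`.
  have lpr : ∀ i j, i ≤ m₁ → j ≤ m₂ → P.map.vertexOf (p i) = P.map.vertexOf (r j) →
      i + j = m₂ := by
    intro i j hi hj hv
    have e1 := g2 (p 0) (r j) i (m₂ - j) (bp 0) (by have := perp 0; omega)
      (fun k hk => by rw [padd]; exact ⟨actp _ (by omega), cp _ (by omega)⟩)
      (fun k hk => by rw [radd]; exact ⟨actr _ (by omega), cr _ (by omega)⟩)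
      (by rw [radd, Nat.add_sub_cancel' hj, rm, v0])
      (by rw [padd, Nat.zero_add]; exact hv.symm)
    have e2 := g2 (r j) (p 0) (m₂ - j) i (br j) (by have := perr j; omega)
      (fun k hk => by rw [radd]; exact ⟨actr _ (by omega), cr _ (by omega)⟩)
      (fun k hk => by rw [padd]; exact ⟨actp _ (by omega), cp _ (by omega)⟩)
      (by rw [padd, Nat.zero_add]; exact hv.symm)
      (by rw [radd, Nat.add_sub_cancel' hj, rm, v0])
    omega
  have hm : m₁ = m₂ := by
    have := lpr m₁ 0 le_rfl (Nat.zero_le _) (by rw [pm]; exact vm)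
    omega
  subst hm
  have q0 : P.map.face^[m₁ - 0] (P.map.face (P.map.edge d₂)) = e d₁ := rm
  refine ⟨m₁, ⟨?_, ?_, ?_, actp, ?_, ?_, ?_, fun i _ => bp i, fun i _ => br _, ?_, ?_, ?_, ?_, ?_,
    ?_, ?_, ?_, ?_, ?_⟩, pm, rm⟩
  · rw [q0]; exact hfill
  · intro i _; exact (padd i 1)
  · intro i hi
    have h4 : m₁ - i = m₁ - (i + 1) + 1 := by omega
    rw [h4, Function.iterate_succ_apply']
  · intro i hi; exact actr _ (by omega)
  · rw [q0, he, CombMap.vert_edge]; rfl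
  · rw [pm, Nat.sub_self, CombMap.vert_apply]; rfl
  · intro i hi; rw [q0]; exact cp i hi
  · intro i hi; rw [q0]; exact cr _ (by omega)
  · intro i hi j hj hij
    have key : ∀ n i j, i + n = m₁ → j ≤ m₁ → p i ≠ r j := by
      intro n
      induction n with
      | zero =>
        intro i j hi hj h4
        rw [show i = m₁ by omega, pm] at h4
        rcases hj.lt_or_eq with h5 | h5
        · exact hne2 (h4 ▸ actr j h5)
        · rw [h5, rm] at h4; exact hne h4
      | succ n ih =>
        intro i j hi hj h4
        rcases hj.lt_or_eq with h5 | h5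
        · refine ih (i + 1) (j + 1) (by omega) h5 ?_
          rw [← padd i 1, ← radd j 1, h4]
        · rw [h5, rm] at h4
          exact hne1 (h4 ▸ actp i (by omega))
    exact key (m₁ - i) i (m₁ - j) (by omega) (by omega) hij
  · intro i hi j hj hv
    rcases le_total i j with h4 | h4
    · exact lp' i j h4 hj hv
    · exact (lp' j i h4 hi hv.symm).symm
  · intro i hi j hj hv
    rcases le_total i j with h4 | h4
    · have := lr' (m₁ - j) (m₁ - i) (by omega) (by omega) hv.symm; omega
    · have := lr' (m₁ - i) (m₁ - j) (by omega) (by omega) hv; omega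
  · intro i hi j hj hv
    have := lpr i (m₁ - j) hi (by omega) hv
    omega
  · intro x hx hc
    rw [q0] at hc
    have h4 := hb x hx hc
    have h5 : (∃ i ≤ m₁, x = p i) ∨ ∃ i ≤ m₁, x = r i := by
      refine SameCycle.induction (p := fun x => (∃ i ≤ m₁, x = p i) ∨ ∃ i ≤ m₁, x = r i) ?_
        (Or.inr ⟨m₁, le_rfl, rm.symm⟩) h4
      rintro z (⟨i, hi, rfl⟩ | ⟨i, hi, rfl⟩)
      · rcases hi.lt_or_eq with h5 | rfl
        · exact Or.inl ⟨i + 1, h5, by rw [hπ, CombMap.faceOn_of_active (actp i h5)]; exact padd i 1⟩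
        · exact Or.inr ⟨0, Nat.zero_le _, by rw [pm, π2]; rfl⟩
      · rcases hi.lt_or_eq with h5 | rfl
        · exact Or.inr ⟨i + 1, h5, by rw [hπ, CombMap.faceOn_of_active (actr i h5)]; exact radd i 1⟩
        · exact Or.inl ⟨0, Nat.zero_le _, by rw [rm, π1]; rfl⟩
    rcases h5 with ⟨i, hi, h6⟩ | ⟨i, hi, h6⟩
    · exact ⟨i, hi, Or.inl h6⟩
    · exact ⟨m₁ - i, by omega, Or.inr (by rw [h6, Nat.sub_sub_self hi])⟩
  · exact pm ▸ s₂
  · rw [q0]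
    exact ⟨s₁.2, by rw [he, P.map.edge_edge]; exact s₁.1⟩
  · exact pm ▸ hne2

end CombPants

end Bigons

/-! ### Counting the classes contained in a set -/

section Inner

open scoped Classical

variable {D : Type}

/-- The number of classes of `s` that are contained in `U`. -/
noncomputable def innerCard (s : Setoid D) (U : Set D) : ℕ :=
  {q : Quotient s | ∀ d, Quotient.mk s d = q → d ∈ U}.ncard

def Saturated (s : Setoid D) (U : Set D) : Prop := ∀ x y, s x y → x ∈ U → y ∈ U

theorem saturated_cyc [Finite D] {π : Perm D} {U : Set D} (h : ∀ x ∈ U, π x ∈ U) :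
    Saturated (cyc π) U := fun _ _ hxy hx => SameCycle.induction h hx hxy

theorem innerCard_univ (s : Setoid D) : innerCard s Set.univ = Nat.card (Quotient s) := by
  rw [innerCard, ← Set.ncard_univ]
  congr 1
  ext q; simp

theorem innerCard_union [Finite D] {s : Setoid D} {U W : Set D} (hU : Saturated s U)
    (hd : Disjoint U W) : innerCard s (U ∪ W) = innerCard s U + innerCard s W := by
  rw [innerCard, innerCard, innerCard, ← Set.ncard_union_eq _ (Set.toFinite _) (Set.toFinite _)]
  · congr 1
    ext q
    induction q using Quotient.inductionOn with | _ a
    simp only [Set.mem_ofPred_eq, Set.mem_union]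
    constructor
    · intro h
      rcases h a rfl with h1 | h1
      · left
        intro d hd
        exact hU a d (s.symm (Quotient.exact hd)) h1
      · right
        intro d hd'
        rcases h d hd' with h2 | h2
        · exact absurd (hU d a (Quotient.exact hd') h2) (Set.disjoint_right.1 hd h1)
        · exact h2
    · rintro (h | h) d hd
      · exact Or.inl (h d hd)
      · exact Or.inr (h d hd)
  · rw [Set.disjoint_left]
    intro q h1 h2
    induction q using Quotient.inductionOn with | _ a
    exact Set.disjoint_left.1 hd (h1 a rfl) (h2 a rfl)

/-- The number of classes contained in `U`, if `T` is a transversal. -/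
theorem innerCard_eq_ncard [Finite D] {s : Setoid D} {U T : Set D} (hU : Saturated s U) (hT : T ⊆ U)
    (h1 : ∀ x ∈ T, ∀ y ∈ T, s x y → x = y) (h2 : ∀ x ∈ U, ∃ t ∈ T, s x t) :
    innerCard s U = T.ncard := by
  rw [innerCard, eq_comm]
  refine Set.ncard_congr (fun a _ => Quotient.mk s a) ?_ ?_ ?_
  · intro a ha d hd
    exact hU a d (s.symm (Quotient.exact hd)) (hT ha)
  · intro a b ha hb hab
    exact h1 a ha b hb (Quotient.exact hab)
  · intro q hq
    induction q using Quotient.inductionOn with | _ a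
    obtain ⟨t, ht, hat⟩ := h2 a (hq a rfl)
    exact ⟨t, ht, (Quotient.sound hat).symm⟩

theorem exists_transversal (s : Setoid D) (U : Set D) :
    ∃ T ⊆ U, (∀ x ∈ T, ∀ y ∈ T, s x y → x = y) ∧
      (Saturated s U → ∀ x ∈ U, ∃ t ∈ T, s x t) := by
  refine ⟨{x ∈ U | (Quotient.mk s x).out = x}, fun x hx => hx.1, ?_, ?_⟩
  · rintro x ⟨_, hx⟩ y ⟨_, hy⟩ hxy
    rw [← hx, ← hy, Quotient.sound hxy]
  · intro hU x hx
    have h1 : s x (Quotient.mk s x).out := s.symm (Quotient.mk_out x)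
    exact ⟨(Quotient.mk s x).out, ⟨hU _ _ h1 hx, by rw [Quotient.out_eq]⟩, h1⟩

theorem innerCard_congr [Finite D] {s s' : Setoid D} {U : Set D} (hU : Saturated s U)
    (h : ∀ x ∈ U, ∀ y, s x y ↔ s' x y) : innerCard s U = innerCard s' U := by
  obtain ⟨T, hT, h1, h2⟩ := exists_transversal s U
  rw [innerCard_eq_ncard hU hT h1 (h2 hU)]
  refine (innerCard_eq_ncard (fun x y hxy hx => hU x y ((h x hx y).2 hxy) hx) hT ?_ ?_).symm
  · intro x hx y hy hxy
    exact h1 x hx y hy ((h x (hT hx) y).2 hxy)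
  · intro x hx
    obtain ⟨t, ht, h3⟩ := h2 hU x hx
    exact ⟨t, ht, (h x hx t).1 h3⟩

theorem innerCard_eq_one [Finite D] {s : Setoid D} {U : Set D} {x : D} (hU : Saturated s U)
    (hx : x ∈ U) (h : ∀ y ∈ U, s y x) : innerCard s U = 1 := by
  rw [← Set.ncard_singleton x]
  refine innerCard_eq_ncard hU (by simpa using hx) ?_ fun y hy => ⟨x, rfl, h y hy⟩
  rintro a rfl b rfl _; rfl

/-- Classes that stick out of `W` do not count, so their darts may be discarded. -/
theorem innerCard_mono_core {s : Setoid D} {U W : Set D} (hUW : U ⊆ W)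
    (h : ∀ x, (∀ d, s d x → d ∈ W) → x ∈ U) : innerCard s U = innerCard s W := by
  rw [innerCard, innerCard]
  congr 1
  ext q
  constructor
  · intro hq d hd; exact hUW (hq d hd)
  · intro hq d hd
    refine h d fun d' hd' => hq d' ?_
    rw [← hd]; exact Quotient.sound hd'

theorem two_mul_innerCard_involution [Finite D] {π : Perm D} {U : Set D}
    (hU : ∀ x ∈ U, π x ∈ U) (hπ : ∀ x ∈ U, π (π x) = x) (hne : ∀ x ∈ U, π x ≠ x) :
    2 * innerCard (cyc π) U = U.ncard := by
  obtain ⟨T, hT, h1, h2⟩ := exists_transversal (cyc π) U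
  have hs : Saturated (cyc π) U := saturated_cyc hU
  rw [innerCard_eq_ncard hs hT h1 (h2 hs)]
  have h3 : U = T ∪ π '' T := by
    ext x
    constructor
    · intro hx
      obtain ⟨t, ht, hxt⟩ := h2 hs x hx
      have h4 : x = t ∨ x = π t :=
        SameCycle.induction (p := fun x => x = t ∨ x = π t) (by
          rintro z (rfl | rfl)
          · exact Or.inr rfl
          · exact Or.inl (hπ t (hT ht))) (Or.inl rfl) (Setoid.symm' _ hxt)
      rcases h4 with rfl | h4
      · exact Or.inl ht
      · exact Or.inr ⟨t, ht, h4.symm⟩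
    · rintro (hx | ⟨t, ht, rfl⟩)
      · exact hT hx
      · exact hU _ (hT ht)
  have h4 : Disjoint T (π '' T) := by
    rw [Set.disjoint_left]
    rintro x hx ⟨t, ht, rfl⟩
    exact hne t (hT ht) (h1 t ht _ hx (cyc_apply _ _)).symm
  conv_rhs => rw [h3]
  rw [Set.ncard_union_eq h4 (Set.toFinite _) (Set.toFinite _),
    Set.ncard_image_of_injective _ π.injective, two_mul]

/-- The classes that meet a subset. -/
theorem card_quotient_subtype [Finite D] {s : Setoid D} {K U : Set D} {s' : Setoid K}
    (h : ∀ x y : K, s' x y ↔ s x y) (hU : Saturated s U) (hK : K ⊆ U)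
    (hm : ∀ x ∈ U, ∃ k ∈ K, s x k) : Nat.card (Quotient s') = innerCard s U := by
  rw [← innerCard_univ, innerCard, innerCard]
  refine Set.ncard_congr
    (fun q _ => Quotient.map' (fun x : K => (x : D)) (fun x y hxy => (h x y).1 hxy) q) ?_ ?_ ?_
  · intro q _ d hd
    induction q using Quotient.inductionOn with | _ a
    exact hU a d (s.symm (Quotient.exact hd)) (hK a.2)
  · intro a b _ _ hab
    induction a, b using Quotient.inductionOn₂ with | _ a b
    exact Quotient.sound ((h a b).2 (Quotient.exact hab))
  · intro q hq
    induction q using Quotient.inductionOn with | _ a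
    obtain ⟨k, hk, hak⟩ := hm a (hq a rfl)
    exact ⟨Quotient.mk _ ⟨k, hk⟩, fun _ _ => trivial, (Quotient.sound hak).symm⟩

namespace CombMap

variable {M : CombMap D}

theorem cyc_edgeOn_iff [Finite D] {A : Set D} {x y : D} :
    cyc (M.edgeOn A) x y ↔ x = y ∨ (M.Active A x ∧ y = M.edge x) := by
  constructor
  · intro h
    refine SameCycle.induction (p := fun y => x = y ∨ (M.Active A x ∧ y = M.edge x)) ?_
      (Or.inl rfl) h
    rintro z (rfl | ⟨h1, rfl⟩)
    · by_cases hx : M.Active A x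
      · exact Or.inr ⟨hx, edgeOn_of_active hx⟩
      · exact Or.inl (edgeOn_of_not_active hx).symm
    · left
      rw [edgeOn_of_active h1.edge, M.edge_edge]
  · rintro (rfl | ⟨h1, rfl⟩)
    · exact Setoid.refl' _ _
    · have := cyc_apply (M.edgeOn A) x
      rwa [edgeOn_of_active h1] at this

theorem cyc_edge_iff [Finite D] {x y : D} : cyc M.edge x y ↔ x = y ∨ y = M.edge x := by
  have h := cyc_edgeOn_iff (M := M) (A := Set.univ) (x := x) (y := y)
  rw [M.edgeOn_univ] at h
  simpa [Active] using h

theorem two_mul_innerCard_edge [Finite D] {U : Set D} (hU : ∀ x ∈ U, M.edge x ∈ U) :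
    2 * innerCard (cyc M.edge) U = U.ncard :=
  two_mul_innerCard_involution hU (fun x _ => M.edge_edge x) fun x _ => M.edge_ne x

end CombMap

end Inner

/-! ### Clusters, their rims, and a criterion for disks -/

section Clusters

open scoped Classical

namespace CombPants

variable {P : CombPants} {c : P.Dart}

theorem mem_cluster_self (c : P.Dart) : c ∈ P.cluster c := Relation.EqvGen.refl _

theorem not_isBdry_of_mem_cluster (hc : ¬ P.IsBdry c) {x : P.Dart} (hx : x ∈ P.cluster c) :
    ¬ P.IsBdry x := by
  have key : ∀ a b, P.SameCluster a b → (P.IsBdry a ↔ P.IsBdry b) := by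
    intro a b h
    induction h with
    | rel a b h => exact ⟨fun h1 => absurd h1 h.1, fun h1 => absurd h1 h.2.1⟩
    | refl a => rfl
    | symm a b _ ih => exact ih.symm
    | trans a b c _ _ ih ih' => exact ih.trans ih'
  rwa [← key _ _ hx]

theorem face_mem_cluster (hc : ¬ P.IsBdry c) {x : P.Dart} (hx : x ∈ P.cluster c) :
    P.map.face x ∈ P.cluster c := by
  have h1 := not_isBdry_of_mem_cluster hc hx
  exact Relation.EqvGen.trans _ _ _ hx
    (Relation.EqvGen.rel _ _ ⟨h1, fun h => h1 (isBdry_face.1 h), Or.inl rfl⟩)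

theorem edge_mem_cluster (hc : ¬ P.IsBdry c) {x : P.Dart} (hx : x ∈ P.cluster c)
    (h : ¬ P.IsBdry (P.map.edge x)) : P.map.edge x ∈ P.cluster c :=
  Relation.EqvGen.trans _ _ _ hx
    (Relation.EqvGen.rel _ _ ⟨not_isBdry_of_mem_cluster hc hx, h, Or.inr rfl⟩)

theorem cluster_subset_class {s : Setoid P.Dart}
    (h1 : ∀ x, ¬ P.IsBdry x → s x (P.map.face x))
    (h2 : ∀ x, ¬ P.IsBdry x → s x (P.map.edge x)) {x : P.Dart} (hx : x ∈ P.cluster c) :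
    s c x := by
  have hx' : P.SameCluster c x := hx
  clear hx
  induction hx' with
  | rel a b h =>
    obtain ⟨ha, -, rfl | rfl⟩ := h
    · exact h1 a ha
    · exact h2 a ha
  | refl a => exact Setoid.refl' _ _
  | symm a b _ ih => exact Setoid.symm' _ ih
  | trans a b c _ _ ih ih' => exact Setoid.trans' _ ih ih'

variable (P) in
/-- The boundary darts that are adjacent to triangles of `C`. -/
def rim (C : Set P.Dart) : Set P.Dart := {x | P.IsBdry x ∧ P.map.edge x ∈ C}

variable (P) in
/-- The darts of the edges of the triangles in `C`. -/
def closure (C : Set P.Dart) : Set P.Dart := C ∪ P.rim C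

theorem edge_mem_closure (hc : ¬ P.IsBdry c) {x : P.Dart} (hx : x ∈ P.closure (P.cluster c)) :
    P.map.edge x ∈ P.closure (P.cluster c) := by
  rcases hx with hx | hx
  · by_cases h : P.IsBdry (P.map.edge x)
    · exact Or.inr ⟨h, by rw [P.map.edge_edge]; exact hx⟩
    · exact Or.inl (edge_mem_cluster hc hx h)
  · exact Or.inl hx.2

theorem active_closure_iff (hc : ¬ P.IsBdry c) {x : P.Dart} :
    P.map.Active (P.closure (P.cluster c)) x ↔ x ∈ P.closure (P.cluster c) :=
  ⟨fun h => h.1, fun h => ⟨h, edge_mem_closure hc h⟩⟩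

theorem faceOn_closure_of_mem (hc : ¬ P.IsBdry c) {x : P.Dart}
    (hx : x ∈ P.closure (P.cluster c)) :
    P.map.faceOn (P.closure (P.cluster c)) x = P.map.face x :=
  CombMap.faceOn_of_active ((active_closure_iff hc).2 hx)

theorem faceOn_closure_of_not_mem {x : P.Dart}
    (hx : x ∉ P.closure (P.cluster c)) :
    P.map.faceOn (P.closure (P.cluster c)) x = P.map.vert x :=
  CombMap.faceOn_of_not_active fun h => hx h.1

theorem saturated_cluster_faceOn (hc : ¬ P.IsBdry c) :
    Saturated (cyc (P.map.faceOn (P.closure (P.cluster c)))) (P.cluster c) := by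
  refine saturated_cyc fun x hx => ?_
  rw [faceOn_closure_of_mem hc (Or.inl hx)]
  exact face_mem_cluster hc hx

/-- From a dart at a vertex of `C`, outside `C`, the boundary walk leads to the rim. -/
theorem exists_rim_of_vert (hc : ¬ P.IsBdry c) {x z : P.Dart} (hx : x ∉ P.cluster c)
    (hz : z ∈ P.closure (P.cluster c)) (hxz : P.map.vert.SameCycle x z) :
    ∃ y ∈ P.rim (P.cluster c), P.map.vert.SameCycle x y ∧
      (P.map.faceOn (P.closure (P.cluster c))).SameCycle x y := by
  set Z := P.closure (P.cluster c) with hZ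
  have hex : ∃ n : ℕ, P.map.vert^[n] x ∈ Z := by
    obtain ⟨n, hn⟩ := hxz.exists_nat_pow_eq
    exact ⟨n, by rw [Perm.iterate_eq_pow, hn]; exact hz⟩
  have h1 : ∀ n ≤ Nat.find hex, (P.map.faceOn Z)^[n] x = P.map.vert^[n] x := by
    intro n hn
    induction n with
    | zero => rfl
    | succ n ih =>
      rw [Function.iterate_succ_apply', Function.iterate_succ_apply', ih (by omega),
        faceOn_closure_of_not_mem (Nat.find_min hex hn)]
  have h2 : (P.map.faceOn Z).SameCycle x (P.map.vert^[Nat.find hex] x) := by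
    rw [← h1 _ le_rfl, Perm.iterate_eq_pow]
    exact Perm.sameCycle_pow_right.2 (Perm.SameCycle.refl _ _)
  refine ⟨_, ?_, ?_, h2⟩
  · rcases Nat.find_spec hex with h3 | h3
    · exact absurd (saturated_cluster_faceOn hc _ _ h2.symm h3) hx
    · exact h3
  · rw [Perm.iterate_eq_pow]
    exact Perm.sameCycle_pow_right.2 (Perm.SameCycle.refl _ _)

theorem not_mem_cluster_of_isBdry (hc : ¬ P.IsBdry c) {x : P.Dart} (hx : P.IsBdry x) :
    x ∉ P.cluster c := fun h => not_isBdry_of_mem_cluster hc h hx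

/-- The rim of a cluster contains a dart that starts where a given one ends. -/
theorem exists_next_rim (hc : ¬ P.IsBdry c) {x : P.Dart} (hx : x ∈ P.rim (P.cluster c)) :
    ∃ y ∈ P.rim (P.cluster c), P.map.vertexOf (P.map.face x) = P.map.vertexOf y ∧
      (P.map.faceOn (P.closure (P.cluster c))).SameCycle x y := by
  have hv : P.map.vert.SameCycle (P.map.face x) (P.map.edge x) := by
    rw [← CombMap.vertexOf_eq_iff, CombMap.vertexOf_edge]
  obtain ⟨y, hy, h1, h2⟩ := exists_rim_of_vert hc
    (not_mem_cluster_of_isBdry hc (isBdry_face.2 hx.1)) (Or.inl hx.2) hv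
  refine ⟨y, hy, CombMap.vertexOf_eq_iff.2 h1, ?_⟩
  rw [← faceOn_closure_of_mem hc (Or.inr hx)] at h2
  exact Perm.sameCycle_apply_left.1 h2

/-- A cluster whose boundary is a single simple closed curve is a disk. -/
theorem diskType_of_rim (hc : ¬ P.IsBdry c) {x₀ : P.Dart} (h₀ : x₀ ∈ P.rim (P.cluster c))
    (h1 : ∀ x ∈ P.rim (P.cluster c),
      (P.map.faceOn (P.closure (P.cluster c))).SameCycle x₀ x)
    (h2 : ∀ x ∈ P.rim (P.cluster c), ∀ y ∈ P.rim (P.cluster c),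
      P.map.vertexOf x = P.map.vertexOf y → x = y) : P.DiskType (P.cluster c) := by
  set C := P.cluster c with hC
  set Z := P.closure C with hZ
  set b := (P.rim C).ncard with hb
  have hdisj : Disjoint C (P.rim C) := Set.disjoint_right.2 fun x hx =>
    not_mem_cluster_of_isBdry hc hx.1
  -- Euler's formula is applied to the graph of the edges of `C`. Each vertex in `O` is a component
  -- with one vertex and one face. The remaining component has the interior vertices and edges of
  -- `C` plus `b` vertices and `b` edges on the rim, the triangles of `C`, and one outer face. The
  -- two terms `b` cancel, and Euler characteristic one remains for the interior.
  have hdef := P.isSpherical.defect_edgeOn Z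
  -- the vertices outside
  set O : Set P.Dart := {x | ∀ z, P.map.vert.SameCycle x z → z ∉ Z} with hO
  have satO : Saturated (cyc P.map.vert) O := fun x y hxy hx z hz => hx z (hxy.trans hz)
  have satOc : Saturated (cyc P.map.vert) Oᶜ := fun x y hxy hx hy =>
    hx fun z hz => hy z (hxy.symm.trans hz)
  have memOc : ∀ x, x ∈ Oᶜ → ∃ z ∈ Z, P.map.vert.SameCycle x z := by
    intro x hx
    simp only [hO, Set.mem_compl_iff, Set.mem_ofPred_eq, not_forall, not_not] at hx
    obtain ⟨z, h3, h4⟩ := hx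
    exact ⟨z, h4, h3⟩
  have ZO : Z ⊆ Oᶜ := fun x hx h => h x (Perm.SameCycle.refl _ _) hx
  have On : ∀ x ∈ O, x ∉ Z := fun x hx h => ZO h hx
  have cup : O ∪ Oᶜ = Set.univ := Set.union_compl_self O
  -- components
  have satcO : Saturated (P.map.connOn Z) O := by
    have h5 : P.map.connOn Z ≤ Setoid.ker (fun x => x ∈ O) := by
      refine CombMap.connOn_le (fun x => ?_) fun x hx => ?_
      · exact propext ⟨fun h => satO _ _ (cyc_apply _ _) h, fun h =>
          satO _ _ ((cyc P.map.vert).symm (cyc_apply _ x)) h⟩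
      · exact propext ⟨fun h => absurd hx.1 (On _ h), fun h => absurd hx.2 (On _ h)⟩
    intro x y hxy hx
    have := h5 hxy
    rw [Setoid.ker_def] at this
    rwa [← this]
  have hconn : Nat.card (Quotient (conn P.map.vert (P.map.edgeOn Z))) =
      innerCard (cyc P.map.vert) O + 1 := by
    rw [← innerCard_univ, ← cup]
    change innerCard (P.map.connOn Z) _ = _
    rw [innerCard_union satcO disjoint_compl_right]
    congr 1
    · refine innerCard_congr satcO fun x hx y => ⟨fun h => ?_, fun h => CombMap.connOn_of_vert h⟩
      let s : Setoid P.Dart :=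
        { r := fun x y => x = y ∨ cyc P.map.vert x y ∨ (x ∈ Oᶜ ∧ y ∈ Oᶜ)
          iseqv := by
            refine ⟨fun x => Or.inl rfl, ?_, ?_⟩
            · rintro x y (h | h | h)
              · exact Or.inl h.symm
              · exact Or.inr (Or.inl h.symm)
              · exact Or.inr (Or.inr h.symm)
            · rintro x y z (rfl | h | h) (rfl | h' | h')
              · exact Or.inl rfl
              · exact Or.inr (Or.inl h')
              · exact Or.inr (Or.inr h')
              · exact Or.inr (Or.inl h)
              · exact Or.inr (Or.inl (h.trans h'))
              · exact Or.inr (Or.inr ⟨satOc _ _ ((cyc P.map.vert).symm h) h'.1, h'.2⟩)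
              · exact Or.inr (Or.inr h)
              · exact Or.inr (Or.inr ⟨h.1, satOc _ _ h' h.2⟩)
              · exact Or.inr (Or.inr ⟨h.1, h'.2⟩) }
      have h5 : P.map.connOn Z ≤ s := by
        refine CombMap.connOn_le (fun x => Or.inr (Or.inl (cyc_apply _ _))) fun x hx => ?_
        exact Or.inr (Or.inr ⟨ZO hx.1, ZO hx.2⟩)
      rcases h5 h with rfl | h6 | h6
      · exact Setoid.refl' _ _
      · exact h6
      · exact absurd hx h6.1
    · have hcC : ∀ x ∈ C, P.map.connOn Z c x := by
        let s : Setoid P.Dart :=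
          { r := fun x y => x = y ∨ ((x ∈ C ↔ y ∈ C) ∧ (x ∈ C → P.map.connOn Z x y))
            iseqv := by
              refine ⟨fun x => Or.inl rfl, ?_, ?_⟩
              · rintro x y (rfl | ⟨h, h'⟩)
                · exact Or.inl rfl
                · exact Or.inr ⟨h.symm, fun h3 => Setoid.symm' _ (h' (h.2 h3))⟩
              · rintro x y z (rfl | ⟨h, h'⟩) (rfl | ⟨k, k'⟩)
                · exact Or.inl rfl
                · exact Or.inr ⟨k, k'⟩
                · exact Or.inr ⟨h, h'⟩
                · exact Or.inr ⟨h.trans k, fun h3 => Setoid.trans' _ (h' h3) (k' (h.1 h3))⟩ }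
        intro x hx
        have hx' : P.SameCluster c x := hx
        have h5 : s c x := by
          refine Relation.EqvGen.rec ?_ (fun a => Or.inl rfl) (fun a b _ ih => s.symm ih)
            (fun a b d _ _ ih ih' => s.trans ih ih') hx'
          rintro a d ⟨ha, hd, hr⟩
          have hiff : a ∈ C ↔ d ∈ C :=
            ⟨fun h => Relation.EqvGen.trans _ _ _ h (Relation.EqvGen.rel _ _ ⟨ha, hd, hr⟩),
              fun h => Relation.EqvGen.trans _ _ _ h
                (Relation.EqvGen.symm _ _ (Relation.EqvGen.rel _ _ ⟨ha, hd, hr⟩))⟩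
          refine Or.inr ⟨hiff, fun h => ?_⟩
          have haZ : P.map.Active Z a := (active_closure_iff hc).2 (Or.inl h)
          rcases hr with rfl | rfl
          · have := CombMap.connOn_faceOn (M := P.map) (A := Z) a
            rwa [CombMap.faceOn_of_active haZ] at this
          · exact CombMap.connOn_edge haZ
        rcases h5 with rfl | h5
        · exact Setoid.refl' _ _
        · exact h5.2 (mem_cluster_self c)
      refine innerCard_eq_one (x := c) (fun x y hxy hx hy => hx ?_) (ZO (Or.inl (mem_cluster_self c)))
        fun y hy => ?_
      · exact satcO y x (Setoid.symm' _ hxy) hy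
      · obtain ⟨z, hz, hyz⟩ := memOc y hy
        refine Setoid.trans' _ (CombMap.connOn_of_vert hyz) (Setoid.symm' _ ?_)
        rcases hz with hz | hz
        · exact hcC z hz
        · refine Setoid.trans' _ (hcC _ hz.2) (Setoid.symm' _ (CombMap.connOn_edge ?_))
          exact (active_closure_iff hc).2 (Or.inr hz)
  -- vertices
  have hvert : numCycles P.map.vert =
      innerCard (cyc P.map.vert) O + innerCard (cyc P.map.vert) C + b := by
    rw [numCycles, ← innerCard_univ, ← cup, innerCard_union satO disjoint_compl_right, add_assoc]
    congr 1
    set I : Set P.Dart := {x | ∀ z, P.map.vert.SameCycle x z → z ∈ C} with hI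
    have satI : Saturated (cyc P.map.vert) I := fun x y hxy hx z hz => hx z (hxy.trans hz)
    have hIC : I ⊆ C := fun x hx => hx x (Perm.SameCycle.refl _ _)
    have h5 : Oᶜ = I ∪ (Oᶜ \ I) :=
      (Set.union_sdiff_cancel fun x hx => ZO (Or.inl (hIC hx))).symm
    have satOI : Saturated (cyc P.map.vert) (Oᶜ \ I) := fun x y hxy hx =>
      ⟨satOc x y hxy hx.1, fun h => hx.2 (satI y x ((cyc P.map.vert).symm hxy) h)⟩
    rw [h5, innerCard_union satI Set.disjoint_sdiff_right]
    congr 1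
    · exact innerCard_mono_core hIC fun x hx z hz => hx z (Setoid.symm' _ hz)
    -- The rim is a transversal of the boundary vertices of `C`: by `h2` at most one rim dart starts
    -- at each, and turning around the vertex from a dart outside `C` finds one.
    · refine innerCard_eq_ncard satOI (fun x hx => ⟨ZO (Or.inr hx), fun h =>
        not_mem_cluster_of_isBdry hc hx.1 (hIC h)⟩)
        (fun x hx y hy hxy => h2 x hx y hy (CombMap.vertexOf_eq_iff.2 hxy)) fun x hx => ?_
      obtain ⟨z, hz, hxz⟩ := memOc x hx.1
      rcases hz with hz | hz
      · have h6 : ∃ w, P.map.vert.SameCycle x w ∧ w ∉ C := by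
          by_contra hcon
          push Not at hcon
          exact hx.2 hcon
        obtain ⟨w, hxw, hw⟩ := h6
        obtain ⟨y, hy, h7, -⟩ := exists_rim_of_vert hc hw (Or.inl hz) (hxw.symm.trans hxz)
        exact ⟨y, hy, hxw.trans h7⟩
      · exact ⟨z, hz, hxz⟩
  -- faces
  have hfO : ∀ x ∈ O, P.map.faceOn Z x ∈ O := fun x hx => by
    rw [faceOn_closure_of_not_mem (On x hx)]
    exact satO _ _ (cyc_apply _ _) hx
  have satfO : Saturated (cyc (P.map.faceOn Z)) O := saturated_cyc hfO
  have hCO : C ⊆ Oᶜ := fun x hx => ZO (Or.inl hx)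
  have satfC := saturated_cluster_faceOn hc
  have hface : numCycles (P.map.faceOn Z) =
      innerCard (cyc P.map.vert) O + innerCard (cyc P.map.face) C + 1 := by
    rw [numCycles, ← innerCard_univ, ← cup, innerCard_union satfO disjoint_compl_right, add_assoc]
    congr 1
    · refine innerCard_congr satfO fun x hx y => ⟨fun h => ?_, fun h => ?_⟩
      · refine (SameCycle.induction (p := fun y => y ∈ O ∧ cyc P.map.vert x y) ?_
          ⟨hx, Setoid.refl' _ _⟩ h).2
        rintro z ⟨h5, h6⟩
        refine ⟨hfO z h5, ?_⟩
        rw [faceOn_closure_of_not_mem (On z h5)]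
        exact Setoid.trans' _ h6 (cyc_apply _ _)
      · refine (SameCycle.induction
          (p := fun y => y ∈ O ∧ cyc (P.map.faceOn Z) x y) ?_ ⟨hx, Setoid.refl' _ _⟩ h).2
        rintro z ⟨h5, h6⟩
        refine ⟨satO _ _ (cyc_apply _ _) h5, ?_⟩
        rw [← faceOn_closure_of_not_mem (On z h5)]
        exact Setoid.trans' _ h6 (cyc_apply _ _)
    · rw [← Set.union_sdiff_cancel hCO, innerCard_union satfC Set.disjoint_sdiff_right]
      congr 1
      · refine innerCard_congr satfC fun x hx y => ⟨fun h => ?_, fun h => ?_⟩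
        · refine (SameCycle.induction (p := fun y => y ∈ C ∧ cyc P.map.face x y) ?_
            ⟨hx, Setoid.refl' _ _⟩ h).2
          rintro z ⟨h5, h6⟩
          rw [faceOn_closure_of_mem hc (Or.inl h5)]
          exact ⟨face_mem_cluster hc h5, Setoid.trans' _ h6 (cyc_apply _ _)⟩
        · refine (SameCycle.induction
            (p := fun y => y ∈ C ∧ cyc (P.map.faceOn Z) x y) ?_ ⟨hx, Setoid.refl' _ _⟩ h).2
          rintro z ⟨h5, h6⟩
          rw [← faceOn_closure_of_mem hc (Or.inl h5)]
          refine ⟨?_, Setoid.trans' _ h6 (cyc_apply _ _)⟩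
          rw [faceOn_closure_of_mem hc (Or.inl h5)]
          exact face_mem_cluster hc h5
      · refine innerCard_eq_one (x := x₀) (fun x y hxy hx => ⟨fun h => hx.1 ?_, fun h => hx.2 ?_⟩)
          ⟨ZO (Or.inr h₀), not_mem_cluster_of_isBdry hc h₀.1⟩ fun y hy => ?_
        · exact satfO y x (Setoid.symm' _ hxy) h
        · exact satfC y x (Setoid.symm' _ hxy) h
        · obtain ⟨z, hz, hyz⟩ := memOc y hy.1
          obtain ⟨w, hw, -, h7⟩ := exists_rim_of_vert hc hy.2 hz hyz
          exact h7.trans (h1 w hw).symm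
  -- edges
  set C₁ : Set P.Dart := {x | x ∈ C ∧ P.map.edge x ∈ C} with hC₁
  have he1 : C₁ ⊆ C := fun x hx => hx.1
  have himg : C \ C₁ = P.map.edge '' P.rim C := by
    ext x
    constructor
    · rintro ⟨hx, hx'⟩
      refine ⟨P.map.edge x, ⟨?_, by rw [P.map.edge_edge]; exact hx⟩, P.map.edge_edge x⟩
      by_contra h
      exact hx' ⟨hx, edge_mem_cluster hc hx h⟩
    · rintro ⟨y, hy, rfl⟩
      refine ⟨hy.2, fun h => ?_⟩
      have := h.2
      rw [P.map.edge_edge] at this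
      exact not_mem_cluster_of_isBdry hc hy.1 this
  -- A dart of `C` either shares an interior edge with another dart of `C`, or is the reverse of a
  -- rim dart.
  have hcardC : C.ncard = 2 * innerCard (cyc P.map.edge) C + b := by
    have h5 : innerCard (cyc P.map.edge) C₁ = innerCard (cyc P.map.edge) C :=
      innerCard_mono_core he1 fun x hx => (⟨hx x (Setoid.refl' _ _),
        hx _ (Setoid.symm' _ (cyc_apply _ _))⟩ : x ∈ C ∧ P.map.edge x ∈ C)
    rw [← h5, CombMap.two_mul_innerCard_edge (U := C₁)
        fun x hx => ⟨hx.2, by rw [P.map.edge_edge]; exact hx.1⟩, hb, ← Set.ncard_image_of_injective (P.rim C) P.map.edge.injective, ← himg, add_comm]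
    exact (Set.ncard_sdiff_add_ncard_of_subset he1 (Set.toFinite _)).symm
  have hedge : numCycles (P.map.edgeOn Z) + (C.ncard + b) =
      Nat.card P.Dart + innerCard (cyc P.map.edge) C + b := by
    have hZc : Z.ncard = C.ncard + b :=
      Set.ncard_union_eq hdisj (Set.toFinite _) (Set.toFinite _)
    have satZ : Saturated (cyc (P.map.edgeOn Z)) Z := saturated_cyc fun x hx => by
      rw [CombMap.edgeOn_of_active ((active_closure_iff hc).2 hx)]
      exact edge_mem_closure hc hx
    have h5 : innerCard (cyc (P.map.edgeOn Z)) Zᶜ = Zᶜ.ncard := by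
      refine innerCard_eq_ncard (fun x y hxy hx hy => hx (satZ y x (Setoid.symm' _ hxy) hy))
        subset_rfl (fun x hx y _ hxy => ?_) fun x hx => ⟨x, hx, Setoid.refl' _ _⟩
      rcases CombMap.cyc_edgeOn_iff.1 hxy with h | h
      · exact h
      · exact absurd h.1.1 hx
    have h6 : innerCard (cyc (P.map.edgeOn Z)) Z = innerCard (cyc P.map.edge) Z := by
      refine innerCard_congr satZ fun x hx y => ?_
      rw [CombMap.cyc_edgeOn_iff, CombMap.cyc_edge_iff, active_closure_iff hc]
      exact or_congr_right (and_iff_right hx)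
    have h7 := CombMap.two_mul_innerCard_edge (M := P.map) (U := Z)
      fun x hx => edge_mem_closure hc hx
    have h8 : numCycles (P.map.edgeOn Z) =
        innerCard (cyc (P.map.edgeOn Z)) Z + innerCard (cyc (P.map.edgeOn Z)) Zᶜ := by
      rw [numCycles, ← innerCard_univ, ← Set.union_compl_self Z,
        innerCard_union satZ disjoint_compl_right]
    have h9 := Set.ncard_add_ncard_compl Z
    omega
  have hfin : (innerCard (cyc P.map.vert) C : ℤ) - innerCard (cyc P.map.edge) C +
      innerCard (cyc P.map.face) C = 1 := by
    rw [defect, hconn, hvert] at hdef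
    change _ - _ - _ - (numCycles (P.map.faceOn Z) : ℤ) = 0 at hdef
    rw [hface] at hdef
    push_cast at hdef
    omega
  exact hfin

end CombPants

end Clusters

/-! ### Tightness makes the two sides of a bigon coincide -/

section BigonClusters

open scoped Classical

namespace CombPants

variable {P : CombPants} {A : Set P.Dart} {m : ℕ} {p q : ℕ → P.Dart}

namespace Bigon

/-- An edge of a bigon that is not shared by both sides has a triangle on the other side. -/
theorem not_isBdry_edge (B : Bigon P A m p q) {i : ℕ} (hi : i < m)
    (h : P.map.edge (p i) ≠ q (i + 1)) : ¬ P.IsBdry (P.map.edge (p i)) := by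
  intro hb
  have hc : P.map.connOn A (q 0) (P.map.edge (p i)) :=
    Setoid.trans' _ (B.conn_p i hi.le) (CombMap.connOn_edge (B.active_p i hi))
  have hv : P.map.vertexOf (P.map.edge (p i)) = P.map.vertexOf (p (i + 1)) := by
    rw [CombMap.vertexOf_edge, B.face_p i hi]
  obtain ⟨j, hj, h1 | h1⟩ := B.mem _ hb hc
  · have h2 : j = i + 1 := B.level_p j hj (i + 1) hi (by rw [← h1, hv])
    subst h2
    have hact : P.map.Active A (p (i + 1)) := h1 ▸ (B.active_p i hi).edge
    rcases Nat.lt_or_ge (i + 1) m with h3 | h3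
    · have h4 : P.map.vertexOf (p (i + 2)) = P.map.vertexOf (p i) := by
        rw [← B.face_p (i + 1) h3, ← CombMap.vertexOf_edge, ← h1, P.map.edge_edge]
      have := B.level_p (i + 2) (by omega) i hi.le h4
      omega
    · exact B.inactive_p ((show i + 1 = m by omega) ▸ hact)
  · have h2 : i + 1 = j := B.level (i + 1) hi j hj (by rw [← h1, hv])
    subst h2
    exact h h1

theorem conn_cluster (B : Bigon P A m p q) {i₀ : ℕ} (hi₀ : i₀ < m) {x : P.Dart} (hx : x ∈ P.cluster (P.map.edge (p i₀))) :
    P.map.connOn A (q 0) x := by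
  refine Setoid.trans' _ (Setoid.trans' _ (B.conn_p i₀ hi₀.le)
    (CombMap.connOn_edge (B.active_p i₀ hi₀))) ?_
  refine cluster_subset_class (s := P.map.connOn A) (fun x hx => ?_) (fun x hx => ?_) hx
  · have := CombMap.connOn_faceOn (M := P.map) (A := A) x
    rwa [CombMap.faceOn_of_active (B.filled.1 x hx)] at this
  · exact CombMap.connOn_edge (B.filled.1 x hx)

theorem mem_of_mem_rim (B : Bigon P A m p q) {i₀ : ℕ} (hi₀ : i₀ < m)
    (hc : ¬ P.IsBdry (P.map.edge (p i₀))) {x : P.Dart} (hx : x ∈ P.rim (P.cluster (P.map.edge (p i₀)))) :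
    (∃ i < m, x = p i) ∨ ∃ i < m, x = q (i + 1) := by
  have hne : ¬ P.IsBdry (P.map.edge x) := not_isBdry_of_mem_cluster hc hx.2
  have hact : P.map.Active A x := P.map.active_edge_iff.1 (B.filled.1 _ hne)
  have hcx : P.map.connOn A (q 0) x :=
    Setoid.trans' _ (B.conn_cluster hi₀ hx.2) (Setoid.symm' _ (CombMap.connOn_edge hact))
  obtain ⟨i, hi, h | h⟩ := B.mem x hx.1 hcx
  · rcases hi.lt_or_eq with h1 | h1
    · exact Or.inl ⟨i, h1, h⟩
    · subst h1
      exact absurd (h ▸ hact) B.inactive_p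
  · rcases i with _ | i
    · exact absurd (h ▸ B.point_q.2) hne
    · exact Or.inr ⟨i, hi, h⟩

theorem mem_rim (B : Bigon P A m p q) {i₀ : ℕ} (hi₀ : i₀ < m) :
    p i₀ ∈ P.rim (P.cluster (P.map.edge (p i₀))) :=
  ⟨B.bdry_p i₀ hi₀.le, mem_cluster_self _⟩

/-- A common vertex of both sides separates the clusters of a bigon. -/
theorem separates (B : Bigon P A m p q) {i₀ : ℕ} (hi₀ : i₀ < m)
    (hc : ¬ P.IsBdry (P.map.edge (p i₀))) {t : ℕ} (ht : t ≤ m) (hv : P.map.vertexOf (p t) = P.map.vertexOf (q t)) :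
    (i₀ < t → ∀ i < m, (p i ∈ P.rim (P.cluster (P.map.edge (p i₀))) → i < t) ∧
      (q (i + 1) ∈ P.rim (P.cluster (P.map.edge (p i₀))) → i < t)) ∧
    (t ≤ i₀ → ∀ i < m, (p i ∈ P.rim (P.cluster (P.map.edge (p i₀))) → t ≤ i) ∧
      (q (i + 1) ∈ P.rim (P.cluster (P.map.edge (p i₀))) → t ≤ i)) := by
  set C := P.cluster (P.map.edge (p i₀)) with hC
  rcases Nat.eq_zero_or_pos t with h0 | h0
  · subst h0
    exact ⟨fun h => absurd h (by omega), fun _ i _ => ⟨fun _ => by omega, fun _ => by omega⟩⟩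
  rcases ht.lt_or_eq with h0' | h0'
  swap
  · subst h0'
    exact ⟨fun _ i hi => ⟨fun _ => hi, fun _ => hi⟩, fun h => absurd h (by omega)⟩
  -- The common vertex is split at the corners of `p t` and `q t`, which lie on the same boundary
  -- walk, so the two halves of the bigon fall apart. A cluster is glued along edges and is not
  -- affected by the split, so it stays in one half.
  set σ := swap (p t) (q t) * P.map.vert with hσ
  set s := conn σ (P.map.edgeOn A) with hs
  have hsep : ¬ s (p t) (q t) := by
    refine not_conn_swap_mul (P.isSpherical.defect_edgeOn A) (B.ne t ht t ht)
      (CombMap.vertexOf_eq_iff.1 hv) ?_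
    exact (B.filled.2 _ (B.bdry_p t ht) (B.conn_p t ht)).symm.trans
      (B.filled.2 _ (B.bdry_q t ht) (B.conn_q t ht))
  have sedge : ∀ x, P.map.Active A x → s x (P.map.edge x) := fun x hx => by
    have := conn_right σ (P.map.edgeOn A) x
    rwa [CombMap.edgeOn_of_active hx] at this
  have svert : ∀ x, P.map.vert x ≠ p t → P.map.vert x ≠ q t → s x (P.map.vert x) :=
    fun x h1 h2 => by
      have := conn_left σ (P.map.edgeOn A) x
      rwa [hσ, Perm.mul_apply, swap_apply_of_ne_of_ne h1 h2] at this
  have sface : ∀ x, P.map.Active A x → P.map.face x ≠ p t → P.map.face x ≠ q t →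
      s x (P.map.face x) := fun x hx h1 h2 => by
    rw [← CombMap.vert_edge] at h1 h2 ⊢
    exact Setoid.trans' _ (sedge x hx) (svert _ h1 h2)
  have scl : ∀ x ∈ C, s (P.map.edge (p i₀)) x := fun x hx => by
    refine cluster_subset_class (s := s) (fun x hx => ?_)
      (fun x hx => sedge x (B.filled.1 x hx)) hx
    have h5 : ¬ P.IsBdry (P.map.face x) := fun h => hx (isBdry_face.1 h)
    exact sface x (B.filled.1 x hx) (fun h => h5 (h ▸ B.bdry_p t ht))
      (fun h => h5 (h ▸ B.bdry_q t ht))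
  have srim : ∀ x ∈ P.rim C, s (p i₀) x := fun x hx => by
    have hact : P.map.Active A x :=
      P.map.active_edge_iff.1 (B.filled.1 _ (not_isBdry_of_mem_cluster hc hx.2))
    exact Setoid.trans' _ (sedge _ (B.active_p i₀ hi₀)) (Setoid.trans' _ (scl _ hx.2)
      (Setoid.symm' _ (sedge _ hact)))
  have pne : ∀ i ≤ m, i ≠ t → p i ≠ p t := fun i hi h h1 =>
    h (B.level_p i hi t ht (by rw [h1]))
  have qne : ∀ i ≤ m, i ≠ t → q i ≠ q t := fun i hi h h1 =>
    h (B.level_q i hi t ht (by rw [h1]))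
  -- The left half is the class of `q t`, containing `q i` for `i ≤ t` and `p i` for `i < t`; the
  -- right half is the class of `p t`, with `p i` for `t ≤ i` and `q i` for `t < i`.
  have leftq : ∀ n i, i + n = t → s (q t) (q i) := by
    intro n
    induction n with
    | zero => intro i hi; rw [show i = t by omega]
    | succ n ih =>
      intro i hi
      refine Setoid.trans' _ (ih (i + 1) (by omega)) ?_
      have h5 := B.face_q i (by omega)
      rw [← h5]
      refine sface _ (B.active_q i (by omega)) ?_ ?_ <;> rw [h5]
      · exact (B.ne t ht i (by omega)).symm
      · exact qne i (by omega) (by omega)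
  have leftp : ∀ i < t, s (q t) (p i) := by
    intro i
    induction i with
    | zero =>
      intro hi
      refine Setoid.trans' _ (leftq t 0 (by omega)) ?_
      rw [← B.vert_p]
      refine svert _ ?_ ?_ <;> rw [B.vert_p]
      · exact pne 0 (by omega) (by omega)
      · exact B.ne 0 (by omega) t ht
    | succ i ih =>
      intro hi
      refine Setoid.trans' _ (ih (by omega)) ?_
      have h5 := B.face_p i (by omega)
      rw [← h5]
      refine sface _ (B.active_p i (by omega)) ?_ ?_ <;> rw [h5]
      · exact pne (i + 1) (by omega) (by omega)
      · exact B.ne (i + 1) (by omega) t ht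
  have rightp : ∀ n, t + n ≤ m → s (p t) (p (t + n)) := by
    intro n
    induction n with
    | zero => intro _; exact Setoid.refl' _ _
    | succ n ih =>
      intro hi
      refine Setoid.trans' _ (ih (by omega)) ?_
      have h5 := B.face_p (t + n) (by omega)
      rw [← add_assoc, ← h5]
      refine sface _ (B.active_p (t + n) (by omega)) ?_ ?_ <;> rw [h5]
      · exact pne (t + n + 1) (by omega) (by omega)
      · exact B.ne (t + n + 1) (by omega) t ht
  have rightq : ∀ n i, i + n = m → t < i → s (p t) (q i) := by
    intro n
    induction n with
    | zero =>
      intro i hi _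
      rw [show i = m by omega]
      refine Setoid.trans' _ (rightp (m - t) (by omega)) ?_
      rw [Nat.add_sub_cancel' ht, ← B.vert_q]
      refine svert _ ?_ ?_ <;> rw [B.vert_q]
      · exact (B.ne t ht m le_rfl).symm
      · exact qne m le_rfl (by omega)
    | succ n ih =>
      intro i hi hti
      refine Setoid.trans' _ (ih (i + 1) (by omega) (by omega)) ?_
      have h5 := B.face_q i (by omega)
      rw [← h5]
      refine sface _ (B.active_q i (by omega)) ?_ ?_ <;> rw [h5]
      · exact (B.ne t ht i (by omega)).symm
      · exact qne i (by omega) (by omega)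
  have rightp' : ∀ i ≤ m, t ≤ i → s (p t) (p i) := fun i hi hti => by
    have := rightp (i - t) (by omega)
    rwa [Nat.add_sub_cancel' hti] at this
  refine ⟨fun hlt i hi => ⟨fun hx => ?_, fun hx => ?_⟩,
    fun hle i hi => ⟨fun hx => ?_, fun hx => ?_⟩⟩
  · by_contra hcon
    exact hsep (Setoid.symm' _ (Setoid.trans' _ (leftp i₀ hlt) (Setoid.trans' _ (srim _ hx)
      (Setoid.symm' _ (rightp' i hi.le (by omega))))))
  · by_contra hcon
    exact hsep (Setoid.symm' _ (Setoid.trans' _ (leftp i₀ hlt) (Setoid.trans' _ (srim _ hx)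
      (Setoid.symm' _ (rightq (m - (i + 1)) (i + 1) (by omega) (by omega))))))
  · by_contra hcon
    exact hsep (Setoid.trans' _ (rightp' i₀ hi₀.le hle) (Setoid.trans' _ (srim _ hx)
      (Setoid.symm' _ (leftp i (by omega)))))
  · by_contra hcon
    exact hsep (Setoid.trans' _ (rightp' i₀ hi₀.le hle) (Setoid.trans' _ (srim _ hx)
      (Setoid.symm' _ (leftq (t - (i + 1)) (i + 1) (by omega)))))

/-- The rim of a cluster in a bigon consists of the parts of both sides between two consecutive
common vertices. -/
theorem exists_rim (B : Bigon P A m p q) {i₀ : ℕ} (hi₀ : i₀ < m)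
    (hc : ¬ P.IsBdry (P.map.edge (p i₀))) :
    ∃ s t, s < t ∧ t ≤ m ∧ P.map.vertexOf (p s) = P.map.vertexOf (q s) ∧
      P.map.vertexOf (p t) = P.map.vertexOf (q t) ∧
      (∀ i, s < i → i < t → P.map.vertexOf (p i) ≠ P.map.vertexOf (q i)) ∧
      (∀ x, x ∈ P.rim (P.cluster (P.map.edge (p i₀))) ↔
        (∃ i, s ≤ i ∧ i < t ∧ x = p i) ∨ ∃ i, s ≤ i ∧ i < t ∧ x = q (i + 1)) ∧
      ∀ x ∈ P.rim (P.cluster (P.map.edge (p i₀))),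
        (P.map.faceOn (P.closure (P.cluster (P.map.edge (p i₀))))).SameCycle (p i₀) x := by
  set C := P.cluster (P.map.edge (p i₀)) with hC
  have v0 : P.map.vertexOf (p 0) = P.map.vertexOf (q 0) := by
    rw [CombMap.vertexOf_eq_iff, ← B.vert_p]
    exact (cyc_apply P.map.vert (q 0)).symm
  have vm : P.map.vertexOf (p m) = P.map.vertexOf (q m) := by
    rw [CombMap.vertexOf_eq_iff, ← B.vert_q]
    exact cyc_apply P.map.vert (p m)
  have ext : ∃ t, i₀ < t ∧ t ≤ m ∧ P.map.vertexOf (p t) = P.map.vertexOf (q t) :=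
    ⟨m, hi₀, le_rfl, vm⟩
  obtain ⟨ht1, ht2, ht3⟩ := Nat.find_spec ext
  have htmin : ∀ j, i₀ < j → j < Nat.find ext → P.map.vertexOf (p j) ≠ P.map.vertexOf (q j) :=
    fun j hj hj' h => Nat.find_min ext hj' ⟨hj, by omega, h⟩
  generalize Nat.find ext = t at ht1 ht2 ht3 htmin
  -- `s` and `t` are the common vertices closest to the edge `p i₀`, before and after it.
  set s := Nat.findGreatest (fun j => P.map.vertexOf (p j) = P.map.vertexOf (q j)) i₀ with hs
  have hs1 : P.map.vertexOf (p s) = P.map.vertexOf (q s) :=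
    Nat.findGreatest_spec (P := fun j => P.map.vertexOf (p j) = P.map.vertexOf (q j))
      (Nat.zero_le i₀) v0
  have hs2 : s ≤ i₀ := Nat.findGreatest_le i₀
  have hsmax : ∀ j, s < j → j ≤ i₀ → P.map.vertexOf (p j) ≠ P.map.vertexOf (q j) :=
    fun j h1 h2 => Nat.findGreatest_is_greatest h1 h2
  clear_value s
  have hmid : ∀ i, s < i → i < t → P.map.vertexOf (p i) ≠ P.map.vertexOf (q i) := by
    intro i h1 h2
    rcases Nat.lt_or_ge i₀ i with h3 | h3
    · exact htmin i h3 h2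
    · exact hsmax i h1 h3
  have sept := (B.separates hi₀ hc ht2 ht3).1 ht1
  have seps := (B.separates hi₀ hc (by omega) hs1).2 hs2
  have sub : ∀ x ∈ P.rim C, (∃ i, s ≤ i ∧ i < t ∧ x = p i) ∨
      ∃ i, s ≤ i ∧ i < t ∧ x = q (i + 1) := by
    intro x hx
    rcases B.mem_of_mem_rim hi₀ hc hx with ⟨i, hi, rfl⟩ | ⟨i, hi, rfl⟩
    · exact Or.inl ⟨i, (seps i hi).1 hx, (sept i hi).1 hx, rfl⟩
    · exact Or.inr ⟨i, (seps i hi).2 hx, (sept i hi).2 hx, rfl⟩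
  -- Going around the cluster, a rim dart is followed by a rim dart that starts where it ends. By
  -- the levels this can only be the next edge of the same side, except at `t` and `s`, where the
  -- walk turns from `p` to `q` and back. So the rim is one closed walk along both sides.
  set G : P.Dart → Prop := fun x => x ∈ P.rim C ∧
    (P.map.faceOn (P.closure C)).SameCycle (p i₀) x with hG
  have G0 : G (p i₀) := ⟨B.mem_rim hi₀, Perm.SameCycle.refl _ _⟩
  have stepP : ∀ i, s ≤ i → i + 1 < t → G (p i) → G (p (i + 1)) := by
    rintro i h1 h2 ⟨h3, h4⟩
    obtain ⟨y, hy, h5, h6⟩ := exists_next_rim hc h3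
    rw [B.face_p i (by omega)] at h5
    rcases sub y hy with ⟨j, hj, hj', rfl⟩ | ⟨j, hj, hj', rfl⟩
    · have := B.level_p _ (by omega) _ (by omega) h5
      subst this
      exact ⟨hy, h4.trans h6⟩
    · have := B.level _ (by omega) _ (by omega) h5
      rw [← this] at h5
      exact absurd h5 (hmid (i + 1) (by omega) h2)
  have turnP : G (p (t - 1)) → G (q t) := by
    rintro ⟨h3, h4⟩
    obtain ⟨y, hy, h5, h6⟩ := exists_next_rim hc h3
    rw [B.face_p (t - 1) (by omega), Nat.sub_add_cancel (by omega)] at h5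
    rcases sub y hy with ⟨j, hj, hj', rfl⟩ | ⟨j, hj, hj', rfl⟩
    · have := B.level_p _ (by omega) _ (by omega) h5
      omega
    · have := B.level _ (by omega) _ (by omega) h5
      rw [this]
      exact ⟨hy, h4.trans h6⟩
  have stepQ : ∀ i, s < i → i < t → G (q (i + 1)) → G (q i) := by
    rintro i h1 h2 ⟨h3, h4⟩
    obtain ⟨y, hy, h5, h6⟩ := exists_next_rim hc h3
    rw [B.face_q i (by omega)] at h5
    rcases sub y hy with ⟨j, hj, hj', rfl⟩ | ⟨j, hj, hj', rfl⟩
    · have := B.level _ (by omega) _ (by omega) h5.symm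
      subst this
      exact absurd h5.symm (hmid j h1 h2)
    · have := B.level_q _ (by omega) _ (by omega) h5
      rw [this]
      exact ⟨hy, h4.trans h6⟩
  have turnQ : G (q (s + 1)) → G (p s) := by
    rintro ⟨h3, h4⟩
    obtain ⟨y, hy, h5, h6⟩ := exists_next_rim hc h3
    rw [B.face_q s (by omega)] at h5
    rcases sub y hy with ⟨j, hj, hj', rfl⟩ | ⟨j, hj, hj', rfl⟩
    · have := B.level _ (by omega) _ (by omega) h5.symm
      rw [← this]
      exact ⟨hy, h4.trans h6⟩
    · have := B.level_q _ (by omega) _ (by omega) h5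
      omega
  have runP : ∀ i, s ≤ i → G (p i) → ∀ n, i + n < t → G (p (i + n)) := by
    intro i hi h n
    induction n with
    | zero => intro _; exact h
    | succ n ih => intro hn; exact stepP (i + n) (by omega) (by omega) (ih (by omega))
  have Gt : G (q t) := by
    have h5 := runP i₀ hs2 G0 (t - 1 - i₀) (by omega)
    rw [Nat.add_sub_cancel' (by omega)] at h5
    exact turnP h5
  have runQ : ∀ n i, i + n = t → s < i → G (q i) := by
    intro n
    induction n with
    | zero => intro i hi _; rwa [show i = t by omega]
    | succ n ih => intro i hi hsi; exact stepQ i hsi (by omega) (ih (i + 1) (by omega) (by omega))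
  have Gs : G (p s) := turnQ (runQ (t - (s + 1)) (s + 1) (by omega) (by omega))
  have allP : ∀ i, s ≤ i → i < t → G (p i) := fun i h1 h2 => by
    have := runP s le_rfl Gs (i - s) (by omega)
    rwa [Nat.add_sub_cancel' h1] at this
  have allQ : ∀ i, s ≤ i → i < t → G (q (i + 1)) := fun i h1 h2 =>
    runQ (t - (i + 1)) (i + 1) (by omega) (by omega)
  refine ⟨s, t, by omega, ht2, hs1, ht3, hmid, fun x => ⟨sub x, ?_⟩, fun x hx => ?_⟩
  · rintro (⟨i, h1, h2, rfl⟩ | ⟨i, h1, h2, rfl⟩)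
    · exact (allP i h1 h2).1
    · exact (allQ i h1 h2).1
  · rcases sub x hx with ⟨i, h1, h2, rfl⟩ | ⟨i, h1, h2, rfl⟩
    · exact (allP i h1 h2).2
    · exact (allQ i h1 h2).2

/-- In a tight pair of pants both sides of a bigon coincide. -/
theorem edge_eq (B : Bigon P A m p q) (hP : P.Tight) {i₀ : ℕ} (hi₀ : i₀ < m) :
    P.map.edge (p i₀) = q (i₀ + 1) := by
  -- Otherwise a triangle lies behind `p i₀`, and its cluster is a disk bounded by both sides
  -- between two consecutive common vertices. Just one strand end is attached at each of these two
  -- vertices, so the cluster is a loose disk.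
  by_contra hne
  have hc := B.not_isBdry_edge hi₀ hne
  obtain ⟨s, t, hst, htm, hs, ht, hmid, hrim, hcyc⟩ := B.exists_rim hi₀ hc
  set C := P.cluster (P.map.edge (p i₀)) with hC
  have at_vertex : ∀ x y, P.IsBdry x → P.map.vertexOf x = P.map.vertexOf y →
      P.map.connOn A (q 0) y → ∃ i ≤ m, x = p i ∨ x = q i := fun x y hx h hy =>
    B.mem x hx (Setoid.trans' _ hy (CombMap.connOn_of_vert (CombMap.vertexOf_eq_iff.1 h).symm))
  have atP : ∀ x i, i ≤ m → P.IsBdry x → P.map.vertexOf x = P.map.vertexOf (p i) →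
      x = p i ∨ (x = q i ∧ P.map.vertexOf (p i) = P.map.vertexOf (q i)) := by
    intro x i hi hx h
    obtain ⟨j, hj, rfl | rfl⟩ := at_vertex x _ hx h (B.conn_p i hi)
    · exact Or.inl (by rw [B.level_p j hj i hi h])
    · have := B.level i hi j hj h.symm
      subst this
      exact Or.inr ⟨rfl, h.symm⟩
  have atQ : ∀ x i, i ≤ m → P.IsBdry x → P.map.vertexOf x = P.map.vertexOf (q i) →
      x = q i ∨ (x = p i ∧ P.map.vertexOf (p i) = P.map.vertexOf (q i)) := by
    intro x i hi hx h
    obtain ⟨j, hj, rfl | rfl⟩ := at_vertex x _ hx h (B.conn_q i hi)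
    · have := B.level j hj i hi h
      subst this
      exact Or.inr ⟨rfl, h⟩
    · exact Or.inl (by rw [B.level_q j hj i hi h])
  refine hP _ hc ⟨diskType_of_rim hc (B.mem_rim hi₀) hcyc ?_, ?_⟩
  · intro x hx y hy h
    rcases (hrim x).1 hx with ⟨i, hi, hi', rfl⟩ | ⟨i, hi, hi', rfl⟩ <;>
      rcases (hrim y).1 hy with ⟨j, hj, hj', rfl⟩ | ⟨j, hj, hj', rfl⟩
    · rw [B.level_p i (by omega) j (by omega) h]
    · have := B.level i (by omega) (j + 1) (by omega) h
      subst this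
      exact absurd h (hmid _ (by omega) hi')
    · have := B.level j (by omega) (i + 1) (by omega) h.symm
      subst this
      exact absurd h.symm (hmid _ (by omega) hj')
    · rw [B.level_q (i + 1) (by omega) (j + 1) (by omega) h]
  · have hset : {d | P.IsIntervalComponent d ∧ P.map.edge d ∈ C} = P.rim C := by
      ext x
      exact ⟨fun h => ⟨h.1.1, h.2⟩, fun h => ⟨⟨h.1, not_isBdry_of_mem_cluster hc h.2⟩, h.2⟩⟩
    -- the end of a strand at a vertex with exactly two boundary darts
    have two : ∀ x y, y ≠ x → P.IsBdry y → P.map.vertexOf y = P.map.vertexOf x →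
        (∀ z, P.IsBdry z → P.map.vertexOf z = P.map.vertexOf x → z = x ∨ z = y) →
        P.IsIntervalComponent x → P.attachedEnds x = 1 := by
      intro x y hyx hy hv hz hx
      rw [attachedEnds]
      -- If `y` starts another interval, the vertex is replaced by a star and the strand to its
      -- centre counts; otherwise `y` is the only stranded edge there.
      split_ifs with h
      · rfl
      · rw [Set.ncard_eq_one]
        refine ⟨y, Set.eq_singleton_iff_unique_mem.2 ⟨⟨⟨hy, ?_⟩, hv⟩, ?_⟩⟩
        · by_contra hcon
          exact h ⟨y, hyx, ⟨hy, hcon⟩, hv⟩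
        · rintro z ⟨h1, h2⟩
          rcases hz z h1.1 h2 with rfl | rfl
          · exact absurd h1.2 hx.2
          · rfl
    have none : ∀ x, (∀ z, P.IsBdry z → P.map.vertexOf z = P.map.vertexOf x → z = x) →
        P.IsIntervalComponent x → P.attachedEnds x = 0 := by
      intro x hz hx
      rw [attachedEnds, if_neg]
      · rw [Set.ncard_eq_zero]
        refine Set.eq_empty_iff_forall_notMem.2 ?_
        rintro z ⟨h1, h2⟩
        rw [hz z h1.1 h2] at h1
        exact hx.2 h1.2
      · rintro ⟨z, h1, h2, h3⟩
        exact h1 (hz z h2.1 h3)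
    have hint : ∀ x ∈ P.rim C, P.IsIntervalComponent x := fun x hx =>
      ⟨hx.1, not_isBdry_of_mem_cluster hc hx.2⟩
    have hps : p s ∈ P.rim C := (hrim _).2 (Or.inl ⟨s, le_rfl, hst, rfl⟩)
    have hqt : q t ∈ P.rim C :=
      (hrim _).2 (Or.inr ⟨t - 1, by omega, by omega, by rw [Nat.sub_add_cancel (by omega)]⟩)
    have endp : P.attachedEnds (p s) = 1 :=
      two _ (q s) (B.ne s (by omega) s (by omega)).symm (B.bdry_q s (by omega)) hs.symm
        (fun z hz h => (atP z s (by omega) hz h).imp id And.left) (hint _ hps)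
    have endq : P.attachedEnds (q t) = 1 :=
      two _ (p t) (B.ne t htm t htm) (B.bdry_p t htm) ht
        (fun z hz h => (atQ z t htm hz h).imp id And.left) (hint _ hqt)
    have hne' : p s ≠ q t := B.ne s (by omega) t htm
    rw [clusterDegree, hset]
    -- Strictly between the common vertices a rim vertex has no boundary dart except the rim dart
    -- itself, so nothing is attached.
    have hzero : ∀ x ∈ P.rim C, x ≠ p s → x ≠ q t → P.attachedEnds x = 0 := by
      intro x hx h1 h2
      refine none x (fun z hz h => ?_) (hint x hx)
      rcases (hrim x).1 hx with ⟨i, hi, hi', rfl⟩ | ⟨i, hi, hi', rfl⟩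
      · rcases atP z i (by omega) hz h with h3 | ⟨-, h3⟩
        · exact h3
        · have : i ≠ s := fun h4 => h1 (by rw [h4])
          exact absurd h3 (hmid i (by omega) hi')
      · rcases atQ z (i + 1) (by omega) hz h with h3 | ⟨-, h3⟩
        · exact h3
        · have : i + 1 ≠ t := fun h4 => h2 (by rw [h4])
          exact absurd h3 (hmid (i + 1) (by omega) (by omega))
    rw [finsum_mem_inter_support_eq P.attachedEnds (P.rim C) {p s, q t},
      finsum_mem_pair hne', endp, endq]
    ext x
    simp only [Set.mem_inter_iff, Function.mem_support, Set.mem_insert_iff,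
      Set.mem_singleton_iff]
    constructor
    · rintro ⟨h1, h2⟩
      refine ⟨?_, h2⟩
      by_contra hcon
      push Not at hcon
      exact h2 (hzero x h1 hcon.1 hcon.2)
    · rintro ⟨rfl | rfl, h2⟩
      · exact ⟨hps, h2⟩
      · exact ⟨hqt, h2⟩

end Bigon

end CombPants

end BigonClusters

/-! ### Forgetting vertices of degree two -/

section Smoothing

open scoped Classical

namespace CombMap

variable {D : Type} {M : CombMap D} {R : Set D}

/-- `R` is the set of darts at some vertices of degree two, not containing a whole face. -/
structure Smoothable (M : CombMap D) (R : Set D) : Prop where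
  vert_mem : ∀ d ∈ R, M.vert d ∈ R
  vert_vert : ∀ d ∈ R, M.vert (M.vert d) = d
  vert_ne : ∀ d ∈ R, M.vert d ≠ d
  exists_not_mem : ∀ d, ∃ n, M.face^[n] d ∉ R

variable (M R) in
/-- The number of edges of the chain that starts with `d`. -/
noncomputable def chainLength (d : D) : ℕ := sInf {n | 0 < n ∧ M.face^[n] d ∉ R}

variable (M R) in
/-- The reverse of the last dart of the chain that starts with `d`. -/
noncomputable def chainEdge (d : D) : D := M.edge (M.face^[M.chainLength R d - 1] d)

namespace Smoothable

theorem vert_mem_iff (h : M.Smoothable R) {d : D} : M.vert d ∈ R ↔ d ∈ R := by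
  refine ⟨fun h1 => ?_, h.vert_mem d⟩
  have h2 := M.vert.injective (h.vert_vert _ h1)
  rw [← h2]
  exact h.vert_mem _ h1

theorem chainLength_spec (h : M.Smoothable R) (d : D) :
    0 < M.chainLength R d ∧ M.face^[M.chainLength R d] d ∉ R := by
  have : {n | 0 < n ∧ M.face^[n] d ∉ R}.Nonempty := by
    obtain ⟨n, hn⟩ := h.exists_not_mem (M.face d)
    exact ⟨n + 1, Nat.succ_pos n, hn⟩
  exact Nat.sInf_mem this

theorem mem_of_lt_chainLength {d : D} {i : ℕ} (h0 : 0 < i) (hi : i < M.chainLength R d) :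
    M.face^[i] d ∈ R := by
  by_contra hcon
  exact Nat.notMem_of_lt_sInf hi ⟨h0, hcon⟩

theorem chainLength_eq (h : M.Smoothable R) {d : D} {n : ℕ} (h0 : 0 < n) (hn : M.face^[n] d ∉ R)
    (hi : ∀ i, 0 < i → i < n → M.face^[i] d ∈ R) : M.chainLength R d = n := by
  obtain ⟨h1, h2⟩ := h.chainLength_spec d
  refine le_antisymm (Nat.sInf_le ⟨h0, hn⟩) ?_
  by_contra hcon
  exact h2 (hi _ h1 (by omega))

theorem face_edge_face (h : M.Smoothable R) {x : D} (hx : M.face x ∈ R) : M.face (M.edge (M.face x)) = M.edge x := by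
  rw [← M.vert_edge] at hx
  have h1 := h.vert_vert _ (h.vert_mem_iff.1 hx)
  rwa [M.vert_edge, M.vert_apply] at h1

/-- At a vertex of degree two a face walk goes straight on, in either direction. So the chain of
`chainEdge` is the given chain run backwards. -/
theorem iterate_chainEdge (h : M.Smoothable R) {d : D} {j : ℕ} (hj : j < M.chainLength R d) :
    M.face^[j] (M.chainEdge R d) = M.edge (M.face^[M.chainLength R d - 1 - j] d) := by
  induction j with
  | zero => rfl
  | succ j ih =>
    rw [Function.iterate_succ_apply', ih (by omega)]
    have h1 : M.chainLength R d - 1 - j = M.chainLength R d - 1 - (j + 1) + 1 := by omega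
    rw [h1, Function.iterate_succ_apply']
    refine h.face_edge_face ?_
    rw [← Function.iterate_succ_apply' M.face]
    exact mem_of_lt_chainLength (by omega) (by omega)

theorem vert_edge_iterate {d : D} {j : ℕ} :
    M.vert (M.edge (M.face^[j] d)) = M.face^[j + 1] d := by
  rw [M.vert_edge, Function.iterate_succ_apply']

theorem vert_chainEdge (h : M.Smoothable R) (d : D) :
    M.vert (M.chainEdge R d) = M.face^[M.chainLength R d] d := by
  obtain ⟨h1, -⟩ := h.chainLength_spec d
  rw [chainEdge, vert_edge_iterate, Nat.sub_add_cancel h1]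

theorem chainEdge_not_mem (h : M.Smoothable R) (d : D) : M.chainEdge R d ∉ R := by
  rw [← h.vert_mem_iff, h.vert_chainEdge]
  exact (h.chainLength_spec d).2

theorem chainLength_chainEdge (h : M.Smoothable R) {d : D} (hd : d ∉ R) :
    M.chainLength R (M.chainEdge R d) = M.chainLength R d := by
  obtain ⟨h1, -⟩ := h.chainLength_spec d
  refine h.chainLength_eq h1 ?_ fun i hi hi' => ?_
  · rw [← Nat.sub_add_cancel h1, Function.iterate_succ_apply', h.iterate_chainEdge (by omega),
      Nat.sub_self, ← M.vert_apply]
    exact fun h2 => hd (h.vert_mem_iff.1 h2)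
  · rw [h.iterate_chainEdge hi', ← h.vert_mem_iff, vert_edge_iterate]
    exact mem_of_lt_chainLength (by omega) (by omega)

theorem chainEdge_chainEdge (h : M.Smoothable R) {d : D} (hd : d ∉ R) : M.chainEdge R (M.chainEdge R d) = d := by
  obtain ⟨h1, -⟩ := h.chainLength_spec d
  rw [chainEdge, h.chainLength_chainEdge hd, h.iterate_chainEdge (by omega), Nat.sub_self,
    M.edge_edge]
  rfl

/-- A chain equal to its own reverse would turn around in its middle: at a vertex fixed by `vert` if
its length is even, on an edge equal to its reverse if it is odd. -/
theorem chainEdge_ne (h : M.Smoothable R) (d : D) : M.chainEdge R d ≠ d := by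
  intro h0
  obtain ⟨h1, -⟩ := h.chainLength_spec d
  have key : ∀ j < M.chainLength R d,
      M.face^[j] d = M.edge (M.face^[M.chainLength R d - 1 - j] d) := fun j hj => by
    rw [← h.iterate_chainEdge hj, h0]
  rcases Nat.even_or_odd' (M.chainLength R d) with ⟨k, hk | hk⟩
  · have h2 := key k (by omega)
    rw [show M.chainLength R d - 1 - k = k - 1 by omega] at h2
    have h3 := vert_edge_iterate (M := M) (d := d) (j := k - 1)
    rw [← h2, Nat.sub_add_cancel (by omega)] at h3
    exact h.vert_ne _ (mem_of_lt_chainLength (by omega) (by omega)) h3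
  · have h2 := key k (by omega)
    rw [show M.chainLength R d - 1 - k = k by omega] at h2
    exact M.edge_ne _ h2.symm

/-- The map obtained by forgetting the vertices of degree two in `R`. -/
noncomputable def smooth (h : M.Smoothable R) : CombMap (Rᶜ : Set D) where
  edge := Function.Involutive.toPerm (fun d => ⟨M.chainEdge R d, h.chainEdge_not_mem d⟩)
    fun d => Subtype.ext (h.chainEdge_chainEdge d.2)
  face := (Function.Involutive.toPerm (fun d : (Rᶜ : Set D) =>
      (⟨M.chainEdge R d, h.chainEdge_not_mem d⟩ : (Rᶜ : Set D)))
    fun d => Subtype.ext (h.chainEdge_chainEdge d.2)).trans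
      (M.vert.subtypePerm fun _ => not_congr h.vert_mem_iff)
  edge_edge d := Subtype.ext (h.chainEdge_chainEdge d.2)
  edge_ne d hd := h.chainEdge_ne d (congrArg Subtype.val hd)

theorem coe_smooth_edge (h : M.Smoothable R) (d : (Rᶜ : Set D)) : (h.smooth.edge d : D) = M.chainEdge R d := rfl

theorem coe_smooth_face (h : M.Smoothable R) (d : (Rᶜ : Set D)) :
    (h.smooth.face d : D) = M.face^[M.chainLength R d] d := by
  rw [← h.vert_chainEdge]; rfl

theorem coe_smooth_vert (h : M.Smoothable R) (d : (Rᶜ : Set D)) : (h.smooth.vert d : D) = M.vert d := by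
  change M.vert (M.chainEdge R (M.chainEdge R d)) = _
  rw [h.chainEdge_chainEdge d.2]

/-- Together with `chain_unique` this says that the chains partition the darts, so a dart is given
by a dart outside `R` and a position. -/
theorem exists_chain [Finite D] (h : M.Smoothable R) (x : D) : ∃ d : (Rᶜ : Set D), ∃ i < M.chainLength R d, M.face^[i] d = x := by
  obtain ⟨n, hn⟩ := h.exists_not_mem x
  have h1 : M.face.SameCycle (M.face^[n] x) x := by
    rw [Perm.iterate_eq_pow]
    exact Perm.sameCycle_pow_left.2 (Perm.SameCycle.refl _ _)
  obtain ⟨m, hm⟩ := h1.exists_nat_pow_eq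
  rw [← Perm.iterate_eq_pow] at hm
  generalize M.face^[n] x = y at hn hm
  clear h1
  induction m using Nat.strong_induction_on generalizing y with | _ m ih
  rcases Nat.lt_or_ge m (M.chainLength R y) with h2 | h2
  · exact ⟨⟨y, hn⟩, m, h2, hm⟩
  · obtain ⟨h3, h4⟩ := h.chainLength_spec y
    refine ih (m - M.chainLength R y) (by omega) _ h4 ?_
    rw [← Function.iterate_add_apply, Nat.sub_add_cancel h2, hm]

theorem chain_unique {d d' : (Rᶜ : Set D)} {i j : ℕ} (hi : i < M.chainLength R d)
    (hj : j < M.chainLength R d') (hij : M.face^[i] d = M.face^[j] d') : d = d' ∧ i = j := by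
  have key : ∀ (d d' : (Rᶜ : Set D)) (i j : ℕ), i ≤ j → j < M.chainLength R d' →
      M.face^[i] (d : D) = M.face^[j] d' → d = d' ∧ i = j := by
    intro d d' i j h1 h2 h3
    rw [← Nat.add_sub_cancel' h1, Function.iterate_add_apply] at h3
    have h4 := (M.face.injective.iterate i) h3
    rcases Nat.eq_zero_or_pos (j - i) with h5 | h5
    · rw [h5] at h4
      exact ⟨Subtype.ext h4, by omega⟩
    · exact absurd (h4 ▸ mem_of_lt_chainLength h5 (by omega)) d.2
  rcases le_total i j with h1 | h1
  · exact key d d' i j h1 hj hij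
  · have := key d' d j i h1 hi hij.symm
    exact ⟨this.1.symm, this.2.symm⟩

theorem sameCycle_smooth_face [Finite D] (h : M.Smoothable R) {x y : (Rᶜ : Set D)} :
    h.smooth.face.SameCycle x y ↔ M.face.SameCycle (x : D) y := by
  constructor
  · intro h1
    refine SameCycle.induction (p := fun y : (Rᶜ : Set D) => M.face.SameCycle (x : D) y) ?_
      (Perm.SameCycle.refl _ _) h1
    intro z hz
    rw [h.coe_smooth_face, Perm.iterate_eq_pow]
    exact Perm.sameCycle_pow_right.2 hz
  · intro h1
    obtain ⟨m, hm⟩ := h1.exists_nat_pow_eq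
    rw [← Perm.iterate_eq_pow] at hm
    clear h1
    induction m using Nat.strong_induction_on generalizing x with | _ m ih
    obtain ⟨h3, h4⟩ := h.chainLength_spec x
    rcases Nat.lt_or_ge m (M.chainLength R x) with h2 | h2
    · rcases Nat.eq_zero_or_pos m with h5 | h5
      · subst h5
        rw [Subtype.ext hm]
      · exact absurd (hm ▸ mem_of_lt_chainLength h5 h2) y.2
    · refine Perm.sameCycle_apply_left.1 (ih (m - M.chainLength R x) (by omega) ?_)
      rw [h.coe_smooth_face, ← Function.iterate_add_apply, Nat.sub_add_cancel h2, hm]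

theorem edge_iterate (h : M.Smoothable R) {d : (Rᶜ : Set D)} {i : ℕ} (hi : i < M.chainLength R d) :
    M.edge (M.face^[i] (d : D)) = M.face^[M.chainLength R d - 1 - i] (h.smooth.edge d : D) := by
  rw [h.coe_smooth_edge, h.iterate_chainEdge (by omega)]
  congr 2
  omega

theorem smooth_connected [Finite D] (h : M.Smoothable R) (hM : M.Connected) : h.smooth.Connected := by
  obtain ⟨⟨x₀⟩, hc⟩ := hM
  obtain ⟨d₀, -⟩ := h.exists_chain x₀
  refine ⟨⟨d₀⟩, ?_⟩
  set r := fun a b => b = h.smooth.edge a ∨ b = h.smooth.face a with hr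
  choose c i hi hci using h.exists_chain
  have hface : ∀ x, Relation.EqvGen r (c x) (c (M.face x)) := by
    intro x
    have h1 : M.face x = M.face^[i x + 1] (c x) := by
      rw [Function.iterate_succ_apply', hci]
    rcases Nat.lt_or_ge (i x + 1) (M.chainLength R (c x)) with h2 | h2
    · rw [(chain_unique h2 (hi (M.face x)) (by rw [hci, h1])).1]
      exact Relation.EqvGen.refl _
    · have h3 := hi x
      rw [show i x + 1 = M.chainLength R (c x) by omega, ← h.coe_smooth_face] at h1
      have h4 := (chain_unique (i := 0) (h.chainLength_spec (h.smooth.face (c x) : D)).1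
        (hi (M.face x)) (by rw [hci, h1]; rfl)).1
      exact Relation.EqvGen.rel _ _ (Or.inr h4.symm)
  have hedge : ∀ x, Relation.EqvGen r (c x) (c (M.edge x)) := by
    intro x
    have h1 := h.edge_iterate (hi x)
    rw [hci] at h1
    have h3 := hi x
    have h4 := (chain_unique (d := h.smooth.edge (c x)) (i := M.chainLength R (c x) - 1 - i x)
      (by rw [h.coe_smooth_edge, h.chainLength_chainEdge (c x).2]; omega) (hi (M.edge x))
      (by rw [hci, h1])).1
    exact Relation.EqvGen.rel _ _ (Or.inl h4.symm)
  have hall : ∀ x y, Relation.EqvGen r (c x) (c y) := by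
    intro x y
    induction hc x y with
    | rel x y h1 =>
      rcases h1 with rfl | rfl
      · exact hedge x
      · exact hface x
    | refl x => exact Relation.EqvGen.refl _
    | symm x y _ ih => exact Relation.EqvGen.symm _ _ ih
    | trans x y z _ _ ih ih' => exact Relation.EqvGen.trans _ _ _ ih ih'
  have hcd : ∀ d : (Rᶜ : Set D), c d = d := fun d =>
    ((chain_unique (i := 0) (h.chainLength_spec (d : D)).1 (hi d) (by rw [hci]; rfl)).1).symm
  intro d d'
  have := hall d d'
  rwa [hcd, hcd] at this

/-- Forgetting a vertex removes its two darts, that is, one edge and one vertex; the faces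
correspond because no face lies in `R`. -/
theorem smooth_eulerChar [Finite D] (h : M.Smoothable R) : h.smooth.eulerChar = M.eulerChar := by
  have hM : M.eulerChar = (numCycles M.vert : ℤ) - numCycles M.edge + numCycles M.face := rfl
  have hS : h.smooth.eulerChar = (numCycles h.smooth.vert : ℤ) - numCycles h.smooth.edge +
    numCycles h.smooth.face := rfl
  have hf : numCycles h.smooth.face = numCycles M.face := by
    rw [numCycles, numCycles, ← innerCard_univ (cyc M.face)]
    refine card_quotient_subtype (fun x y => h.sameCycle_smooth_face) (fun _ _ _ _ => trivial)
      (Set.subset_univ _) fun x _ => ?_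
    obtain ⟨n, hn⟩ := h.exists_not_mem x
    refine ⟨_, hn, ?_⟩
    rw [Perm.iterate_eq_pow]
    exact Perm.sameCycle_pow_right.2 (Perm.SameCycle.refl _ _)
  have hsat : Saturated (cyc M.vert) Rᶜ :=
    saturated_cyc fun x hx hx' => hx (h.vert_mem_iff.1 hx')
  have hv : numCycles h.smooth.vert = innerCard (cyc M.vert) Rᶜ := by
    rw [numCycles]
    refine card_quotient_subtype (fun x y => ⟨fun h1 => ?_, fun h1 => ?_⟩) hsat subset_rfl
      fun x hx => ⟨x, hx, Setoid.refl' _ _⟩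
    · refine SameCycle.induction (p := fun y : (Rᶜ : Set D) => cyc M.vert (x : D) y) ?_ (Setoid.refl' _ _) h1
      intro z hz
      rw [h.coe_smooth_vert]
      exact Setoid.trans' _ hz (cyc_apply _ _)
    · have h2 := SameCycle.induction (p := fun y => ∃ hy : y ∈ Rᶜ, cyc h.smooth.vert x ⟨y, hy⟩) ?_
        ⟨x.2, Setoid.refl' _ _⟩ h1
      · exact h2.2
      · rintro z ⟨hz, h3⟩
        refine ⟨hsat _ _ (cyc_apply _ _) hz, Setoid.trans' _ h3 ?_⟩
        have h4 : h.smooth.vert ⟨z, hz⟩ = ⟨M.vert z, hsat _ _ (cyc_apply _ _) hz⟩ :=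
          Subtype.ext (h.coe_smooth_vert _)
        rw [← h4]
        exact cyc_apply _ _
  have hv' : numCycles M.vert = innerCard (cyc M.vert) Rᶜ + innerCard (cyc M.vert) R := by
    rw [numCycles, ← innerCard_univ, ← Set.compl_union_self R,
      innerCard_union hsat disjoint_compl_left]
  have h1 := two_mul_innerCard_involution h.vert_mem h.vert_vert h.vert_ne
  have h2 := M.two_mul_numCycles_edge
  have h3 := h.smooth.two_mul_numCycles_edge
  have h4 := Set.ncard_add_ncard_compl R
  rw [Nat.card_coe_set_eq] at h3
  rw [hS, hM, hf, hv, hv']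
  push_cast
  omega

end Smoothable

/-- A map can be recovered from a smoothed one and the lengths of the chains. -/
theorem Smoothable.exists_equiv {D' : Type} [Finite D] [Finite D'] {M' : CombMap D'} {R' : Set D'}
    (h : M.Smoothable R) (h' : M'.Smoothable R') (ψ : (Rᶜ : Set D) ≃ (R'ᶜ : Set D'))
    (hedge : ∀ d, ψ (h.smooth.edge d) = h'.smooth.edge (ψ d))
    (hface : ∀ d, ψ (h.smooth.face d) = h'.smooth.face (ψ d))
    (hlen : ∀ d, M'.chainLength R' (ψ d : D') = M.chainLength R (d : D)) :
    ∃ Ψ : D ≃ D', (∀ x, Ψ (M.edge x) = M'.edge (Ψ x)) ∧ (∀ x, Ψ (M.face x) = M'.face (Ψ x)) ∧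
      ∀ d : (Rᶜ : Set D), Ψ d = ψ d := by
  choose c i hi hci using h.exists_chain
  set F : D → D' := fun x => M'.face^[i x] (ψ (c x)) with hF
  have key : ∀ (d : (Rᶜ : Set D)) (j : ℕ), j < M.chainLength R d →
      F (M.face^[j] d) = M'.face^[j] (ψ d) := by
    intro d j hj
    obtain ⟨h1, h2⟩ := Smoothable.chain_unique hj (hi (M.face^[j] d)) (hci _).symm
    simp only [hF]
    rw [← h1, ← h2]
  have keyK : ∀ d : (Rᶜ : Set D), F d = ψ d := fun d =>
    key d 0 (h.chainLength_spec (d : D)).1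
  have Ff : ∀ x, F (M.face x) = M'.face (F x) := by
    intro x
    obtain ⟨d, j, hj, rfl⟩ := h.exists_chain x
    rw [← Function.iterate_succ_apply' M.face, key d j hj,
      ← Function.iterate_succ_apply' M'.face]
    rcases Nat.lt_or_ge (j + 1) (M.chainLength R d) with h2 | h2
    · exact key d _ h2
    · have h3 : j + 1 = M.chainLength R d := by omega
      rw [Nat.succ_eq_add_one, h3, ← h.coe_smooth_face, keyK, hface, h'.coe_smooth_face, hlen]
  have Fe : ∀ x, F (M.edge x) = M'.edge (F x) := by
    intro x
    obtain ⟨d, j, hj, rfl⟩ := h.exists_chain x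
    rw [h.edge_iterate hj, key d j hj, h'.edge_iterate (by rw [hlen]; exact hj), key _ _ ?_, hedge,
      hlen]
    rw [h.coe_smooth_edge, h.chainLength_chainEdge d.2]
    omega
  have hbij : Function.Bijective F := by
    constructor
    · intro x y hxy
      obtain ⟨d, j, hj, rfl⟩ := h.exists_chain x
      obtain ⟨d', j', hj', rfl⟩ := h.exists_chain y
      rw [key d j hj, key d' j' hj'] at hxy
      obtain ⟨h1, h2⟩ := Smoothable.chain_unique (by rw [hlen]; exact hj) (by rw [hlen]; exact hj') hxy
      rw [ψ.injective h1, h2]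
    · intro y
      obtain ⟨d, j, hj, rfl⟩ := h'.exists_chain y
      refine ⟨M.face^[j] (ψ.symm d : D), ?_⟩
      rw [key _ j ?_, ψ.apply_symm_apply]
      rw [← hlen, ψ.apply_symm_apply]
      exact hj
  exact ⟨Equiv.ofBijective F hbij, Fe, Ff, keyK⟩

end CombMap

end Smoothing

/-! ### Parallel strands and bridges -/

section Strands

open scoped Classical

namespace CombMap

variable {D : Type} {M : CombMap D}

theorem connOn_of_face {A : Set D} [Finite D] {x y : D} (h : M.face.SameCycle x y)
    (hA : ∀ z, M.face.SameCycle x z → M.Active A z) : M.connOn A x y := by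
  refine (SameCycle.induction (p := fun z => M.face.SameCycle x z ∧ M.connOn A x z) ?_
    ⟨Perm.SameCycle.refl _ _, Setoid.refl' _ _⟩ h).2
  rintro z ⟨h1, h2⟩
  refine ⟨Perm.sameCycle_apply_right.2 h1, Setoid.trans' _ h2 ?_⟩
  have := connOn_faceOn (M := M) (A := A) z
  rwa [faceOn_of_active (hA z h1)] at this

theorem connOn_diff_edge (A : Set D) (d : D) : M.connOn (A \ {M.edge d}) = M.connOn (A \ {d}) := by
  rw [connOn, connOn, edgeOn_congr]
  intro x
  rw [active_diff_iff, active_diff_iff, M.edge_edge]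
  tauto

theorem face_edge_face {z : D} (h : M.vert (M.vert (M.face z)) = M.face z) :
    M.face (M.edge (M.face z)) = M.edge z := by
  rw [← M.vert_edge] at h
  have := M.vert.injective h
  rwa [M.vert_edge, M.vert_apply] at this

/-- Deleting two edges with the same pair of distinct faces. -/
theorem sameCycle_faceOn_pair [Finite D] {d₁ d₂ : D} (hne : d₁ ≠ d₂) (h : M.face.SameCycle d₁ d₂)
    (h1 : ¬ M.face.SameCycle d₁ (M.edge d₁)) (h2 : ¬ M.face.SameCycle d₁ (M.edge d₂)) :
    (M.faceOn {d₁, d₂}ᶜ).SameCycle (M.edge d₁) d₂ := by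
  obtain ⟨k, hk, hk'⟩ := exists_first_visit hne h
  have hcyc : ∀ i : ℕ, M.face.SameCycle d₁ (M.face^[i] d₁) := fun i => by
    rw [Perm.iterate_eq_pow]
    exact Perm.sameCycle_pow_right.2 (Perm.SameCycle.refl _ _)
  have key : ∀ i ≤ k, (M.faceOn {d₁, d₂}ᶜ).SameCycle (M.edge d₁) (M.face^[i + 1] d₁) := by
    intro i hi
    induction i with
    | zero =>
      have h3 := cyc_apply (M.faceOn {d₁, d₂}ᶜ) (M.edge d₁)
      rwa [faceOn_of_not_active, M.vert_edge] at h3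
      rintro ⟨-, h4⟩
      rw [M.edge_edge] at h4
      exact h4 (Or.inl rfl)
    | succ i ih =>
      rw [Function.iterate_succ_apply', ← faceOn_of_active (A := {d₁, d₂}ᶜ)]
      · exact Perm.sameCycle_apply_right.2 (ih (by omega))
      · constructor
        · rintro (h3 | h3)
          · exact (hk' i (by omega)).2 h3
          · exact (hk' i (by omega)).1 h3
        · rintro (h3 | h3)
          · refine h1 ?_
            have h4 := hcyc (i + 1)
            rwa [← M.edge_edge (M.face^[i + 1] d₁), h3] at h4
          · refine h2 ?_
            have h4 := hcyc (i + 1)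
            rwa [← M.edge_edge (M.face^[i + 1] d₁), h3] at h4
  have := key k le_rfl
  rwa [hk] at this

theorem compl_pair (d₁ d₂ : D) : ({d₁, d₂}ᶜ : Set D) = (Set.univ \ {d₁}) \ {d₂} := by
  ext x; simp [not_or]

end CombMap

namespace CombPants

variable {P : CombPants}

variable (P) in
/-- The `k`-th hole is on the left of `d`. -/
def IsHole (k : Fin 3) (d : P.Dart) : Prop := P.map.face.SameCycle (P.base k) d

theorem exists_third : ∀ a b : Fin 3, ∃ c, c ≠ a ∧ c ≠ b := by decide

theorem isBdry_iff {d : P.Dart} : P.IsBdry d ↔ ∃ k, P.IsHole k d :=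
  exists_congr fun _ => ⟨fun h => (CombMap.faceOf_eq_iff.1 h).symm,
    fun h => CombMap.faceOf_eq_iff.2 (Perm.SameCycle.symm h)⟩

theorem IsHole.isBdry {k : Fin 3} {d : P.Dart} (h : P.IsHole k d) : P.IsBdry d :=
  isBdry_iff.2 ⟨k, h⟩

theorem IsHole.unique {k l : Fin 3} {d : P.Dart} (h : P.IsHole k d) (h' : P.IsHole l d) : k = l :=
  P.base_injective (CombMap.faceOf_eq_iff.2 (h.trans h'.symm))

theorem isHole_base (k : Fin 3) : P.IsHole k (P.base k) := Perm.SameCycle.refl _ _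

/-- Holes that are not adjacent to the deleted edges. -/
theorem IsHole.connOn {k : Fin 3} {x y : P.Dart} (hx : P.IsHole k x) (hy : P.IsHole k y)
    {A : Set P.Dart} (hA : ∀ z, P.IsHole k z → P.map.Active A z) : P.map.connOn A x y :=
  CombMap.connOn_of_face (hx.symm.trans hy) fun z hz => hA z (hx.trans hz)

theorem active_diff_of_isHole {k : Fin 3} {d z : P.Dart} (h : ¬ P.IsHole k d)
    (h' : ¬ P.IsHole k (P.map.edge d)) (hz : P.IsHole k z) :
    P.map.Active (Set.univ \ {d}) z := by
  rw [CombMap.active_diff_iff]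
  refine ⟨⟨trivial, trivial⟩, ?_, ?_⟩ <;> rintro rfl
  · exact h hz
  · exact h' hz

theorem connOn_or (d x : P.Dart) :
    P.map.connOn (Set.univ \ {d}) x d ∨ P.map.connOn (Set.univ \ {d}) x (P.map.edge d) := by
  rcases CombMap.connOn_diff (d := d) (P.connected.connOn_univ x d) with h | h
  · exact Or.inl h
  · exact h.1

theorem not_connOn_of_isHole {a : Fin 3} {d : P.Dart} (h : P.IsHole a d)
    (h' : P.IsHole a (P.map.edge d)) :
    ¬ P.map.connOn (Set.univ \ {d}) d (P.map.edge d) := by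
  rw [P.isSpherical.jordan (A := Set.univ) ⟨trivial, trivial⟩, not_not, CombMap.faceOn_univ]
  exact h.symm.trans h'

/-- There is another hole on each side of a bridge. -/
theorem Geodesic.exists_other_hole (hP : P.Geodesic) {a : Fin 3} {d : P.Dart} (h : P.IsHole a d)
    (h' : P.IsHole a (P.map.edge d)) :
    ∃ k, k ≠ a ∧ ∃ x, P.IsHole k x ∧
      P.map.connOn (Set.univ \ {d}) (P.map.edge d) x := by
  -- Otherwise the part behind the bridge is simply connected. The boundary walk from `d` to `edge
  -- d` is then a closed geodesic, hence empty, and the curve runs along `d` and straight back,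
  -- which a backtrack shortens.
  by_contra hcon
  push Not at hcon
  set A : Set P.Dart := Set.univ \ {d} with hA
  have hbr := not_connOn_of_isHole h h'
  have hact : ∀ x, P.map.Active A x ↔ x ≠ d ∧ x ≠ P.map.edge d := fun x => by
    rw [hA, CombMap.active_diff_iff]
    exact and_iff_right ⟨trivial, trivial⟩
  have hfill : Filled A (P.map.edge d) := by
    refine ⟨fun x hx => (hact x).2 ⟨?_, ?_⟩, fun x hx hc => ?_⟩
    · rintro rfl; exact hx h.isBdry
    · rintro rfl; exact hx h'.isBdry
    · obtain ⟨k, hk⟩ := isBdry_iff.1 hx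
      have hka : k = a := by
        by_contra hne
        exact hcon k hne x hk hc
      subst hka
      have h1 : (P.map.faceOn Set.univ).SameCycle (P.map.edge d) x := by
        rw [CombMap.faceOn_univ]; exact h'.symm.trans hk
      rcases CombMap.sameCycle_faceOn_diff (d := d) h1 with h2 | ⟨-, h2 | h2⟩
      · exact h2
      · exact absurd (Setoid.symm' _ (Setoid.trans' _ hc (CombMap.connOn_of_sameCycle h2))) hbr
      · exact h2.symm
  obtain ⟨n, hn, hn'⟩ := exists_first_visit (P.map.edge_ne d).symm (h.symm.trans h')
  have hact' : ∀ i < n, P.map.Active A (P.map.face^[i] (P.map.face d)) := fun i hi => by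
    rw [← Function.iterate_succ_apply]
    exact (hact _).2 ⟨(hn' i hi).2, (hn' i hi).1⟩
  have hconn : ∀ i ≤ n, P.map.connOn A (P.map.edge d) (P.map.face^[i] (P.map.face d)) := by
    intro i hi
    induction i with
    | zero =>
      have h3 := CombMap.connOn_vert (M := P.map) (A := A) (P.map.edge d)
      rwa [CombMap.vert_edge] at h3
    | succ i ih =>
      refine Setoid.trans' _ (ih (by omega)) ?_
      rw [Function.iterate_succ_apply', ← CombMap.faceOn_of_active (hact' i (by omega))]
      exact CombMap.connOn_faceOn _
  have hper : ∀ x, 0 < Function.minimalPeriod P.map.face x := fun x =>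
    Function.minimalPeriod_pos_of_mem_periodicPts ⟨orderOf P.map.face, orderOf_pos _, by
      rw [Function.IsPeriodicPt, Function.IsFixedPt, Perm.iterate_eq_pow, pow_orderOf_eq_one]
      rfl⟩
  have hle : n ≤ Function.minimalPeriod P.map.face (P.map.face d) := by
    by_contra hlt
    have hp := hper (P.map.face d)
    refine (hn' (n - Function.minimalPeriod P.map.face (P.map.face d)) (by omega)).1 ?_
    rw [← hn, Function.iterate_succ_apply, Function.iterate_succ_apply]
    conv_rhs => rw [← Nat.sub_add_cancel (Nat.le_of_not_le hlt), Function.iterate_add_apply,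
      Function.iterate_minimalPeriod]
  have h0 := (hP.of_filled hfill).1 (P.map.face d) n (isBdry_face.2 h.isBdry) hle
    (fun i hi => ⟨hact' i hi, hconn i hi.le⟩)
    (by rw [← Function.iterate_succ_apply, hn, CombMap.vertexOf_edge])
  subst h0
  have hfd : P.map.face d = P.map.edge d := hn
  have hv : P.map.vertexOf (P.map.face^[2] d) = P.map.vertexOf d := by
    change P.map.vertexOf (P.map.face (P.map.face d)) = _
    rw [hfd, ← CombMap.vertexOf_edge, P.map.edge_edge]
  have h2 : 2 ≤ Function.minimalPeriod P.map.face d := by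
    by_contra hlt
    have hp := hper d
    have h3 : Function.minimalPeriod P.map.face d = 1 := by omega
    have h4 := Function.iterate_minimalPeriod (f := P.map.face) (x := d)
    rw [h3, Function.iterate_one, hfd] at h4
    exact P.map.edge_ne d h4
  have h5 := hP d 2 [] h.isBdry h2 (Relation.EqvGen.rel _ _
    ⟨CombMap.isPath_iterate d 2, hv.symm, by
      have := CombMap.PathStep.backtrack (M := P.map) (F := fun d => ¬ P.IsBdry d) [] [] d
      simpa [List.iterate, hfd] using this⟩)
  simp at h5

variable (P) in
/-- The bridge `d` separates the holes `b` and `c`, with `b` on the side of its source. -/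
def Sep (d : P.Dart) (b c : Fin 3) : Prop :=
  P.map.connOn (Set.univ \ {d}) d (P.base b) ∧
    P.map.connOn (Set.univ \ {d}) (P.map.edge d) (P.base c)

theorem Sep.edge {d : P.Dart} {b c : Fin 3} (h : P.Sep d b c) : P.Sep (P.map.edge d) c b := by
  rw [Sep, CombMap.connOn_diff_edge, P.map.edge_edge]
  exact ⟨h.2, h.1⟩

/-- Each side of the bridge contains one of the two other holes, and they cannot be the same hole.
-/
theorem Geodesic.sep_or (hP : P.Geodesic) {a b c : Fin 3} (hab : a ≠ b) (hac : a ≠ c) (hbc : b ≠ c)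
    {d : P.Dart} (h : P.IsHole a d) (h' : P.IsHole a (P.map.edge d)) :
    P.Sep d b c ∨ P.Sep d c b := by
  have hbr := not_connOn_of_isHole h h'
  have key : ∀ d, P.IsHole a d → P.IsHole a (P.map.edge d) →
      P.map.connOn (Set.univ \ {d}) (P.map.edge d) (P.base b) ∨
        P.map.connOn (Set.univ \ {d}) (P.map.edge d) (P.base c) := by
    intro d h h'
    obtain ⟨k, hk, x, hx, hc⟩ := hP.exists_other_hole h h'
    have hcb : P.map.connOn (Set.univ \ {d}) (P.map.edge d) (P.base k) :=
      Setoid.trans' _ hc (hx.connOn (isHole_base k) fun z hz =>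
        active_diff_of_isHole (fun h1 => hk (h1.unique h)) (fun h1 => hk (h1.unique h')) hz)
    have : k = b ∨ k = c := by omega
    rcases this with rfl | rfl
    · exact Or.inl hcb
    · exact Or.inr hcb
  have key' := key (P.map.edge d) h' (by rwa [P.map.edge_edge])
  rw [CombMap.connOn_diff_edge, P.map.edge_edge] at key'
  rcases key d h h' with h1 | h1 <;> rcases key' with h2 | h2
  · exact absurd (Setoid.trans' _ h2 (Setoid.symm' _ h1)) hbr
  · exact Or.inr ⟨h2, h1⟩
  · exact Or.inl ⟨h2, h1⟩
  · exact absurd (Setoid.trans' _ h2 (Setoid.symm' _ h1)) hbr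

variable (P) in
/-- The darts at the vertices in the interior of strands. -/
def links : Set P.Dart :=
  {d | P.IsPointComponent d ∧ P.map.vert (P.map.vert d) = d ∧ P.map.vert d ≠ d}

/-- The sides of the bigon coincide, so at the source of `d₂` there are only the edge `d₂` and the
last edge of the collapsed bigon (or `edge d₁`, if its length is zero): the vertex lies inside a
strand. -/
theorem Geodesic.mem_links_of_bigon (hP : P.Geodesic) (hT : P.Tight) {d₁ d₂ : P.Dart}
    (s₁ : P.IsPointComponent d₁) (s₂ : P.IsPointComponent d₂) (hne : d₂ ≠ P.map.edge d₁)
    (hconn : P.map.connOn {d₁, d₂}ᶜ (P.map.edge d₁) d₂)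
    (hb : ∀ x, P.IsBdry x → P.map.connOn {d₁, d₂}ᶜ (P.map.edge d₁) x →
      (P.map.faceOn {d₁, d₂}ᶜ).SameCycle (P.map.edge d₁) x)
    (h1 : ¬ P.map.connOn {d₁, d₂}ᶜ (P.map.edge d₁) d₁)
    (h2 : ¬ P.map.connOn {d₁, d₂}ᶜ (P.map.edge d₁) (P.map.edge d₂)) : d₂ ∈ P.links := by
  obtain ⟨m, B, hp, hq⟩ := hP.exists_bigon s₁ s₂ hne hconn hb h1 h2
  have hpm : (fun i => P.map.face^[i] (P.map.face d₁)) m = d₂ := hp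
  have hq0 : (fun i => P.map.face^[m - i] (P.map.face (P.map.edge d₂))) 0 = P.map.edge d₁ := hq
  generalize (fun i => P.map.face^[i] (P.map.face d₁)) = p at *
  generalize (fun i => P.map.face^[m - i] (P.map.face (P.map.edge d₂))) = q at *
  have hv := B.vert_q
  rw [hpm] at hv
  refine ⟨s₂, ?_, ?_⟩
  · rw [hv]
    rcases m with _ | m
    · rw [B.vert_p, hpm]
    · have h3 := B.edge_eq hT (Nat.lt_succ_self m)
      rw [← h3, CombMap.vert_edge, B.face_p m (Nat.lt_succ_self m), hpm]
  · rw [hv, ← hpm]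
    exact (B.ne m le_rfl m le_rfl).symm

/-- At most one of two strands between the same pair of different holes ends at a vertex of higher
degree. -/
theorem Geodesic.mem_links_of_ne (hP : P.Geodesic) (hT : P.Tight) {a b : Fin 3} (hab : a ≠ b)
    {d₁ d₂ : P.Dart} (a₁ : P.IsHole a d₁) (a₂ : P.IsHole a d₂) (b₁ : P.IsHole b (P.map.edge d₁))
    (b₂ : P.IsHole b (P.map.edge d₂)) (hne : d₁ ≠ d₂) : d₁ ∈ P.links ∨ d₂ ∈ P.links := by
  have nab : ∀ {x}, P.IsHole a x → ¬ P.IsHole b x := fun h h' => hab (h.unique h')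
  have npair : ∀ x y, P.IsHole a x → P.IsHole b y → ¬ P.map.face.SameCycle x y :=
    fun x y hx hy h => nab (hx.trans h) hy
  have e12 : (P.map.faceOn {d₁, d₂}ᶜ).SameCycle (P.map.edge d₁) d₂ :=
    CombMap.sameCycle_faceOn_pair hne (a₁.symm.trans a₂) (npair _ _ a₁ b₁) (npair _ _ a₁ b₂)
  have e21 : (P.map.faceOn {d₁, d₂}ᶜ).SameCycle (P.map.edge d₂) d₁ := by
    rw [Set.pair_comm]
    exact CombMap.sameCycle_faceOn_pair hne.symm (a₂.symm.trans a₁) (npair _ _ a₂ b₂)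
      (npair _ _ a₂ b₁)
  -- Deleting `d₁` merges the holes `a` and `b`, so that `d₂` becomes a bridge. The third hole lies
  -- in at most one of the two parts left when both are deleted; the other part is a bigon.
  set U : Set P.Dart := Set.univ \ {d₁} with hU
  have hUd : P.map.Active U d₂ := by
    rw [hU, CombMap.active_diff_iff]
    refine ⟨⟨trivial, trivial⟩, hne.symm, ?_⟩
    rintro rfl
    exact nab a₂ b₁
  have m1 : (P.map.faceOn U).SameCycle d₁ (P.map.edge d₁) := by
    rw [hU, CombMap.faceOn, CombMap.edgeOn_diff _ (⟨trivial, trivial⟩ : P.map.Active Set.univ d₁),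
      CombMap.edgeOn_univ, ← mul_assoc, CombMap.vert_mul_edge]
    exact sameCycle_mul_swap (npair _ _ a₁ b₁)
  have mU : ∀ x, (P.IsHole a x ∨ P.IsHole b x) → (P.map.faceOn U).SameCycle d₁ x := by
    have key : ∀ x y, P.map.face.SameCycle x y → (P.map.faceOn U).SameCycle d₁ x →
        (P.map.faceOn U).SameCycle d₁ y := by
      intro x y hxy hx
      rw [← CombMap.faceOn_univ] at hxy
      rcases CombMap.sameCycle_faceOn_diff (d := d₁) hxy with h | ⟨-, h | h⟩
      · exact hx.trans h
      · exact h.symm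
      · exact m1.trans h.symm
    rintro x (hx | hx)
    · exact key d₁ x (a₁.symm.trans hx) (Perm.SameCycle.refl _ _)
    · exact key (P.map.edge d₁) x (b₁.symm.trans hx) m1
  have hsep : ¬ P.map.connOn {d₁, d₂}ᶜ d₂ (P.map.edge d₂) := by
    rw [CombMap.compl_pair, P.isSpherical.jordan hUd, not_not]
    exact (mU _ (Or.inl a₂)).symm.trans (mU _ (Or.inr b₂))
  have c12 := CombMap.connOn_of_sameCycle e12
  have c21 := CombMap.connOn_of_sameCycle e21
  have mA : ∀ x, (P.IsHole a x ∨ P.IsHole b x) → (P.map.faceOn {d₁, d₂}ᶜ).SameCycle x d₂ ∨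
      (P.map.faceOn {d₁, d₂}ᶜ).SameCycle x (P.map.edge d₂) := by
    intro x hx
    rw [CombMap.compl_pair]
    rcases CombMap.sameCycle_faceOn_diff (d := d₂) ((mU x hx).symm.trans (mU d₂ (Or.inl a₂)))
      with h | h
    · exact Or.inl h
    · exact h.1
  obtain ⟨c, hca, hcb⟩ : ∃ c : Fin 3, c ≠ a ∧ c ≠ b := exists_third a b
  have holes : ∀ x, P.IsBdry x → (P.IsHole a x ∨ P.IsHole b x) ∨ P.IsHole c x := by
    intro x hx
    obtain ⟨k, hk⟩ := isBdry_iff.1 hx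
    have : k = a ∨ k = b ∨ k = c := by omega
    rcases this with rfl | rfl | rfl
    · exact Or.inl (Or.inl hk)
    · exact Or.inl (Or.inr hk)
    · exact Or.inr hk
  have hc : ∀ x, P.IsHole c x → P.map.connOn {d₁, d₂}ᶜ x (P.base c) := fun x hx =>
    hx.connOn (isHole_base c) fun z hz => by
      constructor
      · rintro (rfl | rfl)
        · exact hca (hz.unique a₁)
        · exact hca (hz.unique a₂)
      · rintro (h | h)
        · rw [← h, P.map.edge_edge] at b₁
          exact hcb (hz.unique b₁)
        · rw [← Set.mem_singleton_iff.1 h, P.map.edge_edge] at b₂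
          exact hcb (hz.unique b₂)
  by_cases hcc : P.map.connOn {d₁, d₂}ᶜ (P.map.edge d₁) (P.base c)
  · left
    have hpc : ({d₂, d₁} : Set P.Dart) = {d₁, d₂} := Set.pair_comm _ _
    refine hP.mem_links_of_bigon hT ⟨a₂.isBdry, b₂.isBdry⟩ ⟨a₁.isBdry, b₁.isBdry⟩
      (fun h => nab a₁ (h ▸ b₂)) ?_ ?_ ?_ ?_ <;> rw [hpc]
    · exact c21
    · intro x hx hx'
      rcases holes x hx with h | h
      · rcases mA x h with h1 | h1
        · exact absurd (Setoid.trans' _ (Setoid.symm' _ (CombMap.connOn_of_sameCycle h1))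
            (Setoid.symm' _ hx')) hsep
        · exact h1.symm
      · exact absurd (Setoid.trans' _ (Setoid.symm' _ c12) (Setoid.trans' _ hcc
          (Setoid.trans' _ (Setoid.symm' _ (hc x h)) (Setoid.symm' _ hx')))) hsep
    · exact fun h => hsep (Setoid.symm' _ h)
    · exact fun h => hsep (Setoid.trans' _ (Setoid.symm' _ c12) (Setoid.symm' _ h))
  · right
    refine hP.mem_links_of_bigon hT ⟨a₁.isBdry, b₁.isBdry⟩ ⟨a₂.isBdry, b₂.isBdry⟩
      (fun h => nab a₂ (h ▸ b₁)) c12 ?_ ?_ ?_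
    · intro x hx hx'
      rcases holes x hx with h | h
      · rcases mA x h with h1 | h1
        · exact e12.trans h1.symm
        · exact absurd (Setoid.trans' _ (Setoid.symm' _ c12) (Setoid.trans' _ hx'
            (CombMap.connOn_of_sameCycle h1))) hsep
      · exact absurd (Setoid.trans' _ hx' (hc x h)) hcc
    · exact fun h => hsep (Setoid.trans' _ (Setoid.symm' _ c12) (Setoid.trans' _ h
        (Setoid.symm' _ c21)))
    · exact fun h => hsep (Setoid.trans' _ (Setoid.symm' _ c12) h)

/-- At most one of two parallel bridges ends at a vertex of higher degree. -/
theorem Geodesic.mem_links_of_sep (hP : P.Geodesic) (hT : P.Tight) {a b c : Fin 3} (hab : a ≠ b)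
    (hac : a ≠ c) (hbc : b ≠ c) {d₁ d₂ : P.Dart} (a₁ : P.IsHole a d₁) (a₂ : P.IsHole a d₂)
    (b₁ : P.IsHole a (P.map.edge d₁)) (b₂ : P.IsHole a (P.map.edge d₂)) (s₁ : P.Sep d₁ b c)
    (s₂ : P.Sep d₂ b c) (hne : d₁ ≠ d₂) : d₁ ∈ P.links ∨ d₂ ∈ P.links := by
  have hole : ∀ {d x k}, P.IsHole a d → P.IsHole a (P.map.edge d) → a ≠ k → P.IsHole k x →
      P.map.connOn (Set.univ \ {d}) x (P.base k) := fun h h' hk hx =>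
    hx.connOn (isHole_base _) fun z hz => active_diff_of_isHole (fun h1 => hk (h.unique h1))
      (fun h1 => hk (h'.unique h1)) hz
  have hne' : ∀ d₁ d₂, P.IsHole a d₁ → P.IsHole a (P.map.edge d₁) → P.Sep d₁ b c → P.Sep d₂ b c →
      d₂ ≠ P.map.edge d₁ := by
    rintro d₁ d₂ a₁ b₁ s₁ s₂ rfl
    exact not_connOn_of_isHole a₁ b₁ (Setoid.trans' _ s₁.1 (Setoid.symm' _ (by
      have h2 := s₂.1
      rwa [CombMap.connOn_diff_edge] at h2)))
  have act : ∀ d₁ d₂, d₁ ≠ d₂ → d₂ ≠ P.map.edge d₁ →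
      P.map.Active (Set.univ \ {d₁}) d₂ := fun d₁ d₂ h h' =>
    P.map.active_diff_iff.2 ⟨⟨trivial, trivial⟩, h.symm, h'⟩
  -- If `d₂` lies beyond `d₁`, the part between the bridges contains neither `b`, which is behind
  -- `d₁`, nor `c`, which is beyond `d₂`; so it is a bigon.
  have main : ∀ d₁ d₂, P.IsHole a d₁ → P.IsHole a d₂ → P.IsHole a (P.map.edge d₁) →
      P.IsHole a (P.map.edge d₂) → P.Sep d₁ b c → P.Sep d₂ b c → d₁ ≠ d₂ →
      P.map.connOn (Set.univ \ {d₁}) (P.map.edge d₁) d₂ → d₂ ∈ P.links := by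
    intro d₁ d₂ a₁ a₂ b₁ b₂ s₁ s₂ hne hside
    have hne₂ := hne' d₁ d₂ a₁ b₁ s₁ s₂
    set U₁ : Set P.Dart := Set.univ \ {d₁} with hU₁
    set U₂ : Set P.Dart := Set.univ \ {d₂} with hU₂
    have br₁ : ¬ P.map.connOn U₁ d₁ (P.map.edge d₁) := not_connOn_of_isHole a₁ b₁
    have br₂ : ¬ P.map.connOn U₂ d₂ (P.map.edge d₂) := not_connOn_of_isHole a₂ b₂
    have hA₁ : ({d₁, d₂}ᶜ : Set P.Dart) = U₁ \ {d₂} := CombMap.compl_pair _ _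
    have hA₂ : ({d₁, d₂}ᶜ : Set P.Dart) = U₂ \ {d₁} := by
      rw [Set.pair_comm]; exact CombMap.compl_pair _ _
    have m₁ : ∀ {x y}, P.map.connOn {d₁, d₂}ᶜ x y → P.map.connOn U₁ x y := fun h => by
      rw [hA₁] at h; exact CombMap.connOn_mono Set.sdiff_subset h
    have m₂ : ∀ {x y}, P.map.connOn {d₁, d₂}ᶜ x y → P.map.connOn U₂ x y := fun h => by
      rw [hA₂] at h; exact CombMap.connOn_mono Set.sdiff_subset h
    have h12 : P.map.connOn {d₁, d₂}ᶜ (P.map.edge d₁) d₂ := by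
      have h3 := CombMap.connOn_diff (d := d₁) s₂.1
      rw [← hU₂, ← hA₂] at h3
      rcases h3 with h3 | ⟨h3 | h3, -⟩
      · exact absurd (Setoid.trans' _ s₁.1 (Setoid.symm' _ (Setoid.trans' _ hside (m₁ h3)))) br₁
      · exact absurd (Setoid.symm' _ (Setoid.trans' _ hside (m₁ h3))) br₁
      · exact Setoid.symm' _ h3
    refine hP.mem_links_of_bigon hT ⟨a₁.isBdry, b₁.isBdry⟩ ⟨a₂.isBdry, b₂.isBdry⟩ hne₂ h12 ?_ ?_ ?_
    · intro x hx hx'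
      obtain ⟨k, hk⟩ := isBdry_iff.1 hx
      have : k = a ∨ k = b ∨ k = c := by omega
      rcases this with rfl | rfl | rfl
      · have key : ∀ x, P.IsHole k x → P.map.connOn {d₁, d₂}ᶜ (P.map.edge d₁) x →
            (P.map.faceOn U₁).SameCycle (P.map.edge d₁) x := by
          intro x hk hx'
          have h3 : (P.map.faceOn Set.univ).SameCycle x d₁ := by
            rw [CombMap.faceOn_univ]; exact hk.symm.trans a₁
          have h4 : ¬ (P.map.faceOn U₁).SameCycle x d₁ := fun h => br₁ (Setoid.symm' _
            (Setoid.trans' _ (m₁ hx') (CombMap.connOn_of_sameCycle h)))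
          rcases CombMap.sameCycle_faceOn_diff (d := d₁) h3 with h | ⟨h | h, -⟩
          · exact absurd h h4
          · exact absurd h h4
          · exact h.symm
        have key2 : ∀ x, P.IsHole k x → P.map.connOn {d₁, d₂}ᶜ (P.map.edge d₁) x →
            (P.map.faceOn {d₁, d₂}ᶜ).SameCycle x d₂ := by
          intro x hk hx'
          have h3 := (key x hk hx').symm.trans (key d₂ a₂ h12)
          have h4 : ¬ (P.map.faceOn {d₁, d₂}ᶜ).SameCycle x (P.map.edge d₂) := fun h => br₂
            (m₂ (Setoid.trans' _ (Setoid.symm' _ h12) (Setoid.trans' _ hx'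
              (CombMap.connOn_of_sameCycle h))))
          have h5 := CombMap.sameCycle_faceOn_diff (d := d₂) h3
          rw [← hA₁] at h5
          rcases h5 with h | ⟨h | h, -⟩
          · exact h
          · exact h
          · exact absurd h h4
        exact (key2 _ b₁ (Setoid.refl' _ _)).trans (key2 x hk hx').symm
      · exact absurd (Setoid.trans' _ s₁.1 (Setoid.symm' _ (Setoid.trans' _ (m₁ hx')
          (hole a₁ b₁ hab hk)))) br₁
      · exact absurd (Setoid.trans' _ (m₂ (Setoid.trans' _ (Setoid.symm' _ h12) hx'))
          (Setoid.trans' _ (hole a₂ b₂ hac hk) (Setoid.symm' _ s₂.2))) br₂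
    · exact fun h => br₁ (Setoid.symm' _ (m₁ h))
    · exact fun h => br₂ (m₂ (Setoid.trans' _ (Setoid.symm' _ h12) h))
  rcases connOn_or d₁ d₂ with h1 | h1
  swap
  · exact Or.inr (main d₁ d₂ a₁ a₂ b₁ b₂ s₁ s₂ hne (Setoid.symm' _ h1))
  rcases connOn_or d₂ d₁ with h2 | h2
  swap
  · exact Or.inl (main d₂ d₁ a₂ a₁ b₂ b₁ s₂ s₁ hne.symm (Setoid.symm' _ h2))
  -- If each bridge were on the source side of the other, `c`, which is beyond `d₂`, would be on the
  -- source side of `d₁`, against `s₁`.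
  exfalso
  have br₁ := not_connOn_of_isHole a₁ b₁
  have br₂ := not_connOn_of_isHole a₂ b₂
  have hA₁ : (Set.univ \ {d₂}) \ {d₁} ⊆ (Set.univ \ {d₁} : Set P.Dart) := fun x hx =>
    ⟨trivial, hx.2⟩
  have e1 := CombMap.connOn_edge (act d₁ d₂ hne (hne' d₁ d₂ a₁ b₁ s₁ s₂))
  rcases CombMap.connOn_diff (d := d₁) s₂.2 with h | ⟨h | h, -⟩
  · have h3 := CombMap.connOn_mono hA₁ h
    exact br₁ (Setoid.symm' _ (Setoid.trans' _ s₁.2 (Setoid.trans' _ (Setoid.symm' _ h3)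
      (Setoid.trans' _ (Setoid.symm' _ e1) h1))))
  · exact br₂ (Setoid.symm' _ (Setoid.trans' _ (CombMap.connOn_mono Set.sdiff_subset h) h2))
  · have h3 := CombMap.connOn_mono hA₁ h
    exact br₁ (Setoid.symm' _ (Setoid.trans' _ (Setoid.symm' _ h3)
      (Setoid.trans' _ (Setoid.symm' _ e1) h1)))

/-- If there is a bridge in the hole `a`, then all strands are adjacent to `a`. -/
theorem Geodesic.isHole_of_bridge (hP : P.Geodesic) {a : Fin 3} {d : P.Dart} (h : P.IsHole a d)
    (h' : P.IsHole a (P.map.edge d)) {k l : Fin 3} {y : P.Dart} (hk : P.IsHole k y)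
    (hl : P.IsHole l (P.map.edge y)) : k = a ∨ l = a := by
  by_contra hcon
  push Not at hcon
  obtain ⟨hka, hla⟩ := hcon
  have hole : ∀ {d x : P.Dart} {a k : Fin 3}, P.IsHole a d → P.IsHole a (P.map.edge d) → a ≠ k →
      P.IsHole k x → P.map.connOn (Set.univ \ {d}) x (P.base k) := fun h h' hk hx =>
    hx.connOn (isHole_base _) fun z hz => active_diff_of_isHole (fun h1 => hk (h.unique h1))
      (fun h1 => hk (h'.unique h1)) hz
  have hyd : ∀ d, P.IsHole a d → P.IsHole a (P.map.edge d) →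
      P.map.Active (Set.univ \ {d}) y := fun d h h' =>
    active_diff_of_isHole (fun h1 => hka (h1.unique h)) (fun h1 => hka (h1.unique h')) hk
  by_cases hkl : k = l
  · subst hkl
    obtain ⟨c, hca, hck⟩ : ∃ c : Fin 3, c ≠ a ∧ c ≠ k := exists_third a k
    -- Both `d` and `y` are bridges, in different holes. As `y` lies on the side of `k`, the far
    -- side of `d` joins `a` to `c` without using `y`, but `y` must separate these two holes.
    have key : ∀ d, P.IsHole a d → P.IsHole a (P.map.edge d) → P.Sep d k c → False := by
      intro d h h' hs
      have br := not_connOn_of_isHole h h'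
      have hy := CombMap.connOn_edge (hyd d h h')
      have hyd' : P.map.connOn (Set.univ \ {d}) y d :=
        Setoid.trans' _ (hole h h' (Ne.symm hka) hk) (Setoid.symm' _ hs.1)
      have hac : P.map.connOn (Set.univ \ {y}) (P.base a) (P.base c) := by
        have h1 : P.map.connOn (Set.univ \ {y}) (P.map.edge d) (P.base c) := by
          rcases CombMap.connOn_diff (d := y) hs.2 with h1 | ⟨h1 | h1, -⟩
          · exact CombMap.connOn_mono
              (show (Set.univ \ {d}) \ {y} ⊆ Set.univ \ {y} from fun x hx => ⟨trivial, hx.2⟩) h1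
          · have h2 := CombMap.connOn_mono Set.sdiff_subset h1
            exact absurd (Setoid.symm' _ (Setoid.trans' _ h2 hyd')) br
          · have h2 := CombMap.connOn_mono Set.sdiff_subset h1
            exact absurd (Setoid.symm' _ (Setoid.trans' _ h2 (Setoid.trans' _ (Setoid.symm' _ hy)
              hyd'))) br
        exact Setoid.trans' _ (Setoid.symm' _ (hole hk hl hka h')) h1
      have br' := not_connOn_of_isHole hk hl
      rcases hP.sep_or hka hck.symm (Ne.symm hca) hk hl with h1 | h1
      · exact br' (Setoid.trans' _ h1.1 (Setoid.trans' _ hac (Setoid.symm' _ h1.2)))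
      · exact br' (Setoid.trans' _ h1.1 (Setoid.trans' _ (Setoid.symm' _ hac)
          (Setoid.symm' _ h1.2)))
    rcases hP.sep_or (Ne.symm hka) (Ne.symm hca) hck.symm h h' with h1 | h1
    · exact key d h h' h1
    · exact key _ h' (by rwa [P.map.edge_edge]) h1.edge
  -- The edge `y` joins the holes `k` and `l` without crossing the bridge, which should separate
  -- them.
  · have hy := CombMap.connOn_edge (hyd d h h')
    have h1 := hole h h' (Ne.symm hka) hk
    have h2 := hole h h' (Ne.symm hla) hl
    have h3 : P.map.connOn (Set.univ \ {d}) (P.base k) (P.base l) :=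
      Setoid.trans' _ (Setoid.symm' _ h1) (Setoid.trans' _ hy h2)
    have br := not_connOn_of_isHole h h'
    rcases hP.sep_or (Ne.symm hka) (Ne.symm hla) hkl h h' with h4 | h4
    · exact br (Setoid.trans' _ h4.1 (Setoid.trans' _ h3 (Setoid.symm' _ h4.2)))
    · exact br (Setoid.trans' _ h4.1 (Setoid.trans' _ (Setoid.symm' _ h3) (Setoid.symm' _ h4.2)))

end CombPants

end Strands

/-! ### Codes of pairs of pants -/

section PantsCodes

open scoped Classical

namespace CombPants

variable {P : CombPants}

/-- If all darts of a face were links, the complex would be a circle of edges, with one face on each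
side: too few for three holes. -/
theorem links_smoothable (P : CombPants) : P.map.Smoothable P.links := by
  refine ⟨fun d hd => ⟨⟨isBdry_vert.2 hd.1.2, ?_⟩, by rw [hd.2.1], ?_⟩, fun d hd => hd.2.1,
    fun d hd => hd.2.2, ?_⟩
  · rw [← isBdry_vert, hd.2.1]; exact hd.1.1
  · exact fun h => hd.2.2 (P.map.vert.injective h)
  intro d
  by_contra hcon
  push Not at hcon
  have hlink : ∀ x, P.map.face.SameCycle d x → x ∈ P.links := by
    intro x hx
    obtain ⟨n, rfl⟩ := hx.exists_nat_pow_eq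
    rw [← Perm.iterate_eq_pow]; exact hcon n
  have hrev : ∀ z, P.map.face.SameCycle d z → P.map.face (P.map.edge (P.map.face z)) =
      P.map.edge z := fun z hz =>
    CombMap.face_edge_face (hlink _ (Perm.sameCycle_apply_right.2 hz)).2.1
  have hall : ∀ x, P.map.face.SameCycle d x ∨ P.map.face.SameCycle d (P.map.edge x) := by
    let p : P.Dart → Prop := fun x =>
      P.map.face.SameCycle d x ∨ P.map.face.SameCycle d (P.map.edge x)
    have pedge : ∀ x, p x → p (P.map.edge x) := fun x hx => by
      change _ ∨ P.map.face.SameCycle d (P.map.edge (P.map.edge x))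
      rw [P.map.edge_edge]; exact hx.symm
    have pface : ∀ x, p x → p (P.map.face x) := by
      rintro x (hx | hx)
      · exact Or.inl (Perm.sameCycle_apply_right.2 hx)
      · right
        obtain ⟨z, hz⟩ := P.map.face.surjective (P.map.edge x)
        have h1 : P.map.face.SameCycle d z := Perm.sameCycle_apply_right.1 (hz ▸ hx)
        have h2 := hrev z h1
        rw [hz, P.map.edge_edge] at h2
        rwa [h2, P.map.edge_edge]
    have hle : P.map.connOn Set.univ ≤ Setoid.ker p := by
      have hiff : ∀ f : Perm P.Dart, (∀ x, p x → p (f x)) → ∀ x, p x = p (f x) := by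
        intro f hf x
        refine propext ⟨hf x, fun h => ?_⟩
        have h1 : cyc f (f x) x := Setoid.symm' _ (cyc_apply _ _)
        exact SameCycle.induction hf h h1
      refine CombMap.connOn_le (fun x => ?_) fun x _ => hiff _ pedge x
      refine hiff P.map.vert (fun x hx => ?_) x
      exact pface _ (pedge _ hx)
    intro x
    have h1 : p d = p x := hle (P.connected.connOn_univ d x)
    change p x
    rw [← h1]
    exact Or.inl (Perm.SameCycle.refl _ _)
  have hback : ∀ y, P.map.face.SameCycle d y →
      P.map.face.SameCycle (P.map.edge d) (P.map.edge y) := by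
    intro y hy
    refine (SameCycle.induction (p := fun y => P.map.face.SameCycle d y ∧
      P.map.face.SameCycle (P.map.edge d) (P.map.edge y)) ?_
      ⟨Perm.SameCycle.refl _ _, Perm.SameCycle.refl _ _⟩ hy).2
    rintro z ⟨h1, h2⟩
    refine ⟨Perm.sameCycle_apply_right.2 h1, ?_⟩
    rw [← hrev z h1] at h2
    exact Perm.sameCycle_apply_right.1 h2
  have htwo : ∀ k, P.IsHole k d ∨ P.IsHole k (P.map.edge d) := by
    intro k
    rcases hall (P.base k) with h | h
    · exact Or.inl h.symm
    · have := hback _ h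
      rw [P.map.edge_edge] at this
      exact Or.inr this.symm
  have hu : ∀ k l, P.IsHole k d → P.IsHole l d → k = l := fun k l h h' => h.unique h'
  have hu' : ∀ k l, P.IsHole k (P.map.edge d) → P.IsHole l (P.map.edge d) → k = l :=
    fun k l h h' => h.unique h'
  rcases htwo 0 with h0 | h0 <;> rcases htwo 1 with h1 | h1 <;> rcases htwo 2 with h2 | h2
  · exact absurd (hu _ _ h0 h1) (by decide)
  · exact absurd (hu _ _ h0 h1) (by decide)
  · exact absurd (hu _ _ h0 h2) (by decide)
  · exact absurd (hu' _ _ h1 h2) (by decide)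
  · exact absurd (hu _ _ h1 h2) (by decide)
  · exact absurd (hu' _ _ h0 h2) (by decide)
  · exact absurd (hu' _ _ h0 h1) (by decide)
  · exact absurd (hu' _ _ h0 h1) (by decide)

theorem chainLength_of_not_isBdry {d : P.Dart} (h : ¬ P.IsPointComponent d) :
    P.map.chainLength P.links d = 1 := by
  refine P.links_smoothable.chainLength_eq Nat.one_pos (fun h1 => h ?_) fun i hi hi' => by omega
  rw [Function.iterate_one, ← CombMap.vert_edge, P.links_smoothable.vert_mem_iff] at h1
  refine ⟨?_, h1.1.1⟩
  have := h1.1.2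
  rwa [P.map.edge_edge] at this

theorem IsHole.face_iterate {k : Fin 3} {d : P.Dart} (n : ℕ) :
    P.IsHole k (P.map.face^[n] d) ↔ P.IsHole k d := by
  rw [IsHole, IsHole, Perm.iterate_eq_pow]
  exact Perm.sameCycle_pow_right

theorem isHole_chainEdge {k : Fin 3} {d : P.Dart} :
    P.IsHole k (P.map.chainEdge P.links d) ↔ P.IsHole k (P.map.edge d) := by
  have h1 := (P.links_smoothable.chainLength_spec d).1
  have h2 := P.links_smoothable.iterate_chainEdge (d := d)
    (j := P.map.chainLength P.links d - 1) (by omega)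
  rw [Nat.sub_self, Function.iterate_zero, id] at h2
  rw [← h2, IsHole.face_iterate]

theorem isPointComponent_iff {d : P.Dart} : P.IsPointComponent d ↔
    (∃ k, P.IsHole k d) ∧ ∃ k, P.IsHole k (P.map.chainEdge P.links d) := by
  simp only [isHole_chainEdge]
  rw [IsPointComponent, isBdry_iff, isBdry_iff]

theorem ne_add_one_add_two : ∀ a : Fin 3, a ≠ a + 1 ∧ a ≠ a + 2 ∧ a + 1 ≠ a + 2 := by decide

/-- Strands of the same kind coincide, up to the vertices in their interiors. -/
theorem Geodesic.eq_of_not_mem_links (hP : P.Geodesic) (hT : P.Tight) {a b : Fin 3}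
    {d₁ d₂ : P.Dart} (a₁ : P.IsHole a d₁) (a₂ : P.IsHole a d₂) (b₁ : P.IsHole b (P.map.edge d₁))
    (b₂ : P.IsHole b (P.map.edge d₂)) (k₁ : d₁ ∉ P.links) (k₂ : d₂ ∉ P.links)
    (h : a = b → (P.Sep d₁ (a + 1) (a + 2) ↔ P.Sep d₂ (a + 1) (a + 2))) : d₁ = d₂ := by
  by_contra hne
  by_cases hab : a = b
  · subst hab
    obtain ⟨e1, e2, e3⟩ := ne_add_one_add_two a
    have hor : d₁ ∈ P.links ∨ d₂ ∈ P.links := by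
      by_cases hs : P.Sep d₁ (a + 1) (a + 2)
      · exact hP.mem_links_of_sep hT e1 e2 e3 a₁ a₂ b₁ b₂ hs ((h rfl).1 hs) hne
      · have s₁ := (hP.sep_or e1 e2 e3 a₁ b₁).resolve_left hs
        have s₂ := (hP.sep_or e1 e2 e3 a₂ b₂).resolve_left (fun h1 => hs ((h rfl).2 h1))
        exact hP.mem_links_of_sep hT e2 e1 e3.symm a₁ a₂ b₁ b₂ s₁ s₂ hne
    exact hor.elim k₁ k₂
  · exact (hP.mem_links_of_ne hT hab a₁ a₂ b₁ b₂ hne).elim k₁ k₂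

/-- The number of darts of the smoothed pair of pants. -/
theorem Geodesic.ncard_compl_links_le (hP : P.Geodesic) (hT : P.Tight) :
    (P.linksᶜ).ncard ≤ 2 * {d | ¬ P.IsBdry d}.ncard + 18 := by
  set s := {d | ¬ P.IsBdry d} with hs
  set K : Set P.Dart := {d | P.IsPointComponent d ∧ d ∉ P.links} with hK
  have hsub : P.linksᶜ ⊆ (s ∪ P.map.edge '' s) ∪ K := by
    intro d hd
    by_cases h1 : P.IsBdry d
    · by_cases h2 : P.IsBdry (P.map.edge d)
      · exact Or.inr ⟨⟨h1, h2⟩, hd⟩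
      · exact Or.inl (Or.inr ⟨_, h2, P.map.edge_edge d⟩)
    · exact Or.inl (Or.inl h1)
  -- A strand is determined by the holes on its two sides and, if they are equal, by the way it
  -- separates the other two: `3 * 3 * 2` possibilities.
  have hKc : K.ncard ≤ 18 := by
    have hh : ∀ d ∈ K, ∃ a b, P.IsHole a d ∧ P.IsHole b (P.map.edge d) := fun d hd => by
      obtain ⟨a, ha⟩ := isBdry_iff.1 hd.1.1
      obtain ⟨b, hb⟩ := isBdry_iff.1 hd.1.2
      exact ⟨a, b, ha, hb⟩
    choose! a b ha hb using hh
    have := Set.ncard_le_ncard_of_injOn (s := K) (t := Set.univ)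
      (fun d => (a d, b d, decide (P.Sep d (a d + 1) (a d + 2)))) (fun _ _ => trivial) (by
        intro d hd d' hd' hdd
        simp only [Prod.mk.injEq, decide_eq_decide] at hdd
        obtain ⟨h1, h2, h3⟩ := hdd
        refine hP.eq_of_not_mem_links hT (ha d hd) (h1 ▸ ha d' hd') (hb d hd) (h2 ▸ hb d' hd') hd.2
          hd'.2 fun _ => ?_
        rw [h3, h1]) (Set.toFinite _)
    refine this.trans ?_
    rw [Set.ncard_univ, Nat.card_eq_fintype_card]
    simp [Fintype.card_prod]
  have h1 := Set.ncard_le_ncard hsub (Set.toFinite _)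
  have h2 := Set.ncard_union_le (s ∪ P.map.edge '' s) K
  have h3 := Set.ncard_union_le s (P.map.edge '' s)
  have h4 := Set.ncard_image_of_injective s P.map.edge.injective
  omega

theorem bdryLength_eq_ncard (k : Fin 3) : P.bdryLength k = {d | P.IsHole k d}.ncard := by
  rw [bdryLength, CombMap.faceWalk, List.length_iterate]
  have hpos : 0 < Function.minimalPeriod P.map.face (P.base k) :=
    Function.minimalPeriod_pos_of_mem_periodicPts ⟨orderOf P.map.face, orderOf_pos _, by
      rw [Function.IsPeriodicPt, Function.IsFixedPt, Perm.iterate_eq_pow, pow_orderOf_eq_one]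
      rfl⟩
  have h1 : {d | P.IsHole k d} = (fun n => P.map.face^[n] (P.base k)) ''
      Set.Iio (Function.minimalPeriod P.map.face (P.base k)) := by
    ext d
    constructor
    · intro h
      obtain ⟨n, hn⟩ := Perm.SameCycle.exists_nat_pow_eq h
      refine ⟨n % Function.minimalPeriod P.map.face (P.base k), Nat.mod_lt _ hpos, ?_⟩
      beta_reduce
      rw [Function.iterate_mod_minimalPeriod_eq, Perm.iterate_eq_pow, hn]
    · rintro ⟨n, -, rfl⟩
      exact (IsHole.face_iterate n).2 (isHole_base k)
  rw [h1, Function.iterate_injOn_Iio_minimalPeriod.ncard_image, Set.ncard_eq_toFinset_card']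
  simp

/-- The length of a boundary curve is the sum of the lengths of its chains. -/
theorem bdryLength_eq_sum [Fintype (P.linksᶜ : Set P.Dart)] (k : Fin 3) :
    P.bdryLength k = ∑ d : (P.linksᶜ : Set P.Dart),
      if P.IsHole k d then P.map.chainLength P.links d else 0 := by
  have h := P.links_smoothable
  rw [bdryLength_eq_ncard]
  have h1 : ∀ d : (P.linksᶜ : Set P.Dart), (if P.IsHole k d then P.map.chainLength P.links d else 0) =
      Nat.card (Fin (if P.IsHole k d then P.map.chainLength P.links d else 0)) := fun d => by
    rw [Nat.card_eq_fintype_card, Fintype.card_fin]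
  rw [Finset.sum_congr rfl fun d _ => h1 d, ← Nat.card_sigma, ← Nat.card_coe_set_eq]
  symm
  have hlt : ∀ x : Σ d : (P.linksᶜ : Set P.Dart),
      Fin (if P.IsHole k d then P.map.chainLength P.links d else 0),
      P.IsHole k x.1 ∧ (x.2 : ℕ) < P.map.chainLength P.links x.1 := by
    rintro ⟨d, i⟩
    have := i.2
    split_ifs at this with hd
    · exact ⟨hd, this⟩
    · omega
  refine Nat.card_congr (Equiv.ofBijective (fun x => ⟨P.map.face^[x.2] (x.1 : P.Dart),
    (IsHole.face_iterate _).2 (hlt x).1⟩) ⟨?_, ?_⟩)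
  · rintro x y hxy
    obtain ⟨h2, h3⟩ := CombMap.Smoothable.chain_unique (hlt x).2 (hlt y).2 (congrArg Subtype.val hxy)
    obtain ⟨d, i⟩ := x
    obtain ⟨d', j⟩ := y
    cases h2
    have : i = j := Fin.ext h3
    rw [this]
  · rintro ⟨y, hy⟩
    obtain ⟨d, i, hi, rfl⟩ := h.exists_chain y
    have hd : P.IsHole k d := (IsHole.face_iterate _).1 hy
    exact ⟨⟨d, ⟨i, by rw [if_pos hd]; exact hi⟩⟩, rfl⟩

/-- The lengths of the strands are determined by those of the boundary curves. -/
theorem Geodesic.chainLength_eq {P' : CombPants} (hP : P.Geodesic) (hT : P.Tight)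
    (ψ : (P.linksᶜ : Set P.Dart) ≃ (P'.linksᶜ : Set P'.Dart))
    (hedge : ∀ d, ψ (P.links_smoothable.smooth.edge d) = P'.links_smoothable.smooth.edge (ψ d))
    (hhole : ∀ k d, P'.IsHole k (ψ d) ↔ P.IsHole k d)
    (hl : ∀ k, P.bdryLength k = P'.bdryLength k) (d : (P.linksᶜ : Set P.Dart)) :
    P'.map.chainLength P'.links (ψ d : P'.Dart) = P.map.chainLength P.links (d : P.Dart) := by
  have h := P.links_smoothable
  have h' := P'.links_smoothable
  have : Fintype (P.linksᶜ : Set P.Dart) := Fintype.ofFinite _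
  have : Fintype (P'.linksᶜ : Set P'.Dart) := Fintype.ofFinite _
  set e := P.links_smoothable.smooth.edge with he
  set δ : (P.linksᶜ : Set P.Dart) → ℤ := fun d =>
    (P'.map.chainLength P'.links (ψ d : P'.Dart) : ℤ) - P.map.chainLength P.links (d : P.Dart)
    with hδ
  have ee : ∀ d, e (e d) = d := h.smooth.edge_edge
  have hedg : ∀ k (d : (P.linksᶜ : Set P.Dart)), P.IsHole k (e d) ↔ P.IsHole k (P.map.edge d) :=
    fun k d => isHole_chainEdge
  have δe : ∀ d, δ (e d) = δ d := by
    intro d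
    simp only [hδ]
    rw [hedge, h'.coe_smooth_edge, h'.chainLength_chainEdge (ψ d).2, he, h.coe_smooth_edge,
      h.chainLength_chainEdge d.2]
  -- A chain beside a triangle is a single edge in both complexes, so only strands can differ in
  -- length.
  have δ0 : ∀ d, (∀ k, ¬ P.IsHole k (e d)) → δ d = 0 := by
    intro d hd
    simp only [hδ]
    rw [chainLength_of_not_isBdry, chainLength_of_not_isBdry, sub_self]
    · rw [isPointComponent_iff]
      rintro ⟨-, k, hk⟩
      exact hd k hk
    · rw [isPointComponent_iff]
      rintro ⟨-, k, hk⟩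
      refine hd k ?_
      rw [← hhole, hedge]
      exact hk
  have hsum : ∀ k, ∑ d : (P.linksᶜ : Set P.Dart), (if P.IsHole k d then δ d else 0) = 0 := by
    intro k
    have h1 := hl k
    rw [bdryLength_eq_sum, bdryLength_eq_sum, ← ψ.sum_comp] at h1
    have h2 := congrArg (Nat.cast : ℕ → ℤ) h1
    push_cast at h2
    rw [← sub_eq_zero, ← Finset.sum_sub_distrib] at h2
    refine Eq.trans ?_ (neg_eq_zero.2 h2)
    rw [← Finset.sum_neg_distrib]
    refine Finset.sum_congr rfl fun d _ => ?_
    rw [if_congr (hhole k d) rfl rfl]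
    split_ifs
    · simp only [hδ]; ring
    · ring
  -- `X a b` is the total difference in length of the strands between the holes `a` and `b`. The
  -- matrix is symmetric with zero row sums. If some hole `a` has a bridge, all entries outside its
  -- row and column vanish; if none has, the diagonal vanishes. In either case `X = 0`.
  set X : Fin 3 → Fin 3 → ℤ := fun a b =>
    ∑ d : (P.linksᶜ : Set P.Dart), if P.IsHole a d ∧ P.IsHole b (e d) then δ d else 0 with hX
  have hrow : ∀ a, X a 0 + X a 1 + X a 2 = 0 := by
    intro a
    rw [← hsum a, ← Fin.sum_univ_three (X a), hX]
    rw [Finset.sum_comm]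
    refine Finset.sum_congr rfl fun d _ => ?_
    by_cases ha : P.IsHole a d
    · simp only [ha, true_and, if_true]
      by_cases hb : ∃ b, P.IsHole b (e d)
      · obtain ⟨b, hb⟩ := hb
        rw [Finset.sum_eq_single b, if_pos hb]
        · intro b' _ hne
          exact if_neg fun h1 => hne (h1.unique hb)
        · intro h1; exact absurd (Finset.mem_univ _) h1
      · push Not at hb
        rw [δ0 d hb]
        simp
    · simp [ha]
  have hsymm : ∀ a b, X a b = X b a := by
    intro a b
    simp only [hX]
    rw [← Equiv.sum_comp e]
    refine Finset.sum_congr rfl fun d _ => ?_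
    rw [ee, δe, if_congr And.comm rfl rfl]
  have hbridge : ∀ a, (∃ d : (P.linksᶜ : Set P.Dart), P.IsHole a d ∧ P.IsHole a (e d)) →
      ∀ k l, k ≠ a → l ≠ a → X k l = 0 := by
    rintro a ⟨d, hd, hd'⟩ k l hk hl
    refine Finset.sum_eq_zero fun y _ => if_neg ?_
    rintro ⟨h1, h2⟩
    exact (hP.isHole_of_bridge hd ((hedg _ _).1 hd') h1 ((hedg _ _).1 h2)).elim hk hl
  have hnobridge : ∀ a, (¬ ∃ d : (P.linksᶜ : Set P.Dart), P.IsHole a d ∧ P.IsHole a (e d)) →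
      X a a = 0 := by
    intro a ha
    refine Finset.sum_eq_zero fun y _ => if_neg fun h1 => ha ⟨y, h1⟩
  have hX0 : ∀ a b, X a b = 0 := by
    have r0 := hrow 0
    have r1 := hrow 1
    have r2 := hrow 2
    have s01 := hsymm 0 1
    have s02 := hsymm 0 2
    have s12 := hsymm 1 2
    have key : X 0 0 = 0 ∧ X 0 1 = 0 ∧ X 0 2 = 0 ∧ X 1 1 = 0 ∧ X 1 2 = 0 ∧ X 2 2 = 0 := by
      by_cases b0 : ∃ d : (P.linksᶜ : Set P.Dart), P.IsHole 0 d ∧ P.IsHole 0 (e d)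
      · have h1 := hbridge 0 b0 1 1 (by decide) (by decide)
        have h2 := hbridge 0 b0 1 2 (by decide) (by decide)
        have h3 := hbridge 0 b0 2 2 (by decide) (by decide)
        omega
      · by_cases b1 : ∃ d : (P.linksᶜ : Set P.Dart), P.IsHole 1 d ∧ P.IsHole 1 (e d)
        · have h1 := hbridge 1 b1 0 0 (by decide) (by decide)
          have h2 := hbridge 1 b1 0 2 (by decide) (by decide)
          have h3 := hbridge 1 b1 2 2 (by decide) (by decide)
          omega
        · by_cases b2 : ∃ d : (P.linksᶜ : Set P.Dart), P.IsHole 2 d ∧ P.IsHole 2 (e d)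
          · have h1 := hbridge 2 b2 0 0 (by decide) (by decide)
            have h2 := hbridge 2 b2 0 1 (by decide) (by decide)
            have h3 := hbridge 2 b2 1 1 (by decide) (by decide)
            omega
          · have h1 := hnobridge 0 b0
            have h2 := hnobridge 1 b1
            have h3 := hnobridge 2 b2
            omega
    intro a b
    fin_cases a <;> fin_cases b <;> simp <;> omega
  suffices hd0 : δ d = 0 by
    simp only [hδ] at hd0
    omega
  by_cases hd : ∃ b, P.IsHole b (e d)
  swap
  · push Not at hd
    exact δ0 d hd
  obtain ⟨b, hb⟩ := hd
  by_cases hd' : ∃ a, P.IsHole a d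
  swap
  · push Not at hd'
    rw [← δe]
    exact δ0 _ (by rw [ee]; exact hd')
  obtain ⟨a, ha⟩ := hd'
  by_cases hab : a = b
  · subst hab
    have uniq : ∀ y z : (P.linksᶜ : Set P.Dart), (P.IsHole a y ∧ P.IsHole a (e y)) →
        (P.IsHole a z ∧ P.IsHole a (e z)) →
        (P.Sep y (a + 1) (a + 2) ↔ P.Sep z (a + 1) (a + 2)) → y = z := fun y z hy hz hs =>
      Subtype.ext (hP.eq_of_not_mem_links hT hy.1 hz.1 ((hedg _ _).1 hy.2) ((hedg _ _).1 hz.2)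
        y.2 z.2 fun _ => hs)
    have hne : e d ≠ d := h.smooth.edge_ne d
    have hed : P.IsHole a (e d) ∧ P.IsHole a (e (e d)) := ⟨hb, by rw [ee]; exact ha⟩
    -- In a given hole there is just one smoothed bridge, counted once for each direction.
    have hxx : X a a = δ d + δ (e d) := by
      simp only [hX]
      rw [Finset.sum_eq_add d (e d) hne.symm]
      · rw [if_pos ⟨ha, hb⟩, if_pos hed]
      · rintro y - ⟨hy1, hy2⟩
        refine if_neg fun hy => ?_
        by_cases hs : P.Sep d (a + 1) (a + 2) ↔ P.Sep y (a + 1) (a + 2)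
        · exact hy1 (uniq _ _ ⟨ha, hb⟩ hy hs).symm
        · have hs' : ¬ (P.Sep d (a + 1) (a + 2) ↔ P.Sep (e d) (a + 1) (a + 2)) := fun h1 =>
            hne (uniq _ _ ⟨ha, hb⟩ hed h1).symm
          exact hy2 (uniq _ _ hed hy (by tauto)).symm
      · exact fun h1 => absurd (Finset.mem_univ _) h1
      · exact fun h1 => absurd (Finset.mem_univ _) h1
    have := hX0 a a
    rw [hxx, δe] at this
    omega
  · have hxx : X a b = δ d := by
      simp only [hX]
      rw [Finset.sum_eq_single d, if_pos ⟨ha, hb⟩]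
      · intro y _ hy
        refine if_neg fun h1 => hy ?_
        exact Subtype.ext (hP.eq_of_not_mem_links hT h1.1 ha ((hedg _ _).1 h1.2)
          ((hedg _ _).1 hb) y.2 d.2 fun h2 => absurd h2 hab)
      · intro h1; exact absurd (Finset.mem_univ _) h1
    rw [← hxx, hX0]

end CombPants

/-- Codes of pairs of pants: the word of a contour, and a point of each boundary curve. -/
abbrev PantsCode : Type := Σ k : ℕ, (Fin k → Bool × Bool) × (Fin 3 → Fin k)

/-- The code describes the pair of pants `P` with base points `r` on the boundary curves. -/
def PantsCode.Describes (c : PantsCode) (P : CombPants) (r : Fin 3 → P.Dart) : Prop :=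
  ∃ (ε : (P.linksᶜ : Set P.Dart) ≃ Fin c.1) (T : Set (P.linksᶜ : Set P.Dart)),
    P.links_smoothable.smooth.IsContour ε T c.2.1 ∧
      ∀ k, P.IsHole k (r k) ∧ (ε.symm (c.2.2 k) : P.Dart) = r k

namespace CombPants

variable {P : CombPants}

theorem smooth_links_spherical (P : CombPants) : P.links_smoothable.smooth.Spherical :=
  (P.links_smoothable.smooth_connected P.connected).spherical
    (P.links_smoothable.smooth_eulerChar.trans P.spherical)

theorem exists_describes (P : CombPants) :
    ∃ (c : PantsCode) (r : Fin 3 → P.Dart), c.Describes P r ∧ c.1 = (P.linksᶜ).ncard := by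
  have h := P.links_smoothable
  have hr : ∀ k, ∃ d : (P.linksᶜ : Set P.Dart), P.IsHole k d := fun k => by
    obtain ⟨n, hn⟩ := h.exists_not_mem (P.base k)
    exact ⟨⟨_, hn⟩, (IsHole.face_iterate n).2 (isHole_base k)⟩
  choose r hr using hr
  obtain ⟨ε, T, w, hw⟩ := CombMap.exists_contour P.smooth_links_spherical
    (h.smooth_connected P.connected).connOn_univ (r 0)
  exact ⟨⟨_, w, fun k => ε (r k)⟩, fun k => r k, ⟨ε, T, hw, fun k =>
    ⟨hr k, by rw [Equiv.symm_apply_apply]⟩⟩, Nat.card_coe_set_eq _⟩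

/-- A tight pair of pants is determined by its code and the lengths of its boundary curves. -/
theorem Geodesic.exists_equiv {P' : CombPants} (hP : P.Geodesic) (hT : P.Tight) {c : PantsCode}
    {r : Fin 3 → P.Dart} {r' : Fin 3 → P'.Dart} (hc : c.Describes P r) (hc' : c.Describes P' r')
    (hl : ∀ k, P.bdryLength k = P'.bdryLength k) :
    ∃ Ψ : P.Dart ≃ P'.Dart, (∀ x, Ψ (P.map.edge x) = P'.map.edge (Ψ x)) ∧
      (∀ x, Ψ (P.map.face x) = P'.map.face (Ψ x)) ∧ ∀ k, Ψ (r k) = r' k := by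
  obtain ⟨ε, T, hw, hr⟩ := hc
  obtain ⟨ε', T', hw', hr'⟩ := hc'
  have h := P.links_smoothable
  have h' := P'.links_smoothable
  obtain ⟨hedge, hface⟩ := hw.unique hw'
  set ψ := ε.trans ε'.symm with hψ
  -- `ψ` maps faces to faces, and the marked point of each boundary curve tells which face is the
  -- hole `k`.
  have hhole : ∀ k d, P'.IsHole k (ψ d) ↔ P.IsHole k d := by
    intro k d
    have hk := (hr k).1
    have hk' := (hr' k).1
    rw [← (hr k).2] at hk
    rw [← (hr' k).2] at hk'
    have e1 : P.IsHole k d ↔ h.smooth.face.SameCycle (ε.symm (c.2.2 k)) d := by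
      rw [h.sameCycle_smooth_face]
      exact ⟨fun h1 => hk.symm.trans h1, fun h1 => Perm.SameCycle.trans hk h1⟩
    have e2 : P'.IsHole k (ψ d) ↔ h'.smooth.face.SameCycle (ε'.symm (c.2.2 k)) (ψ d) := by
      rw [h'.sameCycle_smooth_face]
      exact ⟨fun h1 => hk'.symm.trans h1, fun h1 => Perm.SameCycle.trans hk' h1⟩
    rw [e1, e2]
    have e3 : ε'.symm (c.2.2 k) = ψ (ε.symm (c.2.2 k)) := by simp [hψ]
    rw [e3]
    generalize ε.symm (c.2.2 k) = x
    constructor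
    · intro h1
      have := SameCycle.induction (p := fun y => h.smooth.face.SameCycle x (ψ.symm y)) ?_
        (by rw [ψ.symm_apply_apply]) h1
      · rwa [ψ.symm_apply_apply] at this
      · intro z hz
        have h2 := hface (ψ.symm z)
        have h3 : h'.smooth.face z = ψ (h.smooth.face (ψ.symm z)) := by
          change _ = ε'.symm (ε _)
          rw [h2]
          congr 1
          exact (ψ.apply_symm_apply z).symm
        rw [h3, ψ.symm_apply_apply]
        exact Perm.sameCycle_apply_right.2 hz
    · intro h1
      refine SameCycle.induction (p := fun y => h'.smooth.face.SameCycle (ψ x) (ψ y)) ?_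
        (Perm.SameCycle.refl _ _) h1
      intro z hz
      have h2 : ψ (h.smooth.face z) = h'.smooth.face (ψ z) := hface z
      rw [h2]
      exact Perm.sameCycle_apply_right.2 hz
  obtain ⟨Ψ, h1, h2, h3⟩ := h.exists_equiv h' ψ hedge hface
    (hP.chainLength_eq hT ψ hedge hhole hl)
  refine ⟨Ψ, h1, h2, fun k => ?_⟩
  rw [← (hr k).2, ← (hr' k).2, h3]
  simp [hψ]

end CombPants

end PantsCodes

/-! ### Codes of pants decompositions and reconstruction of the surface -/

section DecompositionCodes

open scoped Classical

theorem minimalPeriod_face_pos {D : Type} [Finite D] (π : Perm D) (x : D) :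
    0 < Function.minimalPeriod π x :=
  Function.minimalPeriod_pos_of_mem_periodicPts ⟨orderOf π, orderOf_pos _, by
    rw [Function.IsPeriodicPt, Function.IsFixedPt, Perm.iterate_eq_pow, pow_orderOf_eq_one]
    rfl⟩

theorem unionMap_face_iterate {n : ℕ} (P : Fin n → CombPants) (m : ℕ) (i : Fin n)
    (d : (P i).Dart) : (unionMap P).face^[m] ⟨i, d⟩ = ⟨i, (P i).map.face^[m] d⟩ := by
  induction m with
  | zero => rfl
  | succ m ih => rw [Function.iterate_succ_apply', ih, Function.iterate_succ_apply']; rfl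

namespace CombPants

variable {P : CombPants} {r : Fin 3 → P.Dart}

theorem minimalPeriod_of_isHole {k : Fin 3} {x : P.Dart} (h : P.IsHole k x) :
    Function.minimalPeriod P.map.face x = P.bdryLength k := by
  rw [bdryLength, CombMap.faceWalk, List.length_iterate]
  obtain ⟨n, rfl⟩ := Perm.SameCycle.exists_nat_pow_eq h
  rw [← Perm.iterate_eq_pow]
  refine Function.minimalPeriod_apply_iterate ?_ n
  exact Function.minimalPeriod_pos_iff_mem_periodicPts.1 (minimalPeriod_face_pos _ _)

theorem bdryLength_pos (P : CombPants) (k : Fin 3) : 0 < P.bdryLength k := by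
  rw [← minimalPeriod_of_isHole (isHole_base k)]
  exact minimalPeriod_face_pos _ _

/-- Polar coordinates on the boundary curves. -/
theorem exists_iterate (hr : ∀ k, P.IsHole k (r k)) {x : P.Dart} (hx : P.IsBdry x) :
    ∃ k, ∃ t < P.bdryLength k, P.map.face^[t] (r k) = x := by
  obtain ⟨k, hk⟩ := isBdry_iff.1 hx
  obtain ⟨n, hn⟩ := ((hr k).symm.trans hk).exists_nat_pow_eq
  refine ⟨k, n % P.bdryLength k, Nat.mod_lt _ (P.bdryLength_pos k), ?_⟩
  rw [← minimalPeriod_of_isHole (hr k), Function.iterate_mod_minimalPeriod_eq,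
    Perm.iterate_eq_pow, hn]

theorem iterate_unique (hr : ∀ k, P.IsHole k (r k)) {k l : Fin 3} {s t : ℕ}
    (h : P.map.face^[s] (r k) = P.map.face^[t] (r l)) :
    k = l ∧ (s < P.bdryLength k → t < P.bdryLength l → s = t) := by
  have hkl : k = l := by
    have h1 := (IsHole.face_iterate s).2 (hr k)
    rw [h] at h1
    exact h1.unique ((IsHole.face_iterate t).2 (hr l))
  subst hkl
  refine ⟨rfl, fun hs ht => ?_⟩
  rw [← minimalPeriod_of_isHole (hr k)] at hs ht
  exact Function.iterate_injOn_Iio_minimalPeriod hs ht h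

end CombPants

/-- The combinatorial data of a tight pants decomposition into `n` pairs of pants: the codes of the
pairs of pants, the matching of their boundary curves, and the lengths and twists of the curves. -/
@[ext] structure DecompCode (n : ℕ) where
  codes : Fin n → PantsCode
  matching : Fin n × Fin 3 → Fin n × Fin 3
  length : Fin n × Fin 3 → ℕ
  twist : Fin n × Fin 3 → ℕ

namespace DecompCode

variable {n : ℕ}

/-- The code describes a tight pants decomposition of the surface, up to the labels of the pairs
of pants. -/
def Describes (ω : DecompCode n) {N : ℕ} (S : CombSurface N) : Prop :=
  ∃ (Q : PantsDecomposition S n) (ρ : Perm (Fin n)) (r : ∀ i, Fin 3 → (Q.pants i).Dart),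
    Q.Tight ∧ (∀ i, (ω.codes (ρ i)).Describes (Q.pants i) (r i)) ∧
    (∀ i k, (Q.pants i).bdryLength k = ω.length (ρ i, k)) ∧
    ∀ i k, ∃ j l, ω.matching (ρ i, k) = (ρ j, l) ∧
      Q.mate ⟨i, r i k⟩ = ⟨j, (Q.pants j).map.face^[ω.twist (ρ i, k)] (r j l)⟩

/-- Permutations of the labels. -/
def relabel (θ : Perm (Fin n)) (ω : DecompCode n) : DecompCode n where
  codes i := ω.codes (θ.symm i)
  matching x := Prod.map θ id (ω.matching (Prod.map θ.symm id x))
  length x := ω.length (Prod.map θ.symm id x)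
  twist x := ω.twist (Prod.map θ.symm id x)

theorem Describes.relabel {ω : DecompCode n} {N : ℕ} {S : CombSurface N} (h : ω.Describes S)
    (θ : Perm (Fin n)) : (ω.relabel θ).Describes S := by
  obtain ⟨Q, ρ, r, h1, h2, h3, h4⟩ := h
  refine ⟨Q, ρ.trans θ, r, h1, fun i => ?_, fun i k => ?_, fun i k => ?_⟩
  · simpa [DecompCode.relabel] using h2 i
  · simpa [DecompCode.relabel] using h3 i k
  · obtain ⟨j, l, h5, h6⟩ := h4 i k
    refine ⟨j, l, ?_, ?_⟩
    · simp [DecompCode.relabel, h5]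
    · simpa [DecompCode.relabel] using h6

theorem _root_.Relation.EqvGen.transport {α β : Type} {R : α → α → Prop} {R' : β → β → Prop}
    {f : α → β} (hf : ∀ a b, R a b → R' (f a) (f b)) {a b : α} (h : Relation.EqvGen R a b) :
    Relation.EqvGen R' (f a) (f b) := by
  induction h with
  | rel a b h => exact Relation.EqvGen.rel _ _ (hf a b h)
  | refl a => exact Relation.EqvGen.refl _
  | symm a b _ ih => exact Relation.EqvGen.symm _ _ ih
  | trans a b c _ _ ih ih' => exact Relation.EqvGen.trans _ _ _ ih ih'

theorem proj_surjective {N : ℕ} {S : CombSurface N} (Q : PantsDecomposition S n) (s : Side N) :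
    ∃ x, ¬ (Q.pants x.1).IsBdry x.2 ∧ Q.proj x = s := by
  obtain ⟨x, hx, hs⟩ := Q.proj_bijOn.surjOn (Set.mem_univ s)
  exact ⟨x, hx, hs⟩

/-- The gluing reverses directions, so steps on one side are undone by as many steps on the other.
-/
theorem mate_iterate {N : ℕ} {S : CombSurface N} (Q : PantsDecomposition S n)
    {x : Σ i, (Q.pants i).Dart} (hx : (Q.pants x.1).IsBdry x.2) (m : ℕ) :
    (unionMap Q.pants).face^[m] (Q.mate ((unionMap Q.pants).face^[m] x)) = Q.mate x := by
  induction m with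
  | zero => rfl
  | succ m ih =>
    have hb : (Q.pants ((unionMap Q.pants).face^[m] x).1).IsBdry
        ((unionMap Q.pants).face^[m] x).2 := by
      obtain ⟨i, d⟩ := x
      rw [unionMap_face_iterate]
      exact (CombPants.isBdry_iterate m).2 hx
    rw [Function.iterate_succ_apply' _ m x, Q.mate_face _ hb, Function.iterate_succ_apply,
      Equiv.apply_symm_apply, ih]

/-- Surfaces with the same code are isomorphic. -/
theorem Describes.equivalent {ω : DecompCode n} {N : ℕ} {S S' : CombSurface N}
    (h : ω.Describes S) (h' : ω.Describes S') : CombSurface.Equivalent S S' := by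
  obtain ⟨Q, ρ, r, hT, hc, hl, hm⟩ := h
  obtain ⟨Q', ρ', r', hT', hc', hl', hm'⟩ := h'
  set σ : Perm (Fin n) := ρ.trans ρ'.symm with hσ
  have hρσ : ∀ i, ρ' (σ i) = ρ i := fun i => ρ'.apply_symm_apply _
  have hex : ∀ i, ∃ Ψ : (Q.pants i).Dart ≃ (Q'.pants (σ i)).Dart,
      (∀ x, Ψ ((Q.pants i).map.edge x) = (Q'.pants (σ i)).map.edge (Ψ x)) ∧
      (∀ x, Ψ ((Q.pants i).map.face x) = (Q'.pants (σ i)).map.face (Ψ x)) ∧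
      ∀ k, Ψ (r i k) = r' (σ i) k := by
    intro i
    refine (hT.1.geodesic i).exists_equiv (hT.2 i) (hc i) ?_ fun k => ?_
    · rw [← hρσ]; exact hc' (σ i)
    · rw [hl, hl', hρσ]
  choose Ψ hΨe hΨf hΨr using hex
  have hΨi : ∀ i (m : ℕ) x, Ψ i ((Q.pants i).map.face^[m] x) =
      (Q'.pants (σ i)).map.face^[m] (Ψ i x) := by
    intro i m x
    induction m with
    | zero => rfl
    | succ m ih => rw [Function.iterate_succ_apply', Function.iterate_succ_apply', hΨf, ih]
  have hr : ∀ i k, (Q.pants i).IsHole k (r i k) := fun i k => by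
    obtain ⟨ε, T, -, h1⟩ := hc i
    exact (h1 k).1
  have hr' : ∀ i k, (Q'.pants i).IsHole k (r' i k) := fun i k => by
    obtain ⟨ε, T, -, h1⟩ := hc' i
    exact (h1 k).1
  set Φ : (Σ i, (Q.pants i).Dart) ≃ Σ i, (Q'.pants i).Dart := Equiv.sigmaCongr σ Ψ with hΦ
  have hΦm : ∀ i d, Φ ⟨i, d⟩ = ⟨σ i, Ψ i d⟩ := fun i d => rfl
  have hΦe : ∀ x, Φ ((unionMap Q.pants).edge x) = (unionMap Q'.pants).edge (Φ x) := by
    rintro ⟨i, d⟩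
    exact congrArg (Sigma.mk (σ i)) (hΨe i d)
  have hΦf : ∀ x, Φ ((unionMap Q.pants).face x) = (unionMap Q'.pants).face (Φ x) := by
    rintro ⟨i, d⟩
    exact congrArg (Sigma.mk (σ i)) (hΨf i d)
  have hΦfs : ∀ x, Φ ((unionMap Q.pants).face.symm x) = (unionMap Q'.pants).face.symm (Φ x) := by
    intro x
    rw [Equiv.eq_symm_apply, ← hΦf, Equiv.apply_symm_apply]
  have hbd : ∀ i d, (Q.pants i).IsBdry d → (Q'.pants (σ i)).IsBdry (Ψ i d) := by
    intro i d hd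
    obtain ⟨k, t, -, rfl⟩ := CombPants.exists_iterate (hr i) hd
    rw [hΨi, hΨr, CombPants.isBdry_iterate]
    exact (hr' _ k).isBdry
  have hbd' : ∀ i d, (Q'.pants (σ i)).IsBdry (Ψ i d) → (Q.pants i).IsBdry d := by
    intro i d hd
    obtain ⟨k, t, -, h1⟩ := CombPants.exists_iterate (hr' (σ i)) hd
    rw [← hΨr, ← hΨi] at h1
    rw [← (Ψ i).injective h1, CombPants.isBdry_iterate]
    exact (hr _ k).isBdry
  -- The matching and the twist give the mate of the base point, and reversal of directions extends
  -- this along the whole curve.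
  have hΦmate : ∀ x, (Q.pants x.1).IsBdry x.2 → Φ (Q.mate x) = Q'.mate (Φ x) := by
    rintro ⟨i, d⟩ hd
    obtain ⟨k, t, -, rfl⟩ := CombPants.exists_iterate (hr i) hd
    clear hd
    induction t with
    | zero =>
      obtain ⟨j, l, h1, h2⟩ := hm i k
      obtain ⟨j', l', h1', h2'⟩ := hm' (σ i) k
      rw [hρσ, h1, ← hρσ] at h1'
      obtain ⟨h3, h4⟩ := Prod.mk.inj h1'
      have h3' := ρ'.injective h3
      subst h3'
      subst h4
      rw [Function.iterate_zero, id, h2, hΦm, hΦm, hΨr, h2', hρσ, hΨi, hΨr]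
    | succ t ih =>
      have e1 : (⟨i, (Q.pants i).map.face^[t + 1] (r i k)⟩ : Σ i, (Q.pants i).Dart) =
          (unionMap Q.pants).face ⟨i, (Q.pants i).map.face^[t] (r i k)⟩ := by
        rw [Function.iterate_succ_apply']; rfl
      have hb : (Q.pants i).IsBdry ((Q.pants i).map.face^[t] (r i k)) :=
        (CombPants.isBdry_iterate t).2 (hr i k).isBdry
      rw [e1, Q.mate_face _ hb, hΦfs, ih, hΦf, Q'.mate_face _ (hbd _ _ hb)]
  -- Sides of the surface are darts modulo the identifications along the curves, and `Φ` respects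
  -- these; so it descends to the surfaces.
  have hwd : ∀ x y, Q.proj x = Q.proj y → Q'.proj (Φ x) = Q'.proj (Φ y) := by
    intro x y hxy
    rw [Q'.proj_eq_iff]
    refine Relation.EqvGen.transport ?_ ((Q.proj_eq_iff x y).1 hxy)
    rintro a b ⟨ha, rfl⟩
    exact ⟨hbd _ _ ha, by rw [hΦe, hΦmate a ha]⟩
  choose rep hrep1 hrep2 using proj_surjective Q
  set φ : Side N → Side N := fun s => Q'.proj (Φ (rep s)) with hφ
  have hφp : ∀ x, φ (Q.proj x) = Q'.proj (Φ x) := fun x => hwd _ _ (hrep2 _)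
  have hsurj : Function.Surjective φ := by
    intro s
    obtain ⟨y, -, rfl⟩ := proj_surjective Q' s
    exact ⟨Q.proj (Φ.symm y), by rw [hφp, Φ.apply_symm_apply]⟩
  refine ⟨Equiv.ofBijective φ ⟨Finite.injective_iff_surjective.2 hsurj, hsurj⟩, fun _ => false,
    fun _ => rfl, fun _ => rfl, fun d => ?_, fun d => ?_⟩
  · obtain ⟨x, -, rfl⟩ := proj_surjective Q d
    change φ _ = S'.glue (φ _)
    rw [← Q.proj_edge, hφp, hφp, hΦe, Q'.proj_edge]
  · obtain ⟨x, hx, rfl⟩ := proj_surjective Q d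
    rw [if_neg Bool.false_ne_true]
    change φ _ = nextSide N (φ _)
    rw [← Q.proj_face x hx, hφp, hφp, hΦf, Q'.proj_face]
    exact fun h1 => hx (hbd' _ _ h1)

/-- The constraints on codes of decompositions of connected surfaces with `N` triangles. -/
structure Valid (ω : DecompCode n) (N M : ℕ) : Prop where
  matching_matching : ∀ x, ω.matching (ω.matching x) = x
  matching_ne : ∀ x, ω.matching x ≠ x
  length_matching : ∀ x, ω.length (ω.matching x) = ω.length x
  twist_matching : ∀ x, ω.twist (ω.matching x) = ω.twist x
  twist_lt : ∀ x, ω.twist x < ω.length x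
  connected : ∀ i j, Relation.EqvGen (fun a b => ∃ k, b = (ω.matching (a, k)).1) i j
  sum_codes : ∑ i, (ω.codes i).1 ≤ 6 * N + 18 * n
  sum_length : ∑ x, ω.length x ≤ M

theorem Valid.relabel {ω : DecompCode n} {N M : ℕ} (h : ω.Valid N M) (θ : Perm (Fin n)) :
    (ω.relabel θ).Valid N M := by
  refine ⟨fun x => ?_, fun x hx => ?_, fun x => ?_, fun x => ?_, fun x => h.twist_lt _,
    fun i j => ?_, ?_, ?_⟩
  · simp only [DecompCode.relabel, Prod.map_map, Equiv.symm_comp_self, Function.comp_id,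
      Prod.map_id, id, h.matching_matching, Equiv.self_comp_symm]
  · refine h.matching_ne (Prod.map θ.symm id x) ?_
    simp only [DecompCode.relabel] at hx
    conv_rhs => rw [← hx]
    simp only [Prod.map_map, Equiv.symm_comp_self, Function.comp_id, Prod.map_id, id]
  · simp only [DecompCode.relabel, Prod.map_map, Equiv.symm_comp_self, Function.comp_id,
      Prod.map_id, id, h.length_matching]
  · simp only [DecompCode.relabel, Prod.map_map, Equiv.symm_comp_self, Function.comp_id,
      Prod.map_id, id, h.twist_matching]
  · have := Relation.EqvGen.transport (f := θ)
      (R' := fun a b => ∃ k, b = ((ω.relabel θ).matching (a, k)).1) ?_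
      (h.connected (θ.symm i) (θ.symm j))
    · simpa using this
    · rintro a b ⟨k, rfl⟩
      exact ⟨k, by simp [DecompCode.relabel]⟩
  · refine le_trans (le_of_eq ?_) h.sum_codes
    exact Equiv.sum_comp θ.symm fun i => (ω.codes i).1
  · refine le_trans (le_of_eq ?_) h.sum_length
    exact Equiv.sum_comp (Equiv.prodCongr θ.symm (Equiv.refl (Fin 3))) ω.length

/-- A connected code has few symmetries. -/
theorem Valid.relabel_injOn {ω : DecompCode n} {N M : ℕ} (h : ω.Valid N M) {θ θ' : Perm (Fin n)}
    (hθ : ω.relabel θ = ω.relabel θ') {i : Fin n} (hi : θ i = θ' i) : θ = θ' := by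
  have key : ∀ x, Prod.map θ id (ω.matching x) =
      Prod.map θ' id (ω.matching (Prod.map θ'.symm id (Prod.map θ id x))) := by
    intro x
    have := congrFun (congrArg DecompCode.matching hθ) (Prod.map θ id x)
    simpa [DecompCode.relabel, Prod.map_map] using this
  -- Agreement of the two relabelings spreads to the neighbours in the matching, and by
  -- connectedness everywhere.
  have step : ∀ a k, θ a = θ' a → θ (ω.matching (a, k)).1 = θ' (ω.matching (a, k)).1 := by
    intro a k ha
    have h1 := congrArg Prod.fst (key (a, k))
    simpa [ha] using h1
  have all : ∀ a b, Relation.EqvGen (fun a b => ∃ k, b = (ω.matching (a, k)).1) a b →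
      (θ a = θ' a ↔ θ b = θ' b) := by
    intro a b hab
    induction hab with
    | refl a => rfl
    | symm a b _ ih => exact ih.symm
    | trans a b c _ _ ih ih' => exact ih.trans ih'
    | rel a b hab =>
      obtain ⟨k, rfl⟩ := hab
      refine ⟨step a k, fun h1 => ?_⟩
      have h2 := step _ (ω.matching (a, k)).2 h1
      rwa [Prod.mk.eta, h.matching_matching] at h2
  exact Equiv.ext fun j => (all i j (h.connected i j)).1 hi

end DecompCode

end DecompositionCodes

/-! ### Every tight pants decomposition has a valid code -/

section ExistenceOfCodes

open scoped Classical

namespace DecompCode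

variable {n N : ℕ} {S : CombSurface N}

/-- One full turn on the side of `d` returns the mate to itself. Used from both sides, this shows
that glued curves have equal lengths. -/
theorem minimalPeriod_mate_le (Q : PantsDecomposition S n) {i j : Fin n} {d : (Q.pants i).Dart}
    {e : (Q.pants j).Dart} (hd : (Q.pants i).IsBdry d) (h : Q.mate ⟨i, d⟩ = ⟨j, e⟩) :
    Function.minimalPeriod (Q.pants j).map.face e ≤
      Function.minimalPeriod (Q.pants i).map.face d := by
  have h1 := mate_iterate Q (x := ⟨i, d⟩) hd (Function.minimalPeriod (Q.pants i).map.face d)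
  rw [unionMap_face_iterate _ _ i d, Function.iterate_minimalPeriod, h,
    unionMap_face_iterate _ _ j e] at h1
  refine Function.IsPeriodicPt.minimalPeriod_le (minimalPeriod_face_pos _ _) ?_
  exact eq_of_heq (Sigma.mk.inj h1).2

theorem fst_mate_iterate (Q : PantsDecomposition S n) {i : Fin n} {d : (Q.pants i).Dart}
    (hd : (Q.pants i).IsBdry d) (m : ℕ) :
    (Q.mate ⟨i, (Q.pants i).map.face^[m] d⟩).1 = (Q.mate ⟨i, d⟩).1 := by
  have key : ∀ y : Σ i, (Q.pants i).Dart, ((unionMap Q.pants).face^[m] y).1 = y.1 := by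
    rintro ⟨j, e⟩
    rw [unionMap_face_iterate]
  have h1 := congrArg Sigma.fst (mate_iterate Q (x := ⟨i, d⟩) hd m)
  rwa [key, unionMap_face_iterate _ _ i d] at h1

/-- The number of triangles. -/
theorem sum_ncard_not_isBdry (Q : PantsDecomposition S n) :
    ∑ i, {d | ¬ (Q.pants i).IsBdry d}.ncard = 3 * N := by
  have h1 : Nat.card (Σ i, {d | ¬ (Q.pants i).IsBdry d}) = Nat.card (Side N) := by
    refine Nat.card_congr (Equiv.ofBijective (fun x => Q.proj ⟨x.1, x.2⟩) ⟨?_, ?_⟩)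
    · rintro ⟨i, d, hd⟩ ⟨j, e, he⟩ h
      have h2 := Q.proj_bijOn.injOn (show (⟨i, d⟩ : Σ i, (Q.pants i).Dart) ∈ _ from hd)
        (show (⟨j, e⟩ : Σ i, (Q.pants i).Dart) ∈ _ from he) h
      cases h2
      rfl
    · intro s
      obtain ⟨⟨i, d⟩, hd, rfl⟩ := proj_surjective Q s
      exact ⟨⟨i, d, hd⟩, rfl⟩
  rw [Nat.card_sigma] at h1
  simp only [Nat.card_coe_set_eq] at h1
  rw [h1, Nat.card_prod, Nat.card_fin, Nat.card_zmod, mul_comm]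

/-- On the surface one moves between sides by `glue` and `nextSide`; lifted to darts, such a move
stays in one pair of pants or crosses curves through `mate`. -/
theorem connected_of_mate (hS : S.toMap.Connected) (Q : PantsDecomposition S n)
    {R : Fin n → Fin n → Prop}
    (hR : ∀ x : Σ i, (Q.pants i).Dart, (Q.pants x.1).IsBdry x.2 →
      Relation.EqvGen R x.1 (Q.mate x).1) (i j : Fin n) : Relation.EqvGen R i j := by
  have hproj : ∀ x y, Q.proj x = Q.proj y → Relation.EqvGen R x.1 y.1 := by
    intro x y hxy
    induction (Q.proj_eq_iff x y).1 hxy with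
    | rel a b h =>
      obtain ⟨h1, rfl⟩ := h
      exact hR a h1
    | refl a => exact Relation.EqvGen.refl _
    | symm a b h ih => exact Relation.EqvGen.symm _ _ (ih ((Q.proj_eq_iff a b).2 h))
    | trans a b c h h' ih ih' =>
      exact Relation.EqvGen.trans _ _ _ (ih ((Q.proj_eq_iff a b).2 h))
        (ih' ((Q.proj_eq_iff b c).2 h'))
  choose rep hrep1 hrep2 using proj_surjective Q
  have hrep : ∀ s s', Relation.EqvGen R (rep s).1 (rep s').1 := by
    intro s s'
    induction hS.2 s s' with
    | rel a b h =>
      rcases h with rfl | rfl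
      · have h1 := Q.proj_edge (rep a)
        rw [hrep2] at h1
        exact hproj ((unionMap Q.pants).edge (rep a)) (rep (S.glue a)) (by rw [h1, hrep2])
      · have h1 := Q.proj_face (rep a) (hrep1 a)
        rw [hrep2] at h1
        exact hproj ((unionMap Q.pants).face (rep a)) (rep (nextSide N a)) (by rw [h1, hrep2])
    | refl a => exact Relation.EqvGen.refl _
    | symm a b _ ih => exact Relation.EqvGen.symm _ _ ih
    | trans a b c _ _ ih ih' => exact Relation.EqvGen.trans _ _ _ ih ih'
  have hi : ∀ i, ∃ s, Relation.EqvGen R i (rep s).1 := fun i =>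
    ⟨Q.proj ⟨i, (Q.pants i).base 0⟩, hproj ⟨i, (Q.pants i).base 0⟩ _ (hrep2 _).symm⟩
  obtain ⟨s, hs⟩ := hi i
  obtain ⟨s', hs'⟩ := hi j
  exact Relation.EqvGen.trans _ _ _ hs
    (Relation.EqvGen.trans _ _ _ (hrep s s') (Relation.EqvGen.symm _ _ hs'))

/-- Every tight pants decomposition of a connected surface has a code. -/
theorem exists_describes (hS : S.toMap.Connected) (Q : PantsDecomposition S n) (hQ : Q.Tight)
    {L : ℝ} (hL : Q.totalLength ≤ L) :
    ∃ ω : DecompCode n, ω.Describes S ∧ ω.Valid N ⌊2 * L⌋₊ := by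
  choose c r hc hsize using fun i => (Q.pants i).exists_describes
  have hr : ∀ i k, (Q.pants i).IsHole k (r i k) := fun i k => by
    obtain ⟨ε, T, -, h1⟩ := hc i
    exact (h1 k).1
  have hex : ∀ i k, ∃ j l, ∃ t < (Q.pants j).bdryLength l,
      Q.mate ⟨i, r i k⟩ = ⟨j, (Q.pants j).map.face^[t] (r j l)⟩ := by
    intro i k
    have h1 := Q.mate_bdry ⟨i, r i k⟩ (hr i k).isBdry
    generalize Q.mate ⟨i, r i k⟩ = y at h1
    obtain ⟨j, e⟩ := y
    obtain ⟨l, t, ht, rfl⟩ := CombPants.exists_iterate (hr j) h1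
    exact ⟨j, l, t, ht, rfl⟩
  choose j l t ht hm using hex
  have hlen : ∀ i k, (Q.pants (j i k)).bdryLength (l i k) = (Q.pants i).bdryLength k := by
    intro i k
    have hb : (Q.pants (j i k)).IsHole (l i k) ((Q.pants (j i k)).map.face^[t i k] (r (j i k) (l i k))) :=
      (CombPants.IsHole.face_iterate _).2 (hr _ _)
    rw [← CombPants.minimalPeriod_of_isHole hb, ← CombPants.minimalPeriod_of_isHole (hr i k)]
    refine le_antisymm (minimalPeriod_mate_le Q (hr i k).isBdry (hm i k)) ?_
    refine minimalPeriod_mate_le Q hb.isBdry ?_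
    rw [← hm, Q.mate_mate _ (hr i k).isBdry]
  -- Each base point is mated `t` steps after the other one; since directions are reversed, the
  -- number of steps is the same from both sides.
  have hback : ∀ i k, j (j i k) (l i k) = i ∧ l (j i k) (l i k) = k ∧ t (j i k) (l i k) = t i k := by
    intro i k
    have h1 := mate_iterate Q (x := ⟨j i k, r (j i k) (l i k)⟩) (hr _ _).isBdry (t i k)
    rw [unionMap_face_iterate _ _ (j i k) (r (j i k) (l i k)), ← hm,
      Q.mate_mate _ (hr i k).isBdry, unionMap_face_iterate _ _ i (r i k), hm (j i k) (l i k)] at h1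
    have h3 := hlen (j i k) (l i k)
    have h4 := ht (j i k) (l i k)
    rw [hlen i k] at h3
    generalize j (j i k) (l i k) = i' at h1 h3 h4 ⊢
    generalize l (j i k) (l i k) = k' at h1 h3 h4 ⊢
    generalize t (j i k) (l i k) = t' at h1 h3 h4 ⊢
    obtain ⟨h5, h6⟩ := Sigma.mk.inj h1
    subst h5
    have h7 := CombPants.iterate_unique (hr i) (eq_of_heq h6)
    obtain ⟨rfl, h8⟩ := h7
    refine ⟨rfl, rfl, (h8 ?_ h4).symm⟩
    rw [← hlen]; exact ht i k
  refine ⟨⟨c, fun x => (j x.1 x.2, l x.1 x.2), fun x => (Q.pants x.1).bdryLength x.2,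
    fun x => t x.1 x.2⟩, ⟨Q, Equiv.refl _, r, hQ, hc, fun _ _ => rfl, fun i k =>
      ⟨j i k, l i k, rfl, hm i k⟩⟩, ?_⟩
  refine ⟨fun x => Prod.ext (hback x.1 x.2).1 (hback x.1 x.2).2.1, fun x hx => ?_,
    fun x => hlen x.1 x.2, fun x => (hback x.1 x.2).2.2, fun x => ?_, ?_, ?_, ?_⟩
  · have h1 : j x.1 x.2 = x.1 := congrArg Prod.fst hx
    have h2 : l x.1 x.2 = x.2 := congrArg Prod.snd hx
    have h3 := hm x.1 x.2
    refine Q.mate_ne ⟨x.1, r x.1 x.2⟩ (hr _ _).isBdry ?_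
    rw [h3, h1, h2, ← unionMap_face_iterate, CombMap.faceOf_eq_iff, Perm.iterate_eq_pow]
    exact Perm.sameCycle_pow_left.2 (Perm.SameCycle.refl _ _)
  · change t x.1 x.2 < (Q.pants x.1).bdryLength x.2
    rw [← hlen]
    exact ht x.1 x.2
  · refine connected_of_mate hS Q ?_
    rintro ⟨i, d⟩ hd
    obtain ⟨k, s, -, rfl⟩ := CombPants.exists_iterate (hr i) hd
    rw [fst_mate_iterate Q (hr i k).isBdry, hm]
    exact Relation.EqvGen.rel _ _ ⟨k, rfl⟩
  -- The triangles contribute their `3 * N` sides, each with its reverse, and every pair of pants at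
  -- most 18 further darts.
  · calc ∑ i, (c i).1 ≤ ∑ i, (2 * {d | ¬ (Q.pants i).IsBdry d}.ncard + 18) :=
        Finset.sum_le_sum fun i _ => by
          rw [hsize]
          exact (hQ.1.geodesic i).ncard_compl_links_le (hQ.2 i)
      _ = 6 * N + 18 * n := by
        rw [Finset.sum_add_distrib, ← Finset.mul_sum, sum_ncard_not_isBdry]
        simp
        ring
  -- Every curve bounds on two sides, hence the total `2 * L`.
  · refine Nat.le_floor ?_
    rw [PantsDecomposition.totalLength] at hL
    rw [Fintype.sum_prod_type]
    push_cast
    linarith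

end DecompCode

end ExistenceOfCodes

/-! ### Counting codes with generating functions -/

section Counting

open scoped Classical

/-- Families of bounded total weight. -/
theorem card_mul_pow_le {ι α : Type} [Fintype ι] {f : α → ℕ} {z W : ℝ} (hz : 0 < z) (hz1 : z ≤ 1)
    (hW : ∀ F : Finset α, ∑ a ∈ F, z ^ f a ≤ W) (G : Finset (ι → α)) {s : ℕ}
    (hG : ∀ x ∈ G, ∑ i, f (x i) ≤ s) : (G.card : ℝ) * z ^ s ≤ W ^ Fintype.card ι := by
  set F : ι → Finset α := fun i => G.image fun x => x i with hF
  calc (G.card : ℝ) * z ^ s = ∑ _x ∈ G, z ^ s := by rw [Finset.sum_const, nsmul_eq_mul]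
    _ ≤ ∑ x ∈ G, ∏ i, z ^ f (x i) := by
        -- As `z ≤ 1`, every family in `G` has weight at least `z ^ s`, and the sum of the weights
        -- over all families factors.
        refine Finset.sum_le_sum fun x hx => ?_
        rw [Finset.prod_pow_eq_pow_sum]
        exact pow_le_pow_of_le_one hz.le hz1 (hG x hx)
    _ ≤ ∑ x ∈ Fintype.piFinset F, ∏ i, z ^ f (x i) := by
        refine Finset.sum_le_sum_of_subset_of_nonneg (fun x hx => ?_) fun x _ _ =>
          Finset.prod_nonneg fun i _ => (pow_pos hz _).le
        exact Fintype.mem_piFinset.2 fun i => Finset.mem_image_of_mem _ hx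
    _ = ∏ i, ∑ a ∈ F i, z ^ f a := (Finset.prod_univ_sum F fun _ a => z ^ f a).symm
    _ ≤ ∏ _i : ι, W := Finset.prod_le_prod
        (fun i _ => Finset.sum_nonneg fun a _ => (pow_pos hz _).le) fun i _ => hW _
    _ = W ^ Fintype.card ι := by rw [Finset.prod_const, Finset.card_univ]

/-- There are `4 ^ k * k ^ 3 ≤ 32 ^ k` codes of size `k`; the weight `1 / 64` leaves a geometric
series of ratio `1 / 2`. -/
theorem sum_pantsCode_le (F : Finset PantsCode) : ∑ c ∈ F, (1 / 64 : ℝ) ^ c.1 ≤ 2 := by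
  set K := F.image Sigma.fst with hK
  have hsub : F ⊆ K.sigma fun _ => Finset.univ := fun c hc =>
    Finset.mem_sigma.2 ⟨Finset.mem_image_of_mem _ hc, Finset.mem_univ _⟩
  calc ∑ c ∈ F, (1 / 64 : ℝ) ^ c.1 ≤ ∑ c ∈ K.sigma fun _ => Finset.univ, (1 / 64 : ℝ) ^ c.1 :=
        Finset.sum_le_sum_of_subset_of_nonneg hsub fun _ _ _ => by positivity
    _ = ∑ k ∈ K, (4 ^ k * k ^ 3 : ℝ) * (1 / 64) ^ k := by
        rw [Finset.sum_sigma]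
        refine Finset.sum_congr rfl fun k _ => ?_
        change ∑ _s : (Fin k → Bool × Bool) × (Fin 3 → Fin k), (1 / 64 : ℝ) ^ k = _
        rw [Finset.sum_const, Finset.card_univ, nsmul_eq_mul, Fintype.card_prod, Fintype.card_fun,
          Fintype.card_fun, Fintype.card_prod, Fintype.card_bool, Fintype.card_fin,
          Fintype.card_fin]
        push_cast
        norm_num
    _ ≤ ∑ k ∈ K, (1 / 2 : ℝ) ^ k := by
        refine Finset.sum_le_sum fun k _ => ?_
        have h1 : (k : ℝ) ≤ 2 ^ k := by exact_mod_cast Nat.lt_two_pow_self.le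
        have h2 : (k : ℝ) ^ 3 ≤ (2 ^ k) ^ 3 := pow_le_pow_left₀ (Nat.cast_nonneg k) h1 3
        calc (4 ^ k * k ^ 3 : ℝ) * (1 / 64) ^ k ≤ (4 ^ k * (2 ^ k) ^ 3) * (1 / 64) ^ k := by gcongr
          _ = (1 / 2 : ℝ) ^ k := by
            rw [← pow_mul, mul_comm k 3, pow_mul, ← mul_pow, ← mul_pow]; norm_num
    _ ≤ ∑' k : ℕ, (1 / 2 : ℝ) ^ k :=
        summable_geometric_two.sum_le_tsum K fun _ _ => by positivity
    _ = 2 := tsum_geometric_two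

theorem sum_pow_le {z : ℝ} (hz : 0 ≤ z) (hz1 : z < 1) (F : Finset ℕ) :
    ∑ a ∈ F, z ^ a ≤ (1 - z)⁻¹ := by
  rw [← tsum_geometric_of_lt_one hz hz1]
  exact (summable_geometric_of_lt_one hz hz1).sum_le_tsum F fun _ _ => by positivity

/-- The number of families of natural numbers with bounded sum. -/
theorem card_le_of_sum_le {ι : Type} [Fintype ι] [Nonempty ι] (G : Finset (ι → ℕ)) {s : ℕ}
    (hG : ∀ x ∈ G, ∑ i, x i ≤ s) :
    (G.card : ℝ) ≤ Real.exp (Fintype.card ι) *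
      ((s + 1 + Fintype.card ι : ℝ) / Fintype.card ι) ^ Fintype.card ι := by
  set k := Fintype.card ι with hk
  have hk0 : (0 : ℝ) < k := by exact_mod_cast Fintype.card_pos
  -- With this weight `1 / (1 - z)` is the base in the bound, while `z⁻¹ ^ s` is at most `exp k`.
  set z : ℝ := (s + 1) / (s + 1 + k) with hz
  have hs : (0 : ℝ) < s + 1 := by positivity
  have hz0 : 0 < z := by positivity
  have hz1 : z < 1 := by rw [hz, div_lt_one (by positivity)]; linarith
  have h1 := card_mul_pow_le (f := id) hz0 hz1.le (sum_pow_le hz0.le hz1) G hG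
  have h2 : (1 - z)⁻¹ = (s + 1 + k) / k := by
    have h3 : 1 - z = k / (s + 1 + k) := by
      rw [hz, eq_div_iff (by positivity), sub_mul, div_mul_cancel₀ _ (by positivity)]
      ring
    rw [h3, inv_div]
  rw [h2] at h1
  have h3 : (z⁻¹) ^ s ≤ Real.exp k := by
    have h4 : z⁻¹ = 1 + k / (s + 1) := by rw [hz]; field_simp
    have h5 : z⁻¹ ≤ Real.exp (k / (s + 1)) := by
      rw [h4, add_comm]; exact Real.add_one_le_exp _
    calc (z⁻¹) ^ s ≤ (Real.exp (k / (s + 1))) ^ s := pow_le_pow_left₀ (inv_pos.2 hz0).le h5 s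
      _ = Real.exp (s * (k / (s + 1))) := by rw [← Real.exp_nat_mul]
      _ ≤ Real.exp k := by
        refine Real.exp_le_exp.2 ?_
        rw [mul_div_assoc', div_le_iff₀ hs]
        nlinarith
  calc (G.card : ℝ) = (z⁻¹) ^ s * (G.card * z ^ s) := by
        rw [inv_pow]; field_simp
    _ ≤ Real.exp k * ((s + 1 + k : ℝ) / k) ^ k := by
        refine mul_le_mul h3 h1 (by positivity) (Real.exp_pos _).le

/-- The number of perfect matchings. -/
theorem card_matchings_le {X : Type} [Fintype X] {m : ℕ} (hX : Fintype.card X = 2 * m)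
    (G : Finset (X → X)) (h1 : ∀ μ ∈ G, ∀ x, μ (μ x) = x) (h2 : ∀ μ ∈ G, ∀ x, μ x ≠ x) :
    G.card ≤ 4 ^ m * (2 * m) ^ m := by
  set e : X → Fin (Fintype.card X) := fun x => Fintype.equivFin X x with he
  have einj : Function.Injective e := (Fintype.equivFin X).injective
  -- A matching is determined by the set of its `m` left ends and its values there; there are `(2 *
  -- m).choose m ≤ 4 ^ m` such sets.
  set T : (X → X) → Finset X := fun μ => Finset.univ.filter fun x => e x < e (μ x) with hT
  have memT : ∀ μ x, x ∈ T μ ↔ e x < e (μ x) := fun μ x => by simp [hT]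
  have hor : ∀ μ ∈ G, ∀ x, x ∉ T μ → μ x ∈ T μ := by
    intro μ hμ x hx
    rw [memT, h1 μ hμ]
    rw [memT, not_lt] at hx
    exact lt_of_le_of_ne hx fun h => h2 μ hμ x (einj h)
  have hcard : ∀ μ ∈ G, (T μ).card = m := by
    intro μ hμ
    have hinj : Function.Injective μ := fun x y hxy => by rw [← h1 μ hμ x, hxy, h1 μ hμ]
    have h3 : (T μ)ᶜ = (T μ).image μ := by
      ext x
      rw [Finset.mem_compl, Finset.mem_image]
      constructor
      · exact fun hx => ⟨μ x, hor μ hμ x hx, h1 μ hμ x⟩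
      · rintro ⟨y, hy, rfl⟩ hx
        rw [memT] at hx hy
        rw [h1 μ hμ] at hx
        exact lt_asymm hx hy
    have h4 := Finset.card_add_card_compl (T μ)
    rw [h3, Finset.card_image_of_injective _ hinj, hX] at h4
    omega
  set F : (X → X) → Σ s : Finset X, (s → X) := fun μ => ⟨T μ, fun x => μ x⟩ with hF
  set B : Finset (Σ s : Finset X, (s → X)) :=
    (Finset.powersetCard m Finset.univ).sigma fun _ => Finset.univ with hB
  have hB' : B.card ≤ 4 ^ m * (2 * m) ^ m := by
    rw [hB, Finset.card_sigma]
    calc ∑ s ∈ Finset.powersetCard m (Finset.univ : Finset X),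
          (Finset.univ : Finset (s → X)).card
        = ∑ s ∈ Finset.powersetCard m (Finset.univ : Finset X), (2 * m) ^ m := by
          refine Finset.sum_congr rfl fun s hs => ?_
          rw [Finset.card_univ, Fintype.card_fun, hX, Fintype.card_coe,
            (Finset.mem_powersetCard.1 hs).2]
      _ = (2 * m).choose m * (2 * m) ^ m := by
          rw [Finset.sum_const, Finset.card_powersetCard, Finset.card_univ, hX, smul_eq_mul]
      _ ≤ 4 ^ m * (2 * m) ^ m := by
          refine Nat.mul_le_mul_right _ ((Nat.choose_le_two_pow _ _).trans (le_of_eq ?_))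
          rw [pow_mul]; norm_num
  refine le_trans (Finset.card_le_card_of_injOn F (fun μ hμ => ?_) ?_) hB'
  · exact Finset.mem_sigma.2 ⟨Finset.mem_powersetCard.2 ⟨Finset.subset_univ _, hcard μ hμ⟩,
      Finset.mem_univ _⟩
  · intro μ hμ ν hν h
    have h3 : T μ = T ν := congrArg Sigma.fst h
    have h4 : ∀ x ∈ T μ, μ x = ν x := by
      have h5 : ∀ (s : Finset X) (hs : T μ = s) (g : s → X),
          F μ = ⟨s, g⟩ → ∀ x (hx : x ∈ s), μ x = g ⟨x, hx⟩ := by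
        rintro s rfl g hg x hx
        exact congrFun (eq_of_heq (Sigma.mk.inj hg).2) ⟨x, hx⟩
      intro x hx
      exact h5 _ h3 _ h x (h3 ▸ hx)
    funext x
    by_cases hx : x ∈ T μ
    · exact h4 x hx
    · have h5 := h4 _ (hor μ hμ x hx)
      rw [h1 μ hμ] at h5
      have h6 := congrArg ν h5
      rw [h1 ν hν] at h6
      exact h6.symm

namespace DecompCode

variable {n : ℕ}

/-- The twists and lengths of a code, in a form without redundancy. -/
noncomputable def gaps (ω : DecompCode n) (x : Fin n × Fin 3) : ℕ :=
  if Fintype.equivFin _ x < Fintype.equivFin _ (ω.matching x) then ω.twist x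
  else ω.length x - 1 - ω.twist x

/-- A length `ℓ` with a twist below `ℓ` amounts to two natural numbers of sum `ℓ - 1`, one for each
side of the curve. In this form lengths and twists are counted together, without side conditions. -/
theorem Valid.gaps_add {ω : DecompCode n} {N M : ℕ} (h : ω.Valid N M) (x : Fin n × Fin 3) :
    ω.gaps x + ω.gaps (ω.matching x) + 1 = ω.length x := by
  have h1 := h.twist_lt x
  have h2 : Fintype.equivFin _ x ≠ Fintype.equivFin _ (ω.matching x) := fun h3 =>
    h.matching_ne x ((Fintype.equivFin _).injective h3).symm
  rw [gaps, gaps, h.matching_matching, h.length_matching, h.twist_matching]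
  rcases lt_or_gt_of_ne h2 with h3 | h3
  · rw [if_pos h3, if_neg h3.le.not_gt]; omega
  · rw [if_neg h3.le.not_gt, if_pos h3]; omega

theorem Valid.sum_gaps {ω : DecompCode n} {N M : ℕ} (h : ω.Valid N M) :
    2 * ∑ x, ω.gaps x + 3 * n ≤ M := by
  have h1 : ∑ x, ω.gaps (ω.matching x) = ∑ x, ω.gaps x :=
    Equiv.sum_comp (Function.Involutive.toPerm ω.matching h.matching_matching) ω.gaps
  have h2 : ∑ x, (ω.gaps x + ω.gaps (ω.matching x) + 1) = ∑ x, ω.length x :=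
    Finset.sum_congr rfl fun x _ => h.gaps_add x
  rw [Finset.sum_add_distrib, Finset.sum_add_distrib, h1] at h2
  have h3 := h.sum_length
  simp only [Finset.sum_const, Finset.card_univ, Fintype.card_prod, Fintype.card_fin,
    smul_eq_mul, mul_one] at h2
  omega

theorem Valid.ext {ω ω' : DecompCode n} {N M : ℕ} (h : ω.Valid N M) (h' : ω'.Valid N M)
    (h1 : ω.codes = ω'.codes) (h2 : ω.matching = ω'.matching) (h3 : ω.gaps = ω'.gaps) :
    ω = ω' := by
  have hl : ω.length = ω'.length := by
    funext x
    rw [← h.gaps_add, ← h'.gaps_add, h2, h3]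
  have ht : ω.twist = ω'.twist := by
    funext x
    have e1 := congrFun h3 x
    have e2 := h.twist_lt x
    have e3 := h'.twist_lt x
    have e4 := congrFun hl x
    rw [gaps, gaps, h2, hl] at e1
    split_ifs at e1 <;> omega
  exact DecompCode.ext h1 h2 hl ht

/-- The number of codes. -/
theorem card_le {m N M : ℕ} (hn : 3 * n = 2 * m) (hn0 : 0 < n) (G : Finset (DecompCode n))
    (hG : ∀ ω ∈ G, ω.Valid N M) {s : ℕ} (hs : M ≤ 2 * s + 3 * n + 1) :
    (G.card : ℝ) ≤ (64 ^ (6 * N + 18 * n) * 2 ^ n) * (4 ^ m * (2 * m) ^ m) *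
      (Real.exp (2 * m) * ((s + 1 + 2 * m : ℝ) / (2 * m)) ^ (2 * m)) := by
  have : Nonempty (Fin n × Fin 3) := ⟨(⟨0, hn0⟩, 0)⟩
  have hX : Fintype.card (Fin n × Fin 3) = 2 * m := by
    rw [Fintype.card_prod, Fintype.card_fin, Fintype.card_fin]; omega
  have h1 : ((G.image DecompCode.codes).card : ℝ) ≤ 64 ^ (6 * N + 18 * n) * 2 ^ n := by
    have h2 := card_mul_pow_le (f := fun c : PantsCode => c.1) (z := 1 / 64) (by norm_num)
      (by norm_num) sum_pantsCode_le (G.image DecompCode.codes) (s := 6 * N + 18 * n) (by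
        intro x hx
        obtain ⟨ω, hω, rfl⟩ := Finset.mem_image.1 hx
        exact (hG ω hω).sum_codes)
    rw [Fintype.card_fin, one_div, inv_pow, ← div_eq_mul_inv, div_le_iff₀ (by positivity)] at h2
    linarith
  have h2 : ((G.image DecompCode.matching).card : ℝ) ≤ 4 ^ m * (2 * m) ^ m := by
    have h3 := card_matchings_le hX (G.image DecompCode.matching) (by
        intro x hx
        obtain ⟨ω, hω, rfl⟩ := Finset.mem_image.1 hx
        exact (hG ω hω).matching_matching) (by
        intro x hx
        obtain ⟨ω, hω, rfl⟩ := Finset.mem_image.1 hx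
        exact (hG ω hω).matching_ne)
    exact_mod_cast h3
  have h3 : ((G.image DecompCode.gaps).card : ℝ) ≤
      Real.exp (2 * m) * ((s + 1 + 2 * m : ℝ) / (2 * m)) ^ (2 * m) := by
    -- Twice the sum of the gaps is at most `M - 3 * n ≤ 2 * s + 1`, so the sum is at most `s`.
    have h4 := card_le_of_sum_le (G.image DecompCode.gaps) (s := s) (by
        intro x hx
        obtain ⟨ω, hω, rfl⟩ := Finset.mem_image.1 hx
        have := (hG ω hω).sum_gaps
        omega)
    rw [hX] at h4
    exact_mod_cast h4
  have h4 : G.card ≤ (G.image DecompCode.codes).card * (G.image DecompCode.matching).card *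
      (G.image DecompCode.gaps).card := by
    rw [← Finset.card_product, ← Finset.card_product]
    refine Finset.card_le_card_of_injOn (fun ω => ((ω.codes, ω.matching), ω.gaps))
      (fun ω hω => ?_) fun ω hω ω' hω' h => ?_
    · exact Finset.mem_product.2 ⟨Finset.mem_product.2 ⟨Finset.mem_image_of_mem _ hω,
        Finset.mem_image_of_mem _ hω⟩, Finset.mem_image_of_mem _ hω⟩
    · simp only [Prod.mk.injEq] at h
      exact (hG ω hω).ext (hG ω' hω') h.1.1 h.1.2 h.2
  calc (G.card : ℝ) ≤ (G.image DecompCode.codes).card * (G.image DecompCode.matching).card *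
      (G.image DecompCode.gaps).card := by exact_mod_cast h4
    _ ≤ _ := by gcongr

/-- Up to the labels of the pairs of pants, the codes determine the surfaces. -/
theorem card_mul_factorial_le {N M : ℕ} (hn0 : 0 < n) (A : Finset (CombMod N))
    (hA : ∀ x ∈ A, ∃ (S : CombSurface N) (ω : DecompCode n), Quotient.mk _ S = x ∧
      ω.Describes S ∧ ω.Valid N M) :
    ∃ G : Finset (DecompCode n), (∀ ω ∈ G, ω.Valid N M) ∧ A.card * n.factorial ≤ n * G.card := by
  rcases A.eq_empty_or_nonempty with rfl | ⟨x₀, hx₀⟩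
  · exact ⟨∅, by simp, by simp⟩
  obtain ⟨S₀, ω₀, -⟩ := hA x₀ hx₀
  have : Nonempty (CombSurface N) := ⟨S₀⟩
  have : Nonempty (DecompCode n) := ⟨ω₀⟩
  choose! S ω hS hω hv using hA
  set F : CombMod N × Perm (Fin n) → DecompCode n := fun p => (ω p.1).relabel p.2 with hF
  set B : Finset (CombMod N × Perm (Fin n)) := A ×ˢ Finset.univ with hB
  refine ⟨B.image F, ?_, ?_⟩
  · intro ω' hω'
    obtain ⟨p, hp, rfl⟩ := Finset.mem_image.1 hω'
    exact (hv p.1 (Finset.mem_product.1 hp).1).relabel p.2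
  · have h1 : B.card = A.card * n.factorial := by
      rw [hB, Finset.card_product, Finset.card_univ, Fintype.card_perm, Fintype.card_fin]
    rw [← h1]
    -- A relabelled code determines the surface, and, the code being connected, the relabeling is
    -- fixed by the image of one label. So each code arises at most `n` times.
    refine Finset.card_le_mul_card_image B n fun ω' _ => ?_
    have h2 : (Finset.univ : Finset (Fin n)).card = n := by simp
    conv_rhs => rw [← h2]
    refine Finset.card_le_card_of_injOn (fun p => p.2 ⟨0, hn0⟩) (fun _ _ => Finset.mem_univ _) ?_
    rintro ⟨x, θ⟩ hp ⟨y, θ'⟩ hq hpq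
    have hp' := Finset.mem_filter.1 hp
    have hq' := Finset.mem_filter.1 hq
    have hx : x ∈ A := (Finset.mem_product.1 hp'.1).1
    have hy : y ∈ A := (Finset.mem_product.1 hq'.1).1
    have heq : (ω x).relabel θ = (ω y).relabel θ' := hp'.2.trans hq'.2.symm
    have hxy : x = y := by
      rw [← hS x hx, ← hS y hy]
      refine Quotient.sound ?_
      have h3 := (hω x hx).relabel θ
      rw [heq] at h3
      exact h3.equivalent ((hω y hy).relabel θ')
    subst hxy
    rw [(hv x hx).relabel_injOn heq hpq]

end DecompCode

end Counting

/-! ### The final estimate -/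

/-- The genus is bounded by the number of triangles. -/
theorem CombSurface.HasGenus.le_card {N g : ℕ} {S : CombSurface N} (h : S.HasGenus g) : g ≤ N := by
  obtain ⟨⟨⟨d⟩, -⟩, h2⟩ := h
  have h3 : 2 * Nat.card S.toMap.Edge = Nat.card (Side N) := S.toMap.two_mul_numCycles_edge
  have h4 : Nat.card (Side N) = N * 3 := by
    rw [Nat.card_eq_fintype_card, Fintype.card_prod, Fintype.card_fin, ZMod.card]
  have : Nonempty S.toMap.Vertex := ⟨S.toMap.vertexOf d⟩
  have : Nonempty S.toMap.Face := ⟨S.toMap.faceOf d⟩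
  -- With at least one vertex and one face, `2 - 2 * g` is at least two minus the number `3 * N / 2`
  -- of edges.
  have hv : 0 < Nat.card S.toMap.Vertex := Nat.card_pos
  have hf : 0 < Nat.card S.toMap.Face := Nat.card_pos
  rw [CombMap.eulerChar] at h2
  omega

/-- The constant in the exponential factor. -/
noncomputable def growthConstant : ℝ := 64 ^ 37 * 4 ^ 2 * 27 * 2 * Real.exp 8

theorem one_le_growthConstant : 1 ≤ growthConstant := by
  rw [growthConstant]
  have h1 : (1 : ℝ) ≤ Real.exp 8 := Real.one_le_exp (by norm_num)
  nlinarith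

/-- With `p = g - 1`, the matchings contribute `(6 * p) ^ (3 * p)` and the labels take away about
`(2 * p) ^ (2 * p)`; a factor `p ^ p` survives. All that is exponential in `p` is absorbed by
`growthConstant ^ N`, as `p ≤ N`. -/
theorem le_of_mul_factorial_le {p N s : ℕ} {a G L : ℝ} (hp : 0 < p) (hpN : p ≤ N)
    (ha : 0 ≤ a) (haG : a * (2 * p).factorial ≤ (2 * p : ℕ) * G)
    (hG : G ≤ (64 ^ (6 * N + 18 * (2 * p)) * 2 ^ (2 * p)) *
      (4 ^ (3 * p) * (2 * (3 * p : ℕ)) ^ (3 * p)) *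
      (Real.exp (2 * (3 * p : ℕ)) *
        ((s + 1 + 2 * (3 * p : ℕ) : ℝ) / (2 * (3 * p : ℕ))) ^ (2 * (3 * p))))
    (hL : s + 3 * p ≤ L) :
    a ≤ (64 ^ 6 * growthConstant) ^ N * ((p + 1 : ℕ) : ℝ) ^ (p + 1) *
      (L / (p + 1 : ℕ)) ^ (6 * (p + 1)) := by
  have hp1 : (1 : ℝ) ≤ p := by exact_mod_cast hp
  have hp0 : (0 : ℝ) < p := by linarith
  have hs0 : (0 : ℝ) ≤ s := Nat.cast_nonneg s
  have hfac : (2 * p : ℝ) ^ (2 * p) ≤ Real.exp (2 * p) * (2 * p).factorial := by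
    have h1 := Real.pow_div_factorial_le_exp (2 * p : ℝ) (by positivity) (2 * p)
    rwa [div_le_iff₀ (by positivity)] at h1
  have hpow : ((s + 1 + 2 * (3 * p : ℕ) : ℝ) / (2 * (3 * p : ℕ))) ^ (2 * (3 * p)) ≤
      (L / (p + 1 : ℕ)) ^ (6 * (p + 1)) := by
    -- From `L ≥ 3 * p ≥ p + 1`; so the exponent may be raised from `6 * p` to `6 * (p + 1)`.
    have h1 : (1 : ℝ) ≤ L / (p + 1 : ℕ) := by
      rw [le_div_iff₀ (by positivity)]; push_cast; linarith
    calc ((s + 1 + 2 * (3 * p : ℕ) : ℝ) / (2 * (3 * p : ℕ))) ^ (2 * (3 * p))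
        ≤ (L / (p + 1 : ℕ)) ^ (2 * (3 * p)) := by
          refine pow_le_pow_left₀ (by positivity) ?_ _
          rw [div_le_div_iff₀ (by positivity) (by positivity)]
          push_cast
          nlinarith
      _ ≤ _ := pow_le_pow_right₀ h1 (by omega)
  set R : ℝ := (L / (p + 1 : ℕ)) ^ (6 * (p + 1)) with hR
  have hR0 : 0 ≤ R := le_trans (by positivity) hpow
  -- This absorbs the factor `2 * p` that comes from the symmetries of labelled codes.
  have h2p : (2 * p : ℝ) ≤ 4 ^ p := by
    have : 2 * p ≤ 4 ^ p := by
      have h1 : p < 2 ^ p := Nat.lt_two_pow_self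
      have h2 : 2 ^ 1 ≤ 2 ^ p := Nat.pow_le_pow_right (by norm_num) hp
      calc 2 * p ≤ 2 ^ p * 2 ^ p := Nat.mul_le_mul (by simpa using h2) h1.le
        _ = 4 ^ p := by rw [← mul_pow]; norm_num
    exact_mod_cast this
  have hpp : (p : ℝ) ^ p ≤ ((p + 1 : ℕ) : ℝ) ^ (p + 1) := by
    have : p ^ p ≤ (p + 1) ^ (p + 1) :=
      (Nat.pow_le_pow_left (Nat.le_succ p) p).trans (Nat.pow_le_pow_right (Nat.succ_pos p) (Nat.le_succ p))
    exact_mod_cast this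
  have key : a * (2 * p : ℝ) ^ (2 * p) ≤
      ((64 ^ 6) ^ N * growthConstant ^ p * (p : ℝ) ^ p * R) * (2 * p : ℝ) ^ (2 * p) := by
    calc a * (2 * p : ℝ) ^ (2 * p) ≤ a * (Real.exp (2 * p) * (2 * p).factorial) := by gcongr
      _ = Real.exp (2 * p) * (a * (2 * p).factorial) := by ring
      _ ≤ Real.exp (2 * p) * ((2 * p : ℕ) * G) := by gcongr
      _ ≤ Real.exp (2 * p) * (4 ^ p * ((64 ^ (6 * N + 18 * (2 * p)) * 2 ^ (2 * p)) *
          (4 ^ (3 * p) * (2 * (3 * p : ℕ)) ^ (3 * p)) * (Real.exp (2 * (3 * p : ℕ)) * R))) := by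
        refine mul_le_mul_of_nonneg_left ?_ (Real.exp_pos _).le
        push_cast at hG ⊢
        push_cast at hpow
        calc 2 * (p : ℝ) * G ≤ 2 * p * _ := mul_le_mul_of_nonneg_left hG (by positivity)
          _ ≤ _ := by gcongr
      _ = _ := by
        have e1 : Real.exp (2 * p) = Real.exp 2 ^ p := by rw [← Real.exp_nat_mul, mul_comm]
        have e2 : Real.exp (2 * (3 * p : ℕ)) = Real.exp 6 ^ p := by
          rw [← Real.exp_nat_mul]; congr 1; push_cast; ring
        have e3 : Real.exp 8 = Real.exp 2 * Real.exp 6 := by rw [← Real.exp_add]; norm_num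
        have e4 : (2 * (3 * p : ℕ) : ℝ) ^ (3 * p) = 27 ^ p * 2 ^ p * p ^ p * (2 * p) ^ (2 * p) := by
          have : (2 * (3 * p : ℕ) : ℝ) = 3 * (2 * p) := by push_cast; ring
          rw [this, mul_pow, pow_mul, show 3 * p = p + 2 * p by ring, pow_add, mul_pow 2 (p : ℝ) p]
          norm_num
          ring
        rw [e1, e2, e4, growthConstant, e3, pow_add, pow_mul, pow_mul 2 2 p, pow_mul 4 3 p,
          show 18 * (2 * p) = 36 * p by ring, pow_mul 64 36 p]
        -- The factors per `p`: 4 from the symmetries, `64 ^ 36 * 2 ^ 2` from the codes of two pairs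
        -- of pants, and `4 ^ 3` from the choice of left ends in the matchings.
        have e5 : (64 : ℝ) ^ 37 * 4 ^ 2 = 4 * (64 ^ 36) * 2 ^ 2 * 4 ^ 3 := by norm_num
        rw [e5]
        simp only [mul_pow _ _ p]
        ring
  have h1 := le_of_mul_le_mul_right key (by positivity)
  have hK := one_le_growthConstant
  calc a ≤ (64 ^ 6) ^ N * growthConstant ^ p * (p : ℝ) ^ p * R := h1
    _ ≤ (64 ^ 6) ^ N * growthConstant ^ N * ((p + 1 : ℕ) : ℝ) ^ (p + 1) * R := by
      gcongr
    _ = _ := by rw [mul_pow]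

theorem mainTheorem3 :
    ∃ c : ℝ, 0 < c ∧ ∀ (N g : ℕ) (L : ℝ), 2 ≤ g →
      ((tightlyDecomposable N g L).ncard : ℝ) ≤
        Real.exp (c * N) * (g : ℝ) ^ g * (L / g) ^ (6 * g) := by
  have hK := one_le_growthConstant
  have hK1 : 1 < 64 ^ 6 * growthConstant := by linarith
  refine ⟨Real.log (64 ^ 6 * growthConstant), Real.log_pos hK1, fun N g L hg => ?_⟩
  have hexp : Real.exp (Real.log (64 ^ 6 * growthConstant) * N) =
      (64 ^ 6 * growthConstant) ^ N := by
    rw [mul_comm, Real.exp_nat_mul, Real.exp_log (by linarith)]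
  rw [hexp]
  obtain ⟨p, rfl⟩ : ∃ p, g = p + 1 := ⟨g - 1, by omega⟩
  have hp : 0 < p := by omega
  have hn : 2 * (p + 1) - 2 = 2 * p := by omega
  rcases (tightlyDecomposable N (p + 1) L).eq_empty_or_nonempty with h0 | ⟨x₀, hx₀⟩
  -- `L` may be negative here; the bound is still nonnegative because the exponent is even.
  · have h6 : 0 ≤ (L / ((p + 1 : ℕ) : ℝ)) ^ (6 * (p + 1)) :=
      Even.pow_nonneg ⟨3 * (p + 1), by ring⟩ _
    rw [h0, Set.ncard_empty, Nat.cast_zero]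
    positivity
  have : Finite (CombSurface N) := Finite.of_injective CombSurface.glue fun S T h =>
    CombSurface.ext h
  have : Finite (CombMod N) := Quotient.finite _
  have hfin := Set.toFinite (tightlyDecomposable N (p + 1) L)
  have hA : ∀ x ∈ hfin.toFinset, ∃ (S : CombSurface N) (ω : DecompCode (2 * p)),
      Quotient.mk _ S = x ∧ ω.Describes S ∧ ω.Valid N ⌊2 * L⌋₊ := by
    intro x hx
    obtain ⟨S, hS, hgen, h⟩ := hfin.mem_toFinset.1 hx
    rw [hn] at h
    obtain ⟨Q, hQ, hQL⟩ := h
    obtain ⟨ω, h1, h2⟩ := DecompCode.exists_describes hgen.1 Q hQ hQL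
    exact ⟨S, ω, hS, h1, h2⟩
  obtain ⟨S₀, _, hgen, _⟩ := id hx₀
  obtain ⟨-, ω₀, -, -, hω₀⟩ := hA x₀ (hfin.mem_toFinset.2 hx₀)
  obtain ⟨G, hG, hcard⟩ := DecompCode.card_mul_factorial_le (by omega) _ hA
  set M := ⌊2 * L⌋₊ with hM
  have hsum := hω₀.sum_gaps
  have hML : (M : ℝ) ≤ 2 * L := by
    refine Nat.floor_le ?_
    -- A negative `L` would make `M` zero, but a valid code requires `3 * n ≤ M` with `n` positive.
    by_contra h
    rw [hM, Nat.floor_of_nonpos (by linarith)] at hsum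
    omega
  have hs : ((M - 6 * p) / 2 : ℕ) + 3 * (p : ℝ) ≤ L := by
    have h1 : 2 * ((M - 6 * p) / 2) + 6 * p ≤ M := by omega
    have h2 : 2 * (((M - 6 * p) / 2 : ℕ) : ℝ) + 6 * p ≤ M := by exact_mod_cast h1
    linarith
  have hGcard := DecompCode.card_le (m := 3 * p) (s := (M - 6 * p) / 2) (by omega) (by omega) G hG
    (by omega)
  rw [Set.ncard_eq_toFinset_card _ hfin]
  exact le_of_mul_factorial_le hp (by have := hgen.le_card; omega) (Nat.cast_nonneg _)
    (by exact_mod_cast hcard) hGcard hs
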